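/- Let $\Omega=(0,1)^2\subset\mathbb{R}^2$. For a real $n\times n$ matrix $M$ with singular values $s_1,\dots,s_n$, let $|M|_p=\|(s_1,\dots,s_n)\|_{\ell^p}$ be the Schatten $p$-norm. For $f\in L^1_{\mathrm{loc}}(\Omega)$ define the Hessian–Schatten total variation (with $p=1$) $$|D^2_1 f|(\Omega)=\sup\Big\{\int_\Omega \sum_{i,j=1}^{2} f\,\partial_i\partial_j F_{i,j}\,dx \;:\; F\in C_c^\infty(\Omega)^{2\times 2},\ \big\||F|_\infty\big\|_{L^\infty(\mathbb{R}^2)}\le 1\Big\}\in[0,\infty],$$ and say that $f$ has bounded Hessian–Schatten variation in $\Omega$ if $|D^2_1 f|(\Omega)<\infty$. A function $g\in C(\Omega)$ belongs to $\mathrm{CPWL}(\Omega)$ if there is a decomposition $\{P_k\}_k$ of $\mathbb{R}^2$ into two-dimensional convex polytopes (convex hulls of finitely many points), intersecting only at their boundaries, such that $g$ is affine on $P_k\cap\Omega$ for every $k$ and every ball meets only finitely many of the $P_k$. Theorem. Let $f\in L^1_{\mathrm{loc}}(\Omega)$ have bounded Hessian–Schatten variation in $\Omega$. Then $f\in L^\infty(\Omega)$,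 and there exists a sequence $(f_k)_{k}$ of functions in $\mathrm{CPWL}(\Omega)\cap L^\infty(\Omega)$ with bounded Hessian–Schatten variation in $\Omega$ such that $\|f_k-f\|_{L^\infty(\Omega)}\to 0$ and $|D^2_1 f_k|(\Omega)\to|D^2_1 f|(\Omega)$ as $k\to\infty$. In other words, $\mathrm{CPWL}(\Omega)$ is dense in energy $|D^2_1\,\cdot\,|(\Omega)$ in $\{f\in L^1_{\mathrm{loc}}(\Omega): |D^2_1 f|(\Omega)<\infty\}$ with respect to the $L^\infty(\Omega)$ topology. -/

import Mathlib

open MeasureTheory Set Filter Topology TopologicalSpace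
open scoped ENNReal Distributions

namespace HTV

/-- The Schatten `p`-norm of a real `n × n` matrix: the `ℓ^p` norm of its `n` singular values,
counted with multiplicity (`p ∈ [1, ∞]`). -/
noncomputable def schattenNorm {n : ℕ} (p : ℝ≥0∞) (M : Matrix (Fin n) (Fin n) ℝ) : ℝ :=
  ‖WithLp.toLp p (fun i : Fin n => (Matrix.toEuclideanLin M).singularValues i)‖

/-- The `L^r`-Schatten `p`-norm of a matrix field on `ℝⁿ`: the `L^r(ℝⁿ)` norm of the
function `x ↦ |M x|_p`. -/
noncomputable def lrSchattenNorm {n : ℕ} (p r : ℝ≥0∞)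
    (M : EuclideanSpace ℝ (Fin n) → Matrix (Fin n) (Fin n) ℝ) : ℝ≥0∞ :=
  eLpNorm (fun x => schattenNorm p (M x)) r volume

/-- The partial derivative `∂_i φ` of a function on `ℝⁿ` (used for smooth functions only). -/
noncomputable def partialDeriv {n : ℕ} (i : Fin n) (φ : EuclideanSpace ℝ (Fin n) → ℝ) :
    EuclideanSpace ℝ (Fin n) → ℝ :=
  fun x => fderiv ℝ φ x (EuclideanSpace.single i 1)

/-- The Hessian–Schatten total variation `|D²_p f|(A)` of `f` on an open set `A ⊆ ℝⁿ`: the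
supremum of `∫_A ∑_{i,j} f ∂_i ∂_j F_{i,j}` over all `F ∈ C_c^∞(A)^{n × n}` whose
`L^∞`-Schatten `p*`-norm is at most `1`, where `p*` is the conjugate exponent of `p`.
(`F = 0` is admissible, so the supremum may be taken in `[0, ∞]`.) -/
noncomputable def hessianSchattenVariation {n : ℕ} (p : ℝ≥0∞)
    (f : EuclideanSpace ℝ (Fin n) → ℝ) (A : Opens (EuclideanSpace ℝ (Fin n))) : ℝ≥0∞ :=
  ⨆ (F : Matrix (Fin n) (Fin n) 𝓓(A, ℝ))
    (_ : lrSchattenNorm (ENNReal.conjExponent p) ∞ (fun x => F.map (fun φ => φ x)) ≤ 1),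
    ENNReal.ofReal
      (∫ x in (A : Set (EuclideanSpace ℝ (Fin n))),
        ∑ i, ∑ j, f x * partialDeriv i (partialDeriv j (F i j)) x)

/-- `f ∈ L¹_loc(Ω)` and `f` has bounded `p`-Hessian–Schatten variation in `Ω`. Only the values
of `f` on `Ω` matter. -/
def HasBoundedHSV {n : ℕ} (p : ℝ≥0∞) (f : EuclideanSpace ℝ (Fin n) → ℝ)
    (Ω : Opens (EuclideanSpace ℝ (Fin n))) : Prop :=
  LocallyIntegrableOn f (Ω : Set (EuclideanSpace ℝ (Fin n))) volume ∧
    hessianSchattenVariation p f Ω < ∞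

/-- A decomposition of `ℝⁿ` into `n`-dimensional convex polytopes (convex hulls of finitely many
points, with nonempty interior), intersecting only at their boundaries, such that every ball
meets only finitely many of them. -/
structure IsPolytopeDecomposition {n : ℕ} (T : Set (Set (EuclideanSpace ℝ (Fin n)))) : Prop where
  polytope : ∀ P ∈ T, ∃ s : Finset (EuclideanSpace ℝ (Fin n)),
    P = convexHull ℝ (s : Set (EuclideanSpace ℝ (Fin n)))
  fullDim : ∀ P ∈ T, (interior P).Nonempty
  cover : ⋃₀ T = univ
  inter : ∀ P ∈ T, ∀ Q ∈ T, P ≠ Q → P ∩ Q ⊆ frontier P ∩ frontier Q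
  locallyFinite : ∀ (x : EuclideanSpace ℝ (Fin n)) (r : ℝ),
    {P ∈ T | (P ∩ Metric.ball x r).Nonempty}.Finite

/-- `f ∈ CPWL(Ω)`: `f` is continuous on `Ω`, and for some decomposition of `ℝⁿ` into polytopes
`P` as above, `f` is affine on each `P ∩ Ω`. Only the values of `f` on `Ω` matter. -/
def IsCPWL {n : ℕ} (f : EuclideanSpace ℝ (Fin n) → ℝ)
    (Ω : Opens (EuclideanSpace ℝ (Fin n))) : Prop :=
  ContinuousOn f (Ω : Set (EuclideanSpace ℝ (Fin n))) ∧
    ∃ T : Set (Set (EuclideanSpace ℝ (Fin n))), IsPolytopeDecomposition T ∧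
      ∀ P ∈ T, ∃ a : EuclideanSpace ℝ (Fin n) →ᵃ[ℝ] ℝ,
        EqOn f a (P ∩ (Ω : Set (EuclideanSpace ℝ (Fin n))))

/-- The open unit square `(0,1)²` in the Euclidean plane. -/
def unitSquare : Opens (EuclideanSpace ℝ (Fin 2)) where
  carrier := {x | ∀ i, x i ∈ Ioo (0 : ℝ) 1}
  is_open' := by
    simp only [Set.ofPred_forall]
    exact isOpen_iInter_of_finite fun i =>
      isOpen_Ioo.preimage (by fun_prop : Continuous fun x : EuclideanSpace ℝ (Fin 2) => x i)

end HTV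

/-! The variation is a supremum of the linear functionals `f ↦ ∫ f div div F` over fields `F` of
operator norm at most one, hence lower semicontinuous. So it suffices to build piecewise affine
functions that are uniformly close to `f` and whose energy exceeds that of `f` by arbitrarily little
(`exists_PL_near`, `tendsto_hsv`).

Convexity controls the energy. A convex `c` has nonnegative Hessian, whose trace norm is its trace,
so the energy of `c` weighted by `χ` is at most `∫ c Δχ` (`pr_le_of_convex`). This bound is
continuous in `c` for uniform convergence. Replacing a convex function by a maximum of finitely many
tangent planes (`exists_convexPL_near`) therefore costs almost nothing in energy.

For smooth `f`, take a fine grid of squares on which the Hessian is almost constant. On each square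
write `f = (f + β) - β`, where the Hessian of the quadratic `β` is slightly more than the negative
part of that of `f`. Both terms are convex there and the sum of their Laplacians is nearly the trace
norm of the Hessian of `f`. Both are replaced by convex piecewise affine functions. A single crude
splitting with a large quadratic `β₀` serves on the thin gaps between the squares, where the energy
density is only bounded. The two descriptions are glued by an explicit truncation that remains a
difference of convex piecewise affine functions (`exists_patch`, `exists_PL_of_squares`,
`exists_PL_near_smooth`). A continuous function with finitely many affine pieces is CPWL for the
arrangement of lines where two pieces agree, refined by the integer grid (`IsPL.isCPWL`).

For general `f`, contract the square towards its centre and mollify. In dimension two the energy is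
invariant under scaling, so this does not increase it (`hsv_regularize_le`). Uniform convergence is
the critical embedding of functions with integrable second derivatives into continuous functions.
The value at a point differs from a weighted mean by at most a scale-independent constant times the
energy near the point (`exists_abs_sub_integral_le_capBall`), and that energy is uniformly small on
small balls because the Hessian measure has no atoms (`hsv_le_diff_singleton`,
`exists_forall_hsv_capBall_le`). The regularizations are thus uniformly Cauchy, and their limit is
`f` almost everywhere (`exists_smooth_near`). -/

namespace HTV

/-! ### Directional derivatives, test functions, and the operator norm in bilinear form. -/

/-- The Euclidean plane. -/
abbrev Plane := EuclideanSpace ℝ (Fin 2)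

/-- Smooth functions on the plane. -/
abbrev Smooth (φ : Plane → ℝ) : Prop := ContDiff ℝ ((⊤ : ℕ∞) : WithTop ℕ∞) φ

/-- The standard basis vectors. -/
noncomputable abbrev bas (i : Fin 2) : Plane := EuclideanSpace.single i (1 : ℝ)

/-- The directional derivative of `φ` in the direction `e`. -/
noncomputable def dd (e : Plane) (φ : Plane → ℝ) : Plane → ℝ := fun x => fderiv ℝ φ x e

theorem partialDeriv_eq_dd (i : Fin 2) (φ : Plane → ℝ) : partialDeriv i φ = dd (bas i) φ := rfl

theorem Smooth.differentiable {φ : Plane → ℝ} (h : Smooth φ) : Differentiable ℝ φ :=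
  ContDiff.differentiable h (by simp)

theorem Smooth.dd {φ : Plane → ℝ} (h : Smooth φ) (e : Plane) : Smooth (dd e φ) :=
  (h.fderiv_right (m := ((⊤ : ℕ∞) : WithTop ℕ∞)) (by simp)).clm_apply contDiff_const

theorem dd_add {φ ψ : Plane → ℝ} (hφ : Smooth φ) (hψ : Smooth ψ) (e : Plane) :
    dd e (fun x => φ x + ψ x) = fun x => dd e φ x + dd e ψ x := by
  funext x
  simp only [dd]
  rw [fderiv_fun_add (hφ.differentiable x) (hψ.differentiable x)]; rfl

theorem dd_sub {φ ψ : Plane → ℝ} (hφ : Smooth φ) (hψ : Smooth ψ) (e : Plane) :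
    dd e (fun x => φ x - ψ x) = fun x => dd e φ x - dd e ψ x := by
  funext x
  simp only [dd]
  rw [fderiv_fun_sub (hφ.differentiable x) (hψ.differentiable x)]; rfl

theorem dd_neg (φ : Plane → ℝ) (e : Plane) :
    dd e (fun x => - φ x) = fun x => - dd e φ x := by
  funext x
  simp only [dd]
  rw [fderiv_fun_neg]; rfl

theorem dd_const_mul {φ : Plane → ℝ} (hφ : Smooth φ) (c : ℝ) (e : Plane) :
    dd e (fun x => c * φ x) = fun x => c * dd e φ x := by
  funext x
  simp only [dd]
  rw [fderiv_const_mul (hφ.differentiable x)]; rfl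

theorem dd_mul {φ ψ : Plane → ℝ} (hφ : Smooth φ) (hψ : Smooth ψ) (e : Plane) :
    dd e (fun x => φ x * ψ x) = fun x => φ x * dd e ψ x + ψ x * dd e φ x := by
  funext x
  simp only [dd]
  rw [fderiv_fun_mul (hφ.differentiable x) (hψ.differentiable x)]; rfl

theorem dd_sum {ι : Type*} (s : Finset ι) {φ : ι → Plane → ℝ} (hφ : ∀ i ∈ s, Smooth (φ i))
    (e : Plane) : dd e (fun x => ∑ i ∈ s, φ i x) = fun x => ∑ i ∈ s, dd e (φ i) x := by
  funext x
  simp only [dd]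
  rw [fderiv_fun_sum (fun i hi => (hφ i hi).differentiable x)]
  simp

theorem dd_zero (e : Plane) : dd e (fun _ => 0) = fun _ => 0 := by
  funext x
  simp [dd]

theorem dd_vec_smul (φ : Plane → ℝ) (c : ℝ) (e : Plane) :
    dd (c • e) φ = fun x => c * dd e φ x := by
  funext x
  simp [dd]

theorem dd_dd_apply {φ : Plane → ℝ} (hφ : Smooth φ) (e e' x : Plane) :
    dd e (dd e' φ) x = fderiv ℝ (fderiv ℝ φ) x e e' := by
  have h : DifferentiableAt ℝ (fderiv ℝ φ) x :=
    (hφ.fderiv_right (m := ((⊤ : ℕ∞) : WithTop ℕ∞)) (by simp)).differentiable (by simp) x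
  have h2 : dd e' φ = fun x => fderiv ℝ φ x ((fun _ => e') x) := rfl
  rw [dd, h2, fderiv_clm_apply h (by fun_prop)]
  simp

theorem dd_comm {φ : Plane → ℝ} (hφ : Smooth φ) (e e' : Plane) :
    dd e (dd e' φ) = dd e' (dd e φ) := by
  funext x
  rw [dd_dd_apply hφ, dd_dd_apply hφ]
  exact (hφ.contDiffAt.isSymmSndFDerivAt (by
    rw [minSmoothness_of_isRCLikeNormedField]
    exact WithTop.coe_le_coe.2 (le_top : (2 : ℕ∞) ≤ ⊤))) e e'

theorem vec_eq_sum (e : Plane) : e = ∑ i, e i • bas i := by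
  ext j; fin_cases j <;> simp [bas, Fin.sum_univ_two]

theorem dd_dd_eq_sum {φ : Plane → ℝ} (hφ : Smooth φ) (e e' x : Plane) :
    dd e (dd e' φ) x = ∑ i, ∑ j, e i * e' j * dd (bas i) (dd (bas j) φ) x := by
  simp only [dd_dd_apply hφ]
  conv_lhs => rw [vec_eq_sum e, vec_eq_sum e']
  simp [Fin.sum_univ_two]
  ring

/-- Scalar test functions supported in `A`. -/
structure IsTestOn (A : Set Plane) (φ : Plane → ℝ) : Prop where
  smooth : Smooth φ
  compact : HasCompactSupport φ
  supp : tsupport φ ⊆ A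

namespace IsTestOn

variable {A B : Set Plane} {φ ψ : Plane → ℝ}

theorem continuous (h : IsTestOn A φ) : Continuous φ := h.smooth.continuous

theorem mono (h : IsTestOn A φ) (hAB : A ⊆ B) : IsTestOn B φ := ⟨h.1, h.2, h.3.trans hAB⟩

theorem eq_zero (h : IsTestOn A φ) {x : Plane} (hx : x ∉ A) : φ x = 0 :=
  image_eq_zero_of_notMem_tsupport fun h' => hx (h.supp h')

theorem zero : IsTestOn A (fun _ => 0) :=
  ⟨contDiff_const, HasCompactSupport.zero, by
    rw [show (fun _ : Plane => (0 : ℝ)) = 0 from rfl, tsupport_zero]; exact empty_subset _⟩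

theorem add (hφ : IsTestOn A φ) (hψ : IsTestOn A ψ) : IsTestOn A (fun x => φ x + ψ x) :=
  ⟨hφ.smooth.add hψ.smooth, hφ.compact.add hψ.compact,
    (tsupport_add φ ψ).trans (union_subset hφ.supp hψ.supp)⟩

theorem mul_left (hφ : IsTestOn A φ) (hψ : Smooth ψ) : IsTestOn A (fun x => ψ x * φ x) :=
  ⟨hψ.mul hφ.smooth, hφ.compact.mul_left, (tsupport_mul_subset_right).trans hφ.supp⟩

theorem mul_right (hφ : IsTestOn A φ) (hψ : Smooth ψ) : IsTestOn A (fun x => φ x * ψ x) := by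
  simpa only [mul_comm] using hφ.mul_left hψ

theorem const_mul (hφ : IsTestOn A φ) (c : ℝ) : IsTestOn A (fun x => c * φ x) :=
  hφ.mul_left contDiff_const

theorem neg (hφ : IsTestOn A φ) : IsTestOn A (fun x => - φ x) := by
  simpa using hφ.const_mul (-1)

theorem sub (hφ : IsTestOn A φ) (hψ : IsTestOn A ψ) : IsTestOn A (fun x => φ x - ψ x) := by
  simpa only [sub_eq_add_neg] using hφ.add hψ.neg

theorem sum {ι : Type*} (s : Finset ι) {φ : ι → Plane → ℝ} (hφ : ∀ i ∈ s, IsTestOn A (φ i)) :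
    IsTestOn A (fun x => ∑ i ∈ s, φ i x) := by
  classical
  induction s using Finset.induction_on with
  | empty => simpa using zero
  | insert a s ha ih =>
    simp only [Finset.sum_insert ha]
    exact (hφ a (by simp)).add (ih fun i hi => hφ i (by simp [hi]))

theorem dd (hφ : IsTestOn A φ) (e : Plane) : IsTestOn A (dd e φ) :=
  ⟨hφ.smooth.dd e, hφ.compact.fderiv_apply ℝ e, by
    refine Subset.trans ?_ hφ.supp
    refine closure_minimal (fun x hx => ?_) (isClosed_tsupport φ)
    by_contra h
    apply hx
    have : fderiv ℝ φ x = 0 := by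
      by_contra h'
      exact h (tsupport_fderiv_subset ℝ (subset_tsupport _ h'))
    simp [HTV.dd, this]⟩

theorem integrable_mul {f : Plane → ℝ} (hf : LocallyIntegrableOn f A)
    (hφ : IsTestOn A φ) : Integrable (fun x => f x * φ x) := by
  have h1 : IntegrableOn f (tsupport φ) := hf.integrableOn_compact_subset hφ.supp hφ.compact
  obtain ⟨C, hC⟩ := hφ.continuous.bounded_above_of_compact_support hφ.compact
  have h2 : IntegrableOn (fun x => f x * φ x) (tsupport φ) :=
    h1.mul_bdd hφ.continuous.aestronglyMeasurable (ae_of_all _ hC)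
  refine (integrableOn_iff_integrable_of_support_subset ?_).1 h2
  exact fun x hx => subset_tsupport _ (right_ne_zero_of_mul hx)

theorem integrable (hφ : IsTestOn A φ) : Integrable φ :=
  hφ.continuous.integrable_of_hasCompactSupport hφ.compact

theorem integrable_mul_cont {f : Plane → ℝ} (hf : Continuous f)
    (hφ : IsTestOn A φ) : Integrable (fun x => f x * φ x) :=
  (hf.mul hφ.continuous).integrable_of_hasCompactSupport hφ.compact.mul_left

end IsTestOn

theorem exists_cutoff {K U : Set Plane} (hK : IsCompact K) (hU : IsOpen U) (hKU : K ⊆ U) :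
    ∃ χ : Plane → ℝ, IsTestOn U χ ∧ (∀ x, 0 ≤ χ x) ∧ (∀ x, χ x ≤ 1) ∧
      (∀ᶠ x in 𝓝ˢ K, χ x = 1) ∧ ∀ x ∈ K, χ x = 1 := by
  obtain ⟨L, hL, hKL, hLU⟩ := exists_compact_between hK hU hKU
  obtain ⟨f, hf1, hf0, hf⟩ := exists_contMDiffMap_one_nhds_of_subset_interior
    (modelWithCornersSelf ℝ Plane) (n := ⊤) hK.isClosed hKL
  have hs : tsupport f ⊆ L := closure_minimal (fun x hx => by
    by_contra h; exact hx (hf0 x h)) hL.isClosed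
  exact ⟨f, ⟨f.contMDiff.contDiff, hL.of_isClosed_subset (isClosed_tsupport _) hs, hs.trans hLU⟩,
    fun x => (hf x).1, fun x => (hf x).2, hf1, fun x hx => hf1.self_of_nhdsSet x hx⟩

/-- Integration by parts against a test function. -/
theorem integral_mul_dd {A : Set Plane} {u φ : Plane → ℝ} (hu : Smooth u) (hφ : IsTestOn A φ)
    (e : Plane) : ∫ x, u x * dd e φ x = - ∫ x, dd e u x * φ x :=
  integral_mul_fderiv_eq_neg_fderiv_mul_of_integrable
    (hφ.integrable_mul_cont (hu.dd e).continuous)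
    ((hφ.dd e).integrable_mul_cont hu.continuous)
    (hφ.integrable_mul_cont hu.continuous)
    (fun x _ => hu.differentiable x) (fun x _ => hφ.smooth.differentiable x)

theorem integral_mul_dd_dd {A : Set Plane} {u φ : Plane → ℝ} (hu : Smooth u) (hφ : IsTestOn A φ)
    (e e' : Plane) : ∫ x, u x * dd e (dd e' φ) x = ∫ x, dd e (dd e' u) x * φ x := by
  rw [integral_mul_dd hu (hφ.dd e'), integral_mul_dd (hu.dd e) hφ, neg_neg, dd_comm hu]

/-- `M` has operator norm at most `c`, in bilinear form. -/
def OpLe (M : Fin 2 → Fin 2 → ℝ) (c : ℝ) : Prop :=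
  ∀ v w : Plane, ∑ i, ∑ j, v i * M i j * w j ≤ c * (‖v‖ * ‖w‖)

namespace OpLe

variable {M N : Fin 2 → Fin 2 → ℝ} {b c : ℝ}

theorem mono (hM : OpLe M b) (h : b ≤ c) : OpLe M c := fun v w =>
  (hM v w).trans (mul_le_mul_of_nonneg_right h (by positivity))

theorem const_mul (hM : OpLe M b) (hc : 0 ≤ c) : OpLe (fun i j => c * M i j) (c * b) := by
  intro v w
  have h1 := mul_le_mul_of_nonneg_left (hM v w) hc
  simp only [Fin.sum_univ_two] at *
  linarith

theorem neg (hM : OpLe M b) : OpLe (fun i j => - M i j) b := by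
  intro v w
  have h1 := hM (-v) w
  rw [norm_neg] at h1
  simp only [Fin.sum_univ_two, PiLp.neg_apply] at *
  linarith

theorem zero : OpLe (fun _ _ => 0) 0 := fun v w => by simp

theorem abs_entry_le (hM : OpLe M b) (i j : Fin 2) : |M i j| ≤ b := by
  have h1 := hM (bas i) (bas j)
  have h2 := hM.neg (bas i) (bas j)
  rw [abs_le]
  fin_cases i <;> fin_cases j <;> simp [bas] at h1 h2 ⊢ <;>
    constructor <;> linarith

theorem abs_coord_le (v : Plane) (i : Fin 2) : |v i| ≤ ‖v‖ := by
  simpa using PiLp.norm_apply_le v i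

theorem rankOne (a e : Plane) (t : ℝ) :
    OpLe (fun i j => t * (a i * e j)) (|t| * (‖a‖ * ‖e‖)) := by
  intro v w
  have h1 := abs_real_inner_le_norm v a
  have h2 := abs_real_inner_le_norm w e
  have e1 : ∑ i, ∑ j, v i * (t * (a i * e j)) * w j = t * (inner ℝ v a * inner ℝ w e) := by
    simp [PiLp.inner_apply, Fin.sum_univ_two]; ring
  rw [e1]
  refine (le_abs_self _).trans ?_
  rw [abs_mul, abs_mul]
  calc |t| * (|inner ℝ v a| * |inner ℝ w e|) ≤ |t| * ((‖v‖ * ‖a‖) * (‖w‖ * ‖e‖)) := by gcongr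
    _ = _ := by ring

theorem of_abs_entry (i₀ j₀ : Fin 2) (t : ℝ) :
    OpLe (fun i j => if i = i₀ ∧ j = j₀ then t else 0) |t| := by
  have := rankOne (bas i₀) (bas j₀) t
  simp only [PiLp.norm_single, norm_one, mul_one] at this
  convert this using 3 with i j
  simp only [bas, PiLp.single_apply]
  split_ifs <;> simp_all

end OpLe

theorem inner_toEuclideanLin (M : Matrix (Fin 2) (Fin 2) ℝ) (v w : Plane) :
    inner ℝ v (Matrix.toEuclideanLin M w) = ∑ i, ∑ j, v i * M i j * w j := by
  simp [PiLp.inner_apply, Matrix.toLpLin_apply, Fin.sum_univ_two]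
  ring

theorem opLe_iff_norm_le (M : Matrix (Fin 2) (Fin 2) ℝ) :
    OpLe M 1 ↔ ∀ w : Plane, ‖Matrix.toEuclideanLin M w‖ ≤ ‖w‖ := by
  constructor
  · intro h w
    have := h (Matrix.toEuclideanLin M w) w
    rw [← inner_toEuclideanLin, real_inner_self_eq_norm_sq] at this
    by_cases h0 : ‖Matrix.toEuclideanLin M w‖ = 0
    · rw [h0]; positivity
    · have : 0 < ‖Matrix.toEuclideanLin M w‖ := lt_of_le_of_ne (norm_nonneg _) (Ne.symm h0)
      nlinarith
  · intro h v w
    rw [← inner_toEuclideanLin, one_mul]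
    exact (real_inner_le_norm _ _).trans (mul_le_mul_of_nonneg_left (h w) (norm_nonneg _))

/-- In an orthonormal eigenbasis `b` of `T* T` one has `‖T w‖² = ∑ sᵢ² ⟨bᵢ, w⟩²`, so the largest
singular value is the operator norm. The bilinear form `OpLe` is linear in the matrix, which makes
it convenient for sums, cutoffs and averages. -/
theorem schattenNorm_top_le_one_iff (M : Matrix (Fin 2) (Fin 2) ℝ) :
    ‖schattenNorm ∞ M‖ ≤ 1 ↔ OpLe M 1 := by
  have hn : Module.finrank ℝ Plane = 2 := by simp
  set T := Matrix.toEuclideanLin M with hT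
  set b := T.isSymmetric_adjoint_comp_self.eigenvectorBasis hn with hb
  have hbi : ∀ i, (LinearMap.adjoint T ∘ₗ T) (b i) = (T.singularValues i ^ 2 : ℝ) • b i := by
    intro i
    rw [T.sq_singularValues_fin hn i]
    exact T.isSymmetric_adjoint_comp_self.apply_eigenvectorBasis hn i
  have hnorm : ∀ w, ‖T w‖ ^ 2 = ∑ i : Fin 2, T.singularValues i ^ 2 * inner ℝ (b i) w ^ 2 := by
    intro w
    rw [← real_inner_self_eq_norm_sq]
    conv_lhs => rw [← LinearMap.adjoint_inner_right, ← LinearMap.comp_apply]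
    rw [← b.sum_inner_mul_inner]
    refine Finset.sum_congr rfl fun i _ => ?_
    have h1 : inner ℝ (b i) ((LinearMap.adjoint T ∘ₗ T) w)
        = inner ℝ ((LinearMap.adjoint T ∘ₗ T) (b i)) w :=
      (T.isSymmetric_adjoint_comp_self _ _).symm
    rw [h1, hbi i, real_inner_smul_left, real_inner_comm (b i) w]
    ring
  rw [schattenNorm, norm_norm, PiLp.norm_eq_ciSup, opLe_iff_norm_le]
  constructor
  · intro h w
    have h1 : ∀ i : Fin 2, T.singularValues i ≤ 1 := by
      intro i
      refine (le_abs_self _).trans ((le_ciSup (f := fun i : Fin 2 => ‖T.singularValues i‖)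
        (Set.finite_range _).bddAbove i).trans h)
    have h2 : ‖T w‖ ^ 2 ≤ ‖w‖ ^ 2 := by
      rw [hnorm, ← b.sum_sq_norm_inner_right w]
      refine Finset.sum_le_sum fun i _ => ?_
      rw [Real.norm_eq_abs, sq_abs]
      have h3 := T.singularValues_nonneg i
      have : T.singularValues i ^ 2 ≤ 1 := by nlinarith [h1 i]
      nlinarith [sq_nonneg (inner ℝ (b i) w)]
    exact le_of_sq_le_sq h2 (norm_nonneg _)
  · intro h
    refine ciSup_le fun i => ?_
    have h1 := h (b i)
    rw [b.norm_eq_one] at h1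
    have h2 := hnorm (b i)
    have h3 : ∑ j : Fin 2, T.singularValues j ^ 2 * inner ℝ (b j) (b i) ^ 2
        = T.singularValues i ^ 2 := by
      simp [b.inner_eq_ite]
    rw [h3] at h2
    have h4 := T.singularValues_nonneg i
    simp only [Real.norm_eq_abs]
    rw [abs_of_nonneg h4]
    have : T.singularValues i ^ 2 ≤ 1 := by rw [← h2]; nlinarith [norm_nonneg (T (b i))]
    nlinarith

end HTV

/-! ### The pairing of a distributional Hessian with matrix fields, and the variation as its
supremum. -/

namespace HTV

/-- The double divergence `∑ ∂_i ∂_j F_ij`. -/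
noncomputable def ddiv (F : Fin 2 → Fin 2 → Plane → ℝ) : Plane → ℝ :=
  fun x => ∑ i, ∑ j, dd (bas i) (dd (bas j) (F i j)) x

/-- The distributional pairing of the Hessian of `f` with the matrix field `F`. -/
noncomputable def pr (f : Plane → ℝ) (F : Fin 2 → Fin 2 → Plane → ℝ) : ℝ :=
  ∫ x, f x * ddiv F x

/-- Matrix fields all of whose entries are test functions. -/
def IsField (A : Set Plane) (F : Fin 2 → Fin 2 → Plane → ℝ) : Prop := ∀ i j, IsTestOn A (F i j)

/-- Matrix fields that are admissible in the definition of the Hessian–Schatten variation. -/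
def Adm (A : Set Plane) (F : Fin 2 → Fin 2 → Plane → ℝ) : Prop :=
  IsField A F ∧ ∀ x, OpLe (fun i j => F i j x) 1

variable {A B : Set Plane} {F G : Fin 2 → Fin 2 → Plane → ℝ} {f g : Plane → ℝ}

namespace IsField

theorem mono (h : IsField A F) (hAB : A ⊆ B) : IsField B F := fun i j => (h i j).mono hAB

theorem ddiv (h : IsField A F) : IsTestOn A (ddiv F) :=
  IsTestOn.sum _ fun i _ => IsTestOn.sum _ fun j _ => ((h i j).dd _).dd _

theorem add (hF : IsField A F) (hG : IsField A G) : IsField A (fun i j x => F i j x + G i j x) :=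
  fun i j => (hF i j).add (hG i j)

theorem neg (hF : IsField A F) : IsField A (fun i j x => - F i j x) :=
  fun i j => (hF i j).neg

theorem smul (hF : IsField A F) {χ : Plane → ℝ} (hχ : Smooth χ) :
    IsField A (fun i j x => χ x * F i j x) := fun i j => (hF i j).mul_left hχ

theorem sum {ι : Type*} (s : Finset ι) {F : ι → Fin 2 → Fin 2 → Plane → ℝ}
    (hF : ∀ k ∈ s, IsField A (F k)) : IsField A (fun i j x => ∑ k ∈ s, F k i j x) :=
  fun i j => IsTestOn.sum _ fun k hk => hF k hk i j

theorem smul_test {χ : Plane → ℝ} (hχ : IsTestOn A χ) (hF : ∀ i j, Smooth (F i j)) :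
    IsField A (fun i j x => χ x * F i j x) := fun i j => hχ.mul_right (hF i j)

end IsField

theorem ddiv_add (hF : IsField A F) (hG : IsField B G) :
    ddiv (fun i j x => F i j x + G i j x) = fun x => ddiv F x + ddiv G x := by
  funext x
  simp only [ddiv, ← Finset.sum_add_distrib]
  refine Finset.sum_congr rfl fun i _ => Finset.sum_congr rfl fun j _ => ?_
  rw [dd_add (hF i j).smooth (hG i j).smooth, dd_add ((hF i j).smooth.dd _) ((hG i j).smooth.dd _)]

theorem ddiv_neg (F : Fin 2 → Fin 2 → Plane → ℝ) :
    ddiv (fun i j x => - F i j x) = fun x => - ddiv F x := by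
  funext x
  simp only [ddiv, ← Finset.sum_neg_distrib]
  refine Finset.sum_congr rfl fun i _ => Finset.sum_congr rfl fun j _ => ?_
  rw [dd_neg, dd_neg]

theorem ddiv_const_mul (hF : IsField A F) (c : ℝ) :
    ddiv (fun i j x => c * F i j x) = fun x => c * ddiv F x := by
  funext x
  simp only [ddiv, Finset.mul_sum]
  refine Finset.sum_congr rfl fun i _ => Finset.sum_congr rfl fun j _ => ?_
  rw [dd_const_mul (hF i j).smooth, dd_const_mul ((hF i j).smooth.dd _)]

theorem ddiv_zero : ddiv (fun _ _ _ => 0) = fun _ => 0 := by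
  funext x
  simp [ddiv, dd_zero]

theorem ddiv_sum {ι : Type*} (s : Finset ι) {F : ι → Fin 2 → Fin 2 → Plane → ℝ}
    (hF : ∀ k ∈ s, IsField A (F k)) :
    ddiv (fun i j x => ∑ k ∈ s, F k i j x) = fun x => ∑ k ∈ s, ddiv (F k) x := by
  classical
  induction s using Finset.induction_on with
  | empty => simpa using ddiv_zero
  | insert a s ha ih =>
    simp only [Finset.sum_insert ha]
    rw [ddiv_add (hF a (by simp)) (IsField.sum s fun k hk => hF k (by simp [hk])),
      ih fun k hk => hF k (by simp [hk])]

theorem pr_add (hf : LocallyIntegrableOn f A) (hF : IsField A F) (hG : IsField A G) :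
    pr f (fun i j x => F i j x + G i j x) = pr f F + pr f G := by
  simp only [pr]
  rw [← integral_add (hF.ddiv.integrable_mul hf) (hG.ddiv.integrable_mul hf)]
  simp only [ddiv_add hF hG, mul_add]

theorem pr_neg (f : Plane → ℝ) (F : Fin 2 → Fin 2 → Plane → ℝ) :
    pr f (fun i j x => - F i j x) = - pr f F := by
  simp only [pr, ddiv_neg, mul_neg, integral_neg]

theorem pr_const_mul (hF : IsField A F) (c : ℝ) :
    pr f (fun i j x => c * F i j x) = c * pr f F := by
  simp only [pr, ddiv_const_mul hF, ← integral_const_mul]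
  congr 1; funext x; ring

theorem pr_sum {ι : Type*} (s : Finset ι) {F : ι → Fin 2 → Fin 2 → Plane → ℝ}
    (hf : LocallyIntegrableOn f A) (hF : ∀ k ∈ s, IsField A (F k)) :
    pr f (fun i j x => ∑ k ∈ s, F k i j x) = ∑ k ∈ s, pr f (F k) := by
  simp only [pr, ddiv_sum s hF, Finset.mul_sum]
  exact integral_finsetSum _ fun k hk => (hF k hk).ddiv.integrable_mul hf

theorem pr_fun_add (hf : LocallyIntegrableOn f A) (hg : LocallyIntegrableOn g A)
    (hF : IsField A F) : pr (fun x => f x + g x) F = pr f F + pr g F := by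
  simp only [pr]
  rw [← integral_add (hF.ddiv.integrable_mul hf) (hF.ddiv.integrable_mul hg)]
  simp only [add_mul]

theorem pr_fun_sub (hf : LocallyIntegrableOn f A) (hg : LocallyIntegrableOn g A)
    (hF : IsField A F) : pr (fun x => f x - g x) F = pr f F - pr g F := by
  simp only [pr]
  rw [← integral_sub (hF.ddiv.integrable_mul hf) (hF.ddiv.integrable_mul hg)]
  simp only [sub_mul]

theorem pr_fun_sum {ι : Type*} (s : Finset ι) {f : ι → Plane → ℝ}
    (hf : ∀ k ∈ s, LocallyIntegrableOn (f k) A) (hF : IsField A F) :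
    pr (fun x => ∑ k ∈ s, f k x) F = ∑ k ∈ s, pr (f k) F := by
  simp only [pr, Finset.sum_mul]
  exact integral_finsetSum _ fun k hk => hF.ddiv.integrable_mul (hf k hk)

theorem pr_congr (hF : IsField A F) (h : ∀ x ∈ A, f x = g x) : pr f F = pr g F := by
  refine integral_congr_ae (ae_of_all _ fun x => ?_)
  by_cases hx : x ∈ A
  · simp [h x hx]
  · simp [hF.ddiv.eq_zero hx]

/-- Integration by parts: the pairing with the classical Hessian. -/
theorem pr_smooth (hf : Smooth f) (hF : IsField A F) :
    pr f F = ∫ x, ∑ i, ∑ j, dd (bas i) (dd (bas j) f) x * F i j x := by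
  have h1 : ∀ i j, Integrable fun x => f x * dd (bas i) (dd (bas j) (F i j)) x := fun i j =>
    (((hF i j).dd _).dd _).integrable_mul_cont hf.continuous
  have h2 : ∀ i j, Integrable fun x => dd (bas i) (dd (bas j) f) x * F i j x := fun i j =>
    (hF i j).integrable_mul_cont ((hf.dd _).dd _).continuous
  simp only [pr, ddiv, Finset.mul_sum]
  rw [integral_finsetSum _ fun i _ => integrable_finsetSum _ fun j _ => h1 i j,
    integral_finsetSum _ fun i _ => integrable_finsetSum _ fun j _ => h2 i j]
  refine Finset.sum_congr rfl fun i _ => ?_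
  rw [integral_finsetSum _ fun j _ => h1 i j, integral_finsetSum _ fun j _ => h2 i j]
  exact Finset.sum_congr rfl fun j _ => integral_mul_dd_dd hf (hF i j) _ _

theorem setIntegral_eq_pr {U : Opens Plane} (f : Plane → ℝ) (hF : IsField U F) :
    ∫ x in (U : Set Plane), ∑ i, ∑ j, f x * partialDeriv i (partialDeriv j (F i j)) x
      = pr f F := by
  rw [setIntegral_eq_integral_of_forall_compl_eq_zero]
  · simp only [pr, ddiv, Finset.mul_sum, partialDeriv_eq_dd]
  · intro x hx
    have := hF.ddiv.eq_zero hx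
    simp only [ddiv] at this
    simp only [partialDeriv_eq_dd, ← Finset.mul_sum, this, mul_zero]

/-- The conjugate exponent of `1` is `∞`. The essential bound holds at every point because the
entries are continuous: the set where it holds is closed, and it is dense since its complement is
null. -/
theorem adm_iff {U : Opens Plane} (F : Matrix (Fin 2) (Fin 2) 𝓓(U, ℝ)) :
    lrSchattenNorm (ENNReal.conjExponent 1) ∞ (fun x => F.map (fun φ => φ x)) ≤ 1 ↔
      Adm U (fun i j => F i j) := by
  have hc : ENNReal.conjExponent 1 = ∞ := by simp [ENNReal.conjExponent]
  have hF : IsField U (fun i j => F i j) := fun i j =>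
    ⟨(F i j).contDiff, (F i j).hasCompactSupport, (F i j).tsupport_subset⟩
  rw [lrSchattenNorm, hc, eLpNorm_exponent_top]
  constructor
  · intro h
    refine ⟨hF, fun x => ?_⟩
    have h1 : ∀ᵐ x ∂(volume : Measure Plane), OpLe (fun i j => F i j x) 1 := by
      filter_upwards [enorm_ae_le_eLpNormEssSup
        (fun x => schattenNorm ∞ (F.map (fun φ => φ x))) volume] with x hx
      have hx2 := hx.trans h
      rw [← ofReal_norm, ENNReal.ofReal_le_one] at hx2
      exact (schattenNorm_top_le_one_iff _).1 hx2
    have h2 : IsClosed {x : Plane | OpLe (fun i j => F i j x) 1} := by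
      have : {x : Plane | OpLe (fun i j => F i j x) 1} = ⋂ v : Plane, ⋂ w : Plane,
          {x | ∑ i, ∑ j, v i * F i j x * w j ≤ 1 * (‖v‖ * ‖w‖)} := by
        ext x; simp [OpLe]
      rw [this]
      refine isClosed_iInter fun v => isClosed_iInter fun w => isClosed_le ?_ continuous_const
      have := fun i j => (F i j).continuous
      fun_prop
    have h3 : Dense {x : Plane | OpLe (fun i j => F i j x) 1} := Measure.dense_of_ae h1
    have := h3.closure_eq
    rw [h2.closure_eq] at this
    exact (this ▸ mem_univ x : x ∈ {x : Plane | OpLe (fun i j => F i j x) 1})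
  · intro h
    refine eLpNormEssSup_le_of_ae_enorm_bound (ae_of_all _ fun x => ?_)
    rw [← ofReal_norm, ENNReal.ofReal_le_one]
    exact (schattenNorm_top_le_one_iff _).2 (h.2 x)

theorem le_hsv {U : Opens Plane} (f : Plane → ℝ) (hF : Adm U F) :
    ENNReal.ofReal (pr f F) ≤ hessianSchattenVariation 1 f U := by
  let F' : Matrix (Fin 2) (Fin 2) 𝓓(U, ℝ) := fun i j =>
    ⟨F i j, (hF.1 i j).smooth, (hF.1 i j).compact, (hF.1 i j).supp⟩
  rw [← setIntegral_eq_pr f hF.1, hessianSchattenVariation]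
  exact le_iSup₂_of_le (f := fun (F : Matrix (Fin 2) (Fin 2) 𝓓(U, ℝ)) _ => ENNReal.ofReal
      (∫ x in (U : Set Plane), ∑ i, ∑ j, f x * partialDeriv i (partialDeriv j (F i j)) x))
    F' ((adm_iff F').2 hF) le_rfl

theorem hsv_le {U : Opens Plane} {f : Plane → ℝ} {C : ℝ≥0∞}
    (h : ∀ F, Adm U F → ENNReal.ofReal (pr f F) ≤ C) : hessianSchattenVariation 1 f U ≤ C := by
  refine iSup₂_le fun F hF => ?_
  have hF' := (adm_iff F).1 hF
  exact (setIntegral_eq_pr f hF'.1).symm ▸ h _ hF'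

theorem hsv_mono {U V : Opens Plane} (f : Plane → ℝ) (h : (U : Set Plane) ⊆ V) :
    hessianSchattenVariation 1 f U ≤ hessianSchattenVariation 1 f V :=
  hsv_le fun _ hF => le_hsv f ⟨hF.1.mono h, hF.2⟩

theorem pr_le_toReal {U : Opens Plane} (hfin : hessianSchattenVariation 1 f U ≠ ∞)
    (hF : Adm U F) : pr f F ≤ (hessianSchattenVariation 1 f U).toReal :=
  (ENNReal.ofReal_le_iff_le_toReal hfin).1 (le_hsv f hF)

theorem pr_le_mul_toReal {U : Opens Plane} (hfin : hessianSchattenVariation 1 f U ≠ ∞)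
    (hF : IsField U F) {c : ℝ} (hc : 0 < c) (h : ∀ x, OpLe (fun i j => F i j x) c) :
    pr f F ≤ c * (hessianSchattenVariation 1 f U).toReal := by
  have h1 : Adm U (fun i j x => c⁻¹ * F i j x) := by
    refine ⟨hF.smul contDiff_const, fun x => ?_⟩
    simpa [hc.ne'] using (h x).const_mul (inv_pos.2 hc).le
  have h2 := pr_le_toReal hfin h1
  rw [pr_const_mul hF] at h2
  calc pr f F = c * (c⁻¹ * pr f F) := by field_simp
    _ ≤ _ := by gcongr

theorem hsv_le_of_pr_le {U : Opens Plane} {C : ℝ} (h : ∀ F, Adm U F → pr f F ≤ C) :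
    hessianSchattenVariation 1 f U ≤ ENNReal.ofReal C :=
  hsv_le fun F hF => ENNReal.ofReal_le_ofReal (h F hF)

/-- Spectral decomposition of a symmetric `2 × 2` matrix. -/
theorem exists_spectral (H : Fin 2 → Fin 2 → ℝ) (hH : ∀ i j, H i j = H j i) :
    ∃ (l : Fin 2 → ℝ) (v : Fin 2 → Plane), Orthonormal ℝ v ∧
      ∀ i j, H i j = ∑ k, l k * (v k i * v k j) := by
  have hA : (Matrix.of H).IsHermitian := by
    ext i j; simp [hH j i]
  refine ⟨hA.eigenvalues, hA.eigenvectorBasis, hA.eigenvectorBasis.orthonormal, fun i j => ?_⟩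
  have h := congrFun (congrFun hA.spectral_theorem i) j
  rw [Matrix.of_apply] at h
  rw [h]
  simp [Unitary.conjStarAlgAut_apply, Matrix.mul_apply, Fin.sum_univ_two, Matrix.star_apply,
    Matrix.diagonal_apply]
  ring

end HTV

/-! ### Mollifiers, and energy bounds for convex functions. -/

namespace HTV

/-- The Laplacian. -/
noncomputable def lap (φ : Plane → ℝ) : Plane → ℝ := fun x => ∑ i, dd (bas i) (dd (bas i) φ) x

theorem IsTestOn.lap {A : Set Plane} {φ : Plane → ℝ} (h : IsTestOn A φ) : IsTestOn A (lap φ) :=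
  IsTestOn.sum _ fun _ _ => (h.dd _).dd _

theorem Smooth.lap {φ : Plane → ℝ} (h : Smooth φ) : Smooth (lap φ) :=
  ContDiff.sum fun _ _ => (h.dd _).dd _

/-- Smooth compactly supported symmetric averaging kernels at scale `s`. -/
structure IsMollifier (s : ℝ) (ρ : Plane → ℝ) : Prop where
  test : IsTestOn (Metric.ball 0 s) ρ
  nonneg : ∀ x, 0 ≤ ρ x
  integral_eq : ∫ x, ρ x = 1
  symm : ∀ x, ρ (-x) = ρ x

theorem exists_mollifier {s : ℝ} (hs : 0 < s) : ∃ ρ, IsMollifier s ρ := by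
  let φ : ContDiffBump (0 : Plane) := ⟨s / 4, s / 2, by positivity, by linarith⟩
  refine ⟨φ.normed volume, ⟨φ.contDiff_normed, φ.hasCompactSupport_normed, ?_⟩,
    φ.nonneg_normed, φ.integral_normed, φ.normed_neg⟩
  rw [φ.tsupport_normed_eq]
  exact Metric.closedBall_subset_ball (by change s / 2 < s; linarith)

/-- Convolution with a kernel. -/
noncomputable def moll (ρ g : Plane → ℝ) : Plane → ℝ :=
  convolution ρ g (ContinuousLinearMap.lsmul ℝ ℝ) volume

theorem moll_apply (ρ g : Plane → ℝ) (x : Plane) : moll ρ g x = ∫ t, ρ t * g (x - t) := rfl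

theorem IsMollifier.smooth_moll {s : ℝ} {ρ g : Plane → ℝ} (h : IsMollifier s ρ)
    (hg : LocallyIntegrable g) : Smooth (moll ρ g) :=
  h.test.compact.contDiff_convolution_left _ h.test.smooth hg

theorem IsMollifier.abs_moll_sub_le {s : ℝ} {ρ g : Plane → ℝ} (h : IsMollifier s ρ)
    (hg : AEStronglyMeasurable g volume) {x : Plane} {ε a : ℝ} (hε : 0 ≤ ε)
    (hx : ∀ y ∈ Metric.ball x s, |g y - a| ≤ ε) : |moll ρ g x - a| ≤ ε := by
  exact dist_convolution_le hε ((subset_tsupport _).trans h.test.supp)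
    h.nonneg h.integral_eq hg hx

theorem exists_unif_near {c : Plane → ℝ} (hc : Continuous c) {K : Set Plane} (hK : IsCompact K)
    {ε : ℝ} (hε : 0 < ε) :
    ∃ δ > 0, ∀ x ∈ K, ∀ y, dist x y < δ → |c y - c x| < ε := by
  have := hK.uniformContinuousAt_of_continuousAt c (fun x _ => hc.continuousAt)
    (Metric.dist_mem_uniformity hε)
  obtain ⟨δ, hδ, h⟩ := Metric.mem_uniformity_dist.1 this
  refine ⟨δ, hδ, fun x hx y hxy => ?_⟩
  have := h hxy hx
  rwa [mem_ofPred_eq, dist_comm, Real.dist_eq] at this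

theorem exists_moll_unif {c : Plane → ℝ} (hc : Continuous c) {K : Set Plane} (hK : IsCompact K)
    {ε : ℝ} (hε : 0 < ε) :
    ∃ δ > 0, ∀ s ≤ δ, ∀ ρ, IsMollifier s ρ → ∀ x ∈ K, |moll ρ c x - c x| ≤ ε := by
  obtain ⟨δ, hδ, h⟩ := exists_unif_near hc hK hε
  refine ⟨δ, hδ, fun s hs ρ hρ x hx => hρ.abs_moll_sub_le hc.aestronglyMeasurable hε.le ?_⟩
  intro y hy
  refine (h x hx y ?_).le
  rw [dist_comm]
  exact (Metric.mem_ball.1 hy).trans_le hs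

/-- Second derivatives along a line. -/
theorem hasDerivAt_line {u : Plane → ℝ} (hu : Smooth u) (x e : Plane) (t : ℝ) :
    HasDerivAt (fun t : ℝ => u (x + t • e)) (dd e u (x + t • e)) t := by
  have h1 : HasDerivAt (fun t : ℝ => x + t • e) e t := by
    simpa using ((hasDerivAt_id t).smul_const e).const_add x
  exact (hu.differentiable _).hasFDerivAt.comp_hasDerivAt t h1

theorem dd_dd_nonneg_of_convex {u : Plane → ℝ} (hu : Smooth u) (hc : ConvexOn ℝ univ u)
    (e x : Plane) : 0 ≤ dd e (dd e u) x := by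
  have h1 : ConvexOn ℝ univ (fun t : ℝ => u (x + t • e)) := by
    have := hc.comp_affineMap (AffineMap.lineMap x (x + e) : ℝ →ᵃ[ℝ] Plane)
    rw [preimage_univ] at this
    have h : (fun t : ℝ => u (x + t • e)) = u ∘ (AffineMap.lineMap x (x + e) : ℝ →ᵃ[ℝ] Plane) := by
      funext t
      simp [AffineMap.lineMap_apply, add_comm]
    rwa [h]
  have h2 := h1.monotoneOn_deriv fun t _ => (hasDerivAt_line hu x e t).differentiableAt
  have h3 : deriv (fun t : ℝ => u (x + t • e)) = fun t => dd e u (x + t • e) :=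
    funext fun t => (hasDerivAt_line hu x e t).deriv
  rw [h3, monotoneOn_univ] at h2
  have h4 := hasDerivAt_line (hu.dd e) x e 0
  rw [zero_smul, add_zero] at h4
  rw [← h4.deriv]
  exact h2.deriv_nonneg

/-- Trace duality for a nonnegative matrix. Diagonalizing `H` turns the pairing into a combination
of values of the form of `M` at unit eigenvectors, with nonnegative coefficients whose sum is the
trace of `H`. -/
theorem spectral_pairing {H M : Fin 2 → Fin 2 → ℝ} {c : ℝ} (hH : ∀ i j, H i j = H j i)
    (hpos : ∀ e : Plane, 0 ≤ ∑ i, ∑ j, e i * e j * H i j) (hM : OpLe M c) :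
    ∑ i, ∑ j, H i j * M i j ≤ (∑ i, H i i) * c := by
  obtain ⟨l, v, hv, h⟩ := exists_spectral H hH
  have hvv : ∀ a b, v a 0 * v b 0 + v a 1 * v b 1 = if a = b then 1 else 0 := by
    intro a b
    have := (orthonormal_iff_ite.1 hv) b a
    simp [PiLp.inner_apply, Fin.sum_univ_two] at this
    rw [this]; simp [eq_comm]
  have hl : ∀ k, 0 ≤ l k := by
    intro k
    have h1 := hpos (v k)
    simp only [h] at h1
    have h00 := hvv 0 k
    have h11 := hvv 1 k
    have e1 : ∑ i, ∑ j, v k i * v k j * ∑ m, l m * (v m i * v m j)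
        = l 0 * (v 0 0 * v k 0 + v 0 1 * v k 1) ^ 2 + l 1 * (v 1 0 * v k 0 + v 1 1 * v k 1) ^ 2 := by
      simp only [Fin.sum_univ_two]; ring
    rw [e1, h00, h11] at h1
    fin_cases k <;> simpa using h1
  have htr : ∑ i, H i i = ∑ k, l k := by
    have h00 := hvv 0 0
    have h11 := hvv 1 1
    simp only [if_true] at h00 h11
    simp only [h, Fin.sum_univ_two]
    linear_combination l 0 * h00 + l 1 * h11
  rw [htr]
  have e2 : ∑ i, ∑ j, H i j * M i j = ∑ k, l k * ∑ i, ∑ j, v k i * M i j * v k j := by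
    simp only [h, Fin.sum_univ_two]; ring
  rw [e2, Finset.sum_mul]
  refine Finset.sum_le_sum fun k _ => mul_le_mul_of_nonneg_left ?_ (hl k)
  have := hM (v k) (v k)
  rwa [hv.1 k, mul_one, mul_one] at this

theorem hess_pairing_le {u : Plane → ℝ} (hu : Smooth u) {x : Plane}
    (hpos : ∀ e, 0 ≤ dd e (dd e u) x) {M : Fin 2 → Fin 2 → ℝ} {c : ℝ} (hM : OpLe M c) :
    ∑ i, ∑ j, dd (bas i) (dd (bas j) u) x * M i j ≤ lap u x * c :=
  spectral_pairing (H := fun i j => dd (bas i) (dd (bas j) u) x)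
    (fun i j => by rw [dd_comm hu]) (fun e => by rw [← dd_dd_eq_sum hu]; exact hpos e) hM

theorem integral_mul_lap {A : Set Plane} {u χ : Plane → ℝ} (hu : Smooth u) (hχ : IsTestOn A χ) :
    ∫ x, u x * lap χ x = ∫ x, lap u x * χ x := by
  simp only [lap, Finset.mul_sum, Finset.sum_mul]
  rw [integral_finsetSum _ fun i _ => ((hχ.dd _).dd _).integrable_mul_cont hu.continuous,
    integral_finsetSum _ fun i _ => hχ.integrable_mul_cont ((hu.dd _).dd _).continuous]
  exact Finset.sum_congr rfl fun i _ => integral_mul_dd_dd hu hχ _ _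

/-- After integration by parts on both sides the inequality holds pointwise, by `hess_pairing_le`.
The right-hand side no longer involves second derivatives of `u`, which is what permits passage to
nonsmooth limits. -/
theorem pr_le_of_convex_smooth {A B : Set Plane} {u χ : Plane → ℝ}
    {F : Fin 2 → Fin 2 → Plane → ℝ} (hu : Smooth u)
    (hc : ConvexOn ℝ univ u) (hF : IsField A F) (hχ : IsTestOn B χ)
    (hFχ : ∀ x, OpLe (fun i j => F i j x) (χ x)) : pr u F ≤ ∫ x, u x * lap χ x := by
  rw [pr_smooth hu hF, integral_mul_lap hu hχ]
  refine integral_mono ?_ (hχ.integrable_mul_cont hu.lap.continuous) fun x =>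
    hess_pairing_le hu (fun e => dd_dd_nonneg_of_convex hu hc e x) (hFχ x)
  exact integrable_finsetSum _ fun i _ => integrable_finsetSum _ fun j _ =>
    (hF i j).integrable_mul_cont ((hu.dd _).dd _).continuous

theorem convexOn_moll {s : ℝ} {ρ c : Plane → ℝ} (hρ : IsMollifier s ρ) (hcont : Continuous c)
    (hc : ConvexOn ℝ univ c) : ConvexOn ℝ univ (moll ρ c) := by
  have hint : ∀ x, Integrable fun t => ρ t * c (x - t) := fun x => by
    simpa only [mul_comm] using
      hρ.test.integrable_mul_cont (f := fun t => c (x - t)) (by fun_prop)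
  refine ⟨convex_univ, fun x _ y _ a b ha hb hab => ?_⟩
  simp only [moll_apply, smul_eq_mul, ← integral_const_mul]
  rw [← integral_add ((hint x).const_mul a) ((hint y).const_mul b)]
  refine integral_mono (hint _) (((hint x).const_mul a).add ((hint y).const_mul b)) fun t => ?_
  have h1 := hc.2 (mem_univ (x - t)) (mem_univ (y - t)) ha hb hab
  have h2 : a • (x - t) + b • (y - t) = a • x + b • y - t := by
    rw [smul_sub, smul_sub]
    have : t = a • t + b • t := by rw [← add_smul, hab, one_smul]
    nth_rw 3 [this]
    abel
  rw [h2] at h1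
  have h3 := mul_le_mul_of_nonneg_left h1 (hρ.nonneg t)
  simp only [smul_eq_mul] at h3
  linarith

theorem abs_integral_sub_le {A : Set Plane} {u v φ : Plane → ℝ} {ε : ℝ} (hu : Continuous u)
    (hv : Continuous v) (hφ : IsTestOn A φ) (h : ∀ x ∈ tsupport φ, |u x - v x| ≤ ε) :
    |(∫ x, u x * φ x) - ∫ x, v x * φ x| ≤ ε * ∫ x, |φ x| := by
  have hφi : Integrable fun x => |φ x| := hφ.integrable.abs
  rw [← integral_sub (hφ.integrable_mul_cont hu) (hφ.integrable_mul_cont hv),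
    ← integral_const_mul]
  refine (abs_integral_le_integral_abs).trans (integral_mono ?_ (hφi.const_mul _) fun x => ?_)
  · exact ((hφ.integrable_mul_cont hu).sub (hφ.integrable_mul_cont hv)).abs
  · simp only
    rw [← sub_mul, abs_mul]
    by_cases hx : φ x = 0
    · simp [hx]
    · exact mul_le_mul_of_nonneg_right (h x (subset_tsupport _ hx)) (abs_nonneg _)

theorem abs_integral_sub_le' {A : Set Plane} {u v φ : Plane → ℝ} {ε : ℝ} (hu : Continuous u)
    (hv : Continuous v) (hφ : IsTestOn A φ) (h : ∀ x ∈ A, |u x - v x| ≤ ε) :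
    |(∫ x, u x * φ x) - ∫ x, v x * φ x| ≤ ε * ∫ x, |φ x| :=
  abs_integral_sub_le hu hv hφ fun x hx => h x (hφ.supp hx)

/-- Mollification preserves convexity, and both sides are continuous for uniform convergence on the
supports of the test functions. This is the upper bound on energies that survives uniform
approximation. -/
theorem pr_le_of_convex {A B : Set Plane} {c χ : Plane → ℝ}
    {F : Fin 2 → Fin 2 → Plane → ℝ} (hcont : Continuous c)
    (hc : ConvexOn ℝ univ c) (hF : IsField A F) (hχ : IsTestOn B χ)
    (hFχ : ∀ x, OpLe (fun i j => F i j x) (χ x)) : pr c F ≤ ∫ x, c x * lap χ x := by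
  -- A uniform error `ε / (D + 1)` in `c` changes the two sides by at most `ε` together.
  set D := (∫ x, |ddiv F x|) + ∫ x, |lap χ x| with hD
  have hD0 : 0 ≤ D := add_nonneg (integral_nonneg fun _ => abs_nonneg _)
    (integral_nonneg fun _ => abs_nonneg _)
  refine le_of_forall_pos_le_add fun ε hε => ?_
  obtain ⟨δ, hδ, h⟩ := exists_moll_unif hcont (hF.ddiv.compact.union hχ.lap.compact)
    (ε := ε / (D + 1)) (by positivity)
  obtain ⟨ρ, hρ⟩ := exists_mollifier hδ
  have hs : Smooth (moll ρ c) := hρ.smooth_moll hcont.locallyIntegrable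
  have h1 := abs_integral_sub_le hs.continuous hcont hF.ddiv
    (fun x hx => h δ le_rfl ρ hρ x (Or.inl hx))
  have h2 := abs_integral_sub_le hs.continuous hcont hχ.lap
    (fun x hx => h δ le_rfl ρ hρ x (Or.inr hx))
  have h3 := pr_le_of_convex_smooth hs (convexOn_moll hρ hcont hc) hF hχ hFχ
  have h4 : ε / (D + 1) * D ≤ ε := by
    rw [div_mul_eq_mul_div, div_le_iff₀ (by positivity)]
    nlinarith
  have h5 : ε / (D + 1) * (∫ x, |ddiv F x|) + ε / (D + 1) * ∫ x, |lap χ x| ≤ ε := by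
    rw [← mul_add]; exact h4
  rw [abs_le] at h1 h2
  simp only [pr] at *
  linarith [h1.1, h2.2]

/-- Quantitative form: if the convex function `c` is close to the smooth function `u` on the support
of the weight, the pairing is controlled by the Laplacian of `u`. -/
theorem pr_le_of_convex_near {A B : Set Plane} {c u χ : Plane → ℝ}
    {F : Fin 2 → Fin 2 → Plane → ℝ} {ε : ℝ} (hcont : Continuous c)
    (hc : ConvexOn ℝ univ c) (hu : Smooth u) (hF : IsField A F) (hχ : IsTestOn B χ)
    (hFχ : ∀ x, OpLe (fun i j => F i j x) (χ x)) (h : ∀ x ∈ B, |c x - u x| ≤ ε) :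
    pr c F ≤ (∫ x, lap u x * χ x) + ε * ∫ x, |lap χ x| := by
  have h1 := pr_le_of_convex hcont hc hF hχ hFχ
  have h2 := abs_integral_sub_le' hcont hu.continuous hχ.lap h
  rw [abs_le] at h2
  rw [← integral_mul_lap hu hχ]
  linarith [h2.2]

/-- The pairing with a difference of convex functions. -/
theorem pr_sub_le_of_convex_near {A B : Set Plane} {a b u v χ : Plane → ℝ}
    {F : Fin 2 → Fin 2 → Plane → ℝ} {ε : ℝ} (ha : Continuous a) (hac : ConvexOn ℝ univ a)
    (hb : Continuous b) (hbc : ConvexOn ℝ univ b) (hu : Smooth u) (hv : Smooth v)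
    (hF : IsField A F) (hχ : IsTestOn B χ)
    (hFχ : ∀ x, OpLe (fun i j => F i j x) (χ x)) (hau : ∀ x ∈ B, |a x - u x| ≤ ε)
    (hbv : ∀ x ∈ B, |b x - v x| ≤ ε) :
    pr (fun x => a x - b x) F
      ≤ (∫ x, (lap u x + lap v x) * χ x) + 2 * ε * ∫ x, |lap χ x| := by
  rw [pr_fun_sub (ha.locallyIntegrable.locallyIntegrableOn A)
    (hb.locallyIntegrable.locallyIntegrableOn A) hF, sub_eq_add_neg, ← pr_neg]
  have h1 := pr_le_of_convex_near ha hac hu hF hχ hFχ hau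
  -- The subtracted function is tested with the opposite field, whose norm is the same, so the two
  -- Laplacians add up.
  have h2 := pr_le_of_convex_near hb hbc hv hF.neg hχ (fun x => (hFχ x).neg) hbv
  simp only [add_mul]
  rw [integral_add (hχ.integrable_mul_cont hu.lap.continuous)
    (hχ.integrable_mul_cont hv.lap.continuous)]
  linarith

end HTV

/-! ### Piecewise affine functions and the polytope decomposition of a line arrangement. -/

namespace HTV

/-- Continuous functions that agree at each point with one of finitely many affine functions. -/
def IsPL (g : Plane → ℝ) : Prop :=
  Continuous g ∧ ∃ s : Set (Plane →ᵃ[ℝ] ℝ), s.Finite ∧ ∀ x, ∃ a ∈ s, g x = a x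

namespace IsPL

variable {g h : Plane → ℝ}

theorem affine (a : Plane →ᵃ[ℝ] ℝ) : IsPL a :=
  ⟨a.continuous_of_finiteDimensional, {a}, finite_singleton a, fun _ => ⟨a, rfl, rfl⟩⟩

theorem const (c : ℝ) : IsPL fun _ => c := affine (AffineMap.const ℝ Plane c)

theorem add (hg : IsPL g) (hh : IsPL h) : IsPL fun x => g x + h x := by
  obtain ⟨hgc, s, hs, hg⟩ := hg
  obtain ⟨hhc, t, ht, hh⟩ := hh
  refine ⟨hgc.add hhc, _, hs.image2 (· + ·) ht, fun x => ?_⟩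
  obtain ⟨a, ha, hga⟩ := hg x
  obtain ⟨b, hb, hhb⟩ := hh x
  exact ⟨a + b, mem_image2_of_mem ha hb, by simp [hga, hhb]⟩

theorem const_mul (hg : IsPL g) (c : ℝ) : IsPL fun x => c * g x := by
  obtain ⟨hgc, s, hs, hg⟩ := hg
  refine ⟨hgc.const_mul c, _, hs.image (c • ·), fun x => ?_⟩
  obtain ⟨a, ha, hga⟩ := hg x
  exact ⟨c • a, mem_image_of_mem _ ha, by simp [hga]⟩

theorem neg (hg : IsPL g) : IsPL fun x => - g x := by simpa using hg.const_mul (-1)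

theorem sub (hg : IsPL g) (hh : IsPL h) : IsPL fun x => g x - h x := by
  simpa only [sub_eq_add_neg] using hg.add hh.neg

theorem max (hg : IsPL g) (hh : IsPL h) : IsPL fun x => max (g x) (h x) := by
  obtain ⟨hgc, s, hs, hg⟩ := hg
  obtain ⟨hhc, t, ht, hh⟩ := hh
  refine ⟨hgc.max hhc, _, hs.union ht, fun x => ?_⟩
  obtain ⟨a, ha, hga⟩ := hg x
  obtain ⟨b, hb, hhb⟩ := hh x
  rcases le_total (g x) (h x) with hx | hx
  · exact ⟨b, Or.inr hb, (max_eq_right hx).trans hhb⟩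
  · exact ⟨a, Or.inl ha, (max_eq_left hx).trans hga⟩

theorem sum {ι : Type*} (s : Finset ι) {g : ι → Plane → ℝ} (hg : ∀ i ∈ s, IsPL (g i)) :
    IsPL fun x => ∑ i ∈ s, g i x := by
  classical
  induction s using Finset.induction_on with
  | empty => simpa using const 0
  | insert a s ha ih =>
    simp only [Finset.sum_insert ha]
    exact (hg a (by simp)).add (ih fun i hi => hg i (by simp [hi]))

end IsPL

/-- A compact polyhedron is the convex hull of finitely many points. -/
theorem exists_finset_convexHull_of_polyhedron {C : Set (Plane →ᵃ[ℝ] ℝ)} (hC : C.Finite)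
    (hP : IsCompact {x : Plane | ∀ c ∈ C, 0 ≤ c x}) :
    ∃ s : Finset Plane, {x : Plane | ∀ c ∈ C, 0 ≤ c x} = convexHull ℝ (s : Set Plane) := by
  set P := {x : Plane | ∀ c ∈ C, 0 ≤ c x} with hPdef
  have hconv : Convex ℝ P := by
    have : P = ⋂ c ∈ C, c ⁻¹' Ici 0 := by ext x; simp [hPdef]
    rw [this]
    exact convex_iInter₂ fun c _ => (convex_Ici (0 : ℝ)).affine_preimage c
  -- An extreme point is determined by its active constraints. If `x` and `y` have the same ones,
  -- the segment from `y` can be prolonged a little beyond `x` inside the polyhedron: active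
  -- constraints vanish along the line and inactive ones have room. Extremality of `x` then forces
  -- `y = x`.
  have hinj : InjOn (fun x : Plane => {c ∈ C | c x = 0}) (P.extremePoints ℝ) := by
    intro x hx y hy hxy
    have hev : ∀ᶠ t : ℝ in 𝓝[>] 0, ∀ c ∈ C, 0 ≤ c (AffineMap.lineMap x y (-t)) := by
      rw [hC.eventually_all]
      intro c hc
      have hlin : ∀ t : ℝ, c (AffineMap.lineMap x y (-t)) = c x + t * (c x - c y) := by
        intro t
        rw [AffineMap.apply_lineMap, AffineMap.lineMap_apply]
        simp; ring
      simp only [hlin]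
      rcases (hx.1 c hc).eq_or_lt with h0 | hpos
      · have hxy' : {c ∈ C | c x = 0} = {c ∈ C | c y = 0} := hxy
        have : c ∈ {c ∈ C | c y = 0} := hxy' ▸ (⟨hc, h0.symm⟩ : c ∈ {c ∈ C | c x = 0})
        simp [← h0, this.2]
      · have hcont : Continuous fun t : ℝ => c x + t * (c x - c y) := by fun_prop
        have h1 : ∀ᶠ t : ℝ in 𝓝 0, 0 < c x + t * (c x - c y) :=
          hcont.continuousAt.eventually (lt_mem_nhds (by simpa using hpos))
        filter_upwards [nhdsWithin_le_nhds h1] with t ht using ht.le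
    obtain ⟨t, ht, ht0⟩ := (hev.and self_mem_nhdsWithin).exists
    have ht0 : 0 < t := ht0
    have hseg : x ∈ openSegment ℝ (AffineMap.lineMap x y (-t)) y := by
      refine ⟨1 / (1 + t), t / (1 + t), by positivity, by positivity, by field_simp, ?_⟩
      ext i
      simp [AffineMap.lineMap_apply]
      field_simp
      ring
    have := hx.2 (x₁ := AffineMap.lineMap x y (-t)) ht hy.1 hseg
    exact (mem_extremePoints.1 hx).2 _ ht _ hy.1 hseg |>.2.symm
  have hfin : (P.extremePoints ℝ).Finite :=
    Finite.of_injOn (t := 𝒫 C) (fun x _ => sep_subset _ _) hinj hC.finite_subsets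
  refine ⟨hfin.toFinset, ?_⟩
  rw [hfin.coe_toFinset]
  -- Krein–Milman; the hull of finitely many points is already closed.
  have h1 := closure_convexHull_extremePoints hP hconv
  rw [(Set.Finite.isClosed_convexHull ℝ hfin).closure_eq] at h1
  exact h1.symm

section Arrangement

/-- The cell of an arrangement of lines together with the integer grid, given by the set `A` of
lines on whose positive side it lies and the corner `k` of its grid square. -/
def cellOf (L A : Set (Plane →ᵃ[ℝ] ℝ)) (k : Fin 2 → ℤ) : Set Plane :=
  {y | (∀ l ∈ L, (l ∈ A → 0 ≤ l y) ∧ (l ∉ A → l y ≤ 0)) ∧ ∀ i, (k i : ℝ) ≤ y i ∧ y i ≤ k i + 1}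

/-- The cell of the arrangement containing the generic point `x`. -/
def cellAt (L : Set (Plane →ᵃ[ℝ] ℝ)) (x : Plane) : Set Plane :=
  cellOf L {l ∈ L | 0 < l x} (fun i => ⌊x i⌋)

/-- The interior of the cell containing the generic point `x`. -/
def openCellAt (L : Set (Plane →ᵃ[ℝ] ℝ)) (x : Plane) : Set Plane :=
  {y | (∀ l ∈ L, 0 < l x * l y) ∧ ∀ i, (⌊x i⌋ : ℝ) < y i ∧ y i < ⌊x i⌋ + 1}

/-- Points on no line of the arrangement and on no grid line. -/
def generic (L : Set (Plane →ᵃ[ℝ] ℝ)) : Set Plane :=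
  {x | (∀ l ∈ L, l x ≠ 0) ∧ ∀ (i : Fin 2) (k : ℤ), x i ≠ k}

variable {L : Set (Plane →ᵃ[ℝ] ℝ)}

/-- The coordinate function minus a constant, as an affine map. -/
noncomputable def coordSub (i : Fin 2) (c : ℝ) : Plane →ᵃ[ℝ] ℝ :=
  (EuclideanSpace.proj i : Plane →L[ℝ] ℝ).toLinearMap.toAffineMap - AffineMap.const ℝ Plane c

@[simp] theorem coordSub_apply (i : Fin 2) (c : ℝ) (x : Plane) : coordSub i c x = x i - c := by
  simp [coordSub]

theorem coordSub_ne_zero (i : Fin 2) (c : ℝ) : coordSub i c ≠ 0 := by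
  intro h
  have := DFunLike.congr_fun h (bas i + c • bas i)
  simp [bas] at this

theorem mem_cellAt {x y : Plane} : y ∈ cellAt L x ↔
    (∀ l ∈ L, (0 < l x → 0 ≤ l y) ∧ (l x ≤ 0 → l y ≤ 0)) ∧
      ∀ i, (⌊x i⌋ : ℝ) ≤ y i ∧ y i ≤ ⌊x i⌋ + 1 := by
  simp only [cellAt, cellOf, mem_ofPred_eq]
  refine and_congr (forall₂_congr fun l hl => ?_) Iff.rfl
  simp [hl]

theorem continuous_coord (i : Fin 2) : Continuous fun y : Plane => y i := by fun_prop

theorem isOpen_openCellAt (hL : L.Finite) (x : Plane) : IsOpen (openCellAt L x) := by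
  have : openCellAt L x = (⋂ l ∈ L, {y | 0 < l x * l y}) ∩
      ⋂ i, {y : Plane | (⌊x i⌋ : ℝ) < y i ∧ y i < ⌊x i⌋ + 1} := by
    ext y; simp [openCellAt]
  rw [this]
  refine (hL.isOpen_biInter fun l _ => ?_).inter (isOpen_iInter_of_finite fun i => ?_)
  · have := l.continuous_of_finiteDimensional
    exact isOpen_lt continuous_const (by fun_prop)
  · exact (isOpen_lt continuous_const (continuous_coord i)).inter
      (isOpen_lt (continuous_coord i) continuous_const)

theorem isClosed_cellAt (x : Plane) : IsClosed (cellAt L x) := by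
  have : cellAt L x = (⋂ l ∈ L, ({y | 0 < l x → 0 ≤ l y} ∩ {y | l x ≤ 0 → l y ≤ 0})) ∩
      ⋂ i, {y : Plane | (⌊x i⌋ : ℝ) ≤ y i ∧ y i ≤ ⌊x i⌋ + 1} := by
    ext y; simp only [mem_cellAt, mem_inter_iff, mem_iInter, mem_ofPred_eq]
  rw [this]
  refine IsClosed.inter (isClosed_biInter fun l _ => ?_) (isClosed_iInter fun i => ?_)
  · have := l.continuous_of_finiteDimensional
    refine IsClosed.inter (isClosed_imp isOpen_const ?_) (isClosed_imp isOpen_const ?_)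
    · exact isClosed_le continuous_const this
    · exact isClosed_le this continuous_const
  · exact (isClosed_le continuous_const (continuous_coord i)).inter
      (isClosed_le (continuous_coord i) continuous_const)

theorem openCellAt_subset (x : Plane) : openCellAt L x ⊆ cellAt L x := by
  intro y hy
  refine mem_cellAt.2 ⟨fun l hl => ⟨fun h => ?_, fun h => ?_⟩, fun i =>
    ⟨(hy.2 i).1.le, (hy.2 i).2.le⟩⟩
  · exact ((mul_pos_iff_of_pos_left h).1 (hy.1 l hl)).le
  · have := hy.1 l hl
    by_contra h'
    nlinarith

theorem self_mem_openCellAt {x : Plane} (hx : x ∈ generic L) : x ∈ openCellAt L x := by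
  refine ⟨fun l hl => mul_self_pos.2 (hx.1 l hl), fun i => ⟨?_, Int.lt_floor_add_one _⟩⟩
  exact lt_of_le_of_ne (Int.floor_le _) (Ne.symm (hx.2 i _))

/-- Moving from a point of the closed cell towards the generic point `x` makes every weak inequality
strict at once. -/
theorem cellAt_subset_closure {x : Plane} (hx : x ∈ generic L) :
    cellAt L x ⊆ closure (openCellAt L x) := by
  intro z hz
  have hz := mem_cellAt.1 hz
  have hx' := self_mem_openCellAt hx
  have hlim : Tendsto (fun t : ℝ => AffineMap.lineMap z x t) (𝓝[>] 0) (𝓝 z) := by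
    have : Continuous fun t : ℝ => (AffineMap.lineMap z x t : Plane) := by fun_prop
    simpa using (this.tendsto 0).mono_left nhdsWithin_le_nhds
  refine mem_closure_of_tendsto hlim ?_
  have : Ioc (0 : ℝ) 1 ∈ 𝓝[>] (0 : ℝ) := Ioc_mem_nhdsGT one_pos
  filter_upwards [this] with t ht
  refine ⟨fun l hl => ?_, fun i => ?_⟩
  · rw [AffineMap.apply_lineMap, AffineMap.lineMap_apply]
    simp only [vsub_eq_sub, smul_eq_mul, vadd_eq_add]
    have h1 := hx'.1 l hl
    have h2 : 0 ≤ l x * l z := by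
      rcases lt_or_ge 0 (l x) with h | h
      · exact mul_nonneg h.le ((hz.1 l hl).1 h)
      · exact mul_nonneg_of_nonpos_of_nonpos h ((hz.1 l hl).2 h)
    have e : l x * (t * (l x - l z) + l z) = t * (l x * l x) + (1 - t) * (l x * l z) := by ring
    rw [e]
    have := mul_pos ht.1 h1
    have := mul_nonneg (sub_nonneg.2 ht.2) h2
    linarith
  · have e : (AffineMap.lineMap z x t : Plane) i = t * x i + (1 - t) * z i := by
      simp [AffineMap.lineMap_apply]; ring
    rw [e]
    have h1 := hx'.2 i
    have h2 := hz.2 i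
    have ht1 := ht.1
    have ht2 := sub_nonneg.2 ht.2
    constructor <;> nlinarith

/-- A cell is coded by the signs of the lines and the integer parts of the coordinates. At a point
of an open cell all inequalities are strict, so they leave a closed cell containing that point no
other code. -/
theorem cellAt_eq_of_mem {x x' w : Plane} (hx : x ∈ generic L) 
    (hw : w ∈ cellAt L x) (hw' : w ∈ openCellAt L x') : cellAt L x = cellAt L x' := by
  have hw := mem_cellAt.1 hw
  have hA : ∀ l ∈ L, (0 < l x ↔ 0 < l x') := by
    intro l hl
    have h1 := hw'.1 l hl
    have h2 := hw.1 l hl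
    have h3 := hx.1 l hl
    constructor
    · intro h
      have := h2.1 h
      by_contra h'
      nlinarith
    · intro h
      by_contra h'
      have := h2.2 (not_lt.1 h')
      nlinarith
  have hk : ∀ i, ⌊x i⌋ = ⌊x' i⌋ := by
    intro i
    have h1 := hw'.2 i
    have h2 := hw.2 i
    have h3 : (⌊x' i⌋ : ℝ) < ⌊x i⌋ + 1 := h1.1.trans_le h2.2
    have h4 : (⌊x i⌋ : ℝ) < ⌊x' i⌋ + 1 := h2.1.trans_lt h1.2
    norm_cast at h3 h4
    omega
  unfold cellAt
  congr 1
  · ext l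
    exact and_congr_right fun hl => hA l hl
  · exact funext hk

/-- The complement is a countable union of zero sets of nonzero affine functions, each closed with
dense complement, so the Baire theorem applies. -/
theorem dense_generic (hL : L.Finite) (h0 : ∀ l ∈ L, l ≠ 0) : Dense (generic L) := by
  have hd : ∀ l : Plane →ᵃ[ℝ] ℝ, l ≠ 0 → Dense {x : Plane | l x ≠ 0} := by
    intro l hl x
    obtain ⟨z, hz⟩ : ∃ z, l z ≠ 0 := by
      by_contra! h
      exact hl (by ext z; simp [h z])
    by_cases hx : l x = 0
    · have hlim : Tendsto (fun t : ℝ => AffineMap.lineMap x z t) (𝓝[>] 0) (𝓝 x) := by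
        have : Continuous fun t : ℝ => (AffineMap.lineMap x z t : Plane) := by fun_prop
        simpa using (this.tendsto 0).mono_left nhdsWithin_le_nhds
      refine mem_closure_of_tendsto hlim ?_
      filter_upwards [self_mem_nhdsWithin] with t ht
      have ht : 0 < t := ht
      change l (AffineMap.lineMap x z t) ≠ 0
      rw [AffineMap.apply_lineMap, AffineMap.lineMap_apply]
      simp [hx, hz, ht.ne']
    · exact subset_closure hx
  have ho : ∀ l : Plane →ᵃ[ℝ] ℝ, IsOpen {x : Plane | l x ≠ 0} := fun l =>
    isOpen_ne_fun l.continuous_of_finiteDimensional continuous_const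
  have hgen : generic L = ⋂ l ∈ L ∪ range (fun p : Fin 2 × ℤ => coordSub p.1 p.2),
      {x : Plane | l x ≠ 0} := by
    ext x
    simp only [generic, mem_ofPred_eq, mem_iInter, mem_union, mem_range, Prod.exists]
    constructor
    · rintro ⟨h1, h2⟩ l (hl | ⟨i, k, rfl⟩)
      · exact h1 l hl
      · simpa [sub_eq_zero] using h2 i k
    · intro h
      refine ⟨fun l hl => h l (Or.inl hl), fun i k => ?_⟩
      simpa [sub_eq_zero] using h _ (Or.inr ⟨i, k, rfl⟩)
  rw [hgen]
  refine dense_biInter_of_isOpen (fun l _ => ho l) (hL.countable.union (countable_range _)) ?_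
  rintro l (hl | ⟨p, rfl⟩)
  · exact hd l (h0 l hl)
  · exact hd _ (coordSub_ne_zero _ _)

/-- The integer grid is included in the arrangement precisely so that each cell is bounded, hence a
polytope and not merely a polyhedron. -/
theorem cellAt_polytope (hL : L.Finite) (x : Plane) :
    ∃ s : Finset Plane, cellAt L x = convexHull ℝ (s : Set Plane) := by
  set C : Set (Plane →ᵃ[ℝ] ℝ) := {l ∈ L | 0 < l x} ∪ (fun l => -l) '' {l ∈ L | l x ≤ 0} ∪
    range (fun i : Fin 2 => coordSub i ⌊x i⌋) ∪ range (fun i : Fin 2 => - coordSub i (⌊x i⌋ + 1))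
  have hCfin : C.Finite := (((hL.subset (sep_subset _ _)).union
    ((hL.subset (sep_subset _ _)).image _)).union (finite_range _)).union (finite_range _)
  have hC : cellAt L x = {y | ∀ c ∈ C, 0 ≤ c y} := by
    ext y
    rw [mem_cellAt]
    constructor
    · rintro ⟨h1, h2⟩ c (((hc | ⟨l, hl, rfl⟩) | ⟨i, rfl⟩) | ⟨i, rfl⟩)
      · exact (h1 c hc.1).1 hc.2
      · simpa using (h1 l hl.1).2 hl.2
      · simpa using (h2 i).1
      · simpa using (h2 i).2
    · intro h
      refine ⟨fun l hl => ⟨fun h' => h l (Or.inl (Or.inl (Or.inl ⟨hl, h'⟩))), fun h' => ?_⟩,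
        fun i => ⟨?_, ?_⟩⟩
      · simpa using h (-l) (Or.inl (Or.inl (Or.inr ⟨l, ⟨hl, h'⟩, rfl⟩)))
      · simpa using h _ (Or.inl (Or.inr ⟨i, rfl⟩))
      · simpa using h _ (Or.inr ⟨i, rfl⟩)
  rw [hC]
  refine exists_finset_convexHull_of_polyhedron hCfin ?_
  rw [← hC]
  refine Metric.isCompact_of_isClosed_isBounded (isClosed_cellAt x) ?_
  have hK : IsCompact (univ.pi fun i : Fin 2 => Icc (⌊x i⌋ : ℝ) (⌊x i⌋ + 1)) :=
    isCompact_univ_pi fun i => isCompact_Icc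
  have := (hK.image (PiLp.continuous_toLp 2 (fun _ : Fin 2 => ℝ))).isBounded
  refine this.subset fun y hy => ⟨WithLp.ofLp y, fun i _ => (mem_cellAt.1 hy).2 i, rfl⟩

theorem finite_cells_meeting (hL : L.Finite) (x : Plane) (r : ℝ) :
    {P ∈ cellAt L '' generic L | (P ∩ Metric.ball x r).Nonempty}.Finite := by
  have hfin : (image2 (cellOf L) (𝒫 L)
      (univ.pi fun i : Fin 2 => Icc ⌊x i - r - 1⌋ ⌊x i + r⌋)).Finite :=
    hL.finite_subsets.image2 _ (Finite.pi fun i => finite_Icc _ _)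
  refine hfin.subset ?_
  rintro P ⟨⟨y, hy, rfl⟩, z, hz, hzr⟩
  refine ⟨_, sep_subset _ _, _, fun i _ => ?_, rfl⟩
  have h1 := (mem_cellAt.1 hz).2 i
  have h2 : |z i - x i| < r := by
    refine lt_of_le_of_lt ?_ (mem_ball_iff_norm.1 hzr)
    exact OpLe.abs_coord_le (z - x) i
  rw [abs_lt] at h2
  constructor
  · rw [← Int.lt_add_one_iff, Int.floor_lt]
    push_cast
    linarith
  · exact Int.le_floor.2 (by linarith)

theorem isPolytopeDecomposition_arrangement (hL : L.Finite) (h0 : ∀ l ∈ L, l ≠ 0) :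
    IsPolytopeDecomposition (cellAt L '' generic L) where
  polytope := by
    rintro _ ⟨x, -, rfl⟩
    exact cellAt_polytope hL x
  fullDim := by
    rintro _ ⟨x, hx, rfl⟩
    exact ⟨x, interior_maximal (openCellAt_subset x) (isOpen_openCellAt hL x)
      (self_mem_openCellAt hx)⟩
  cover := by
    refine eq_univ_of_forall fun z => ?_
    set S := {P ∈ cellAt L '' generic L | (P ∩ Metric.ball z 1).Nonempty}
    -- Only finitely many cells meet the ball, so their union is closed. It contains all generic
    -- points of the ball, and these accumulate at `z`.
    have hS : IsClosed (⋃₀ S) := by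
      rw [sUnion_eq_biUnion]
      refine (finite_cells_meeting hL z 1).isClosed_biUnion ?_
      rintro _ ⟨⟨x, -, rfl⟩, -⟩
      exact isClosed_cellAt x
    have hz : z ∈ closure (Metric.ball z 1 ∩ generic L) :=
      (dense_generic hL h0).open_subset_closure_inter Metric.isOpen_ball
        (Metric.mem_ball_self one_pos)
    have hsub : Metric.ball z 1 ∩ generic L ⊆ ⋃₀ S := fun x hx =>
      have hxc := openCellAt_subset x (self_mem_openCellAt hx.2)
      mem_sUnion.2 ⟨cellAt L x, ⟨⟨x, hx.2, rfl⟩, ⟨x, hxc, hx.1⟩⟩, hxc⟩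
    have : z ∈ ⋃₀ S := closure_minimal hsub hS hz
    exact sUnion_subset_sUnion (sep_subset _ _) this
  inter := by
    have key : ∀ x ∈ generic L, ∀ x' ∈ generic L, cellAt L x ≠ cellAt L x' →
        cellAt L x ∩ cellAt L x' ⊆ frontier (cellAt L x) := by
      rintro x hx x' hx' hne z ⟨hz, hz'⟩
      refine ⟨subset_closure hz, fun hi => hne ?_⟩
      obtain ⟨w, hw, hw'⟩ := mem_closure_iff.1 (cellAt_subset_closure hx' hz') _ isOpen_interior hi
      exact cellAt_eq_of_mem hx (interior_subset hw) hw'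
    rintro _ ⟨x, hx, rfl⟩ _ ⟨x', hx', rfl⟩ hne
    refine subset_inter (key x hx x' hx' hne) ?_
    rw [inter_comm]
    exact key x' hx' x hx hne.symm
  locallyFinite := finite_cells_meeting hL

theorem convex_openCellAt (x : Plane) : Convex ℝ (openCellAt L x) := by
  intro y hy z hz a b ha hb hab
  refine ⟨fun l hl => ?_, fun i => ?_⟩
  · rw [Convex.combo_affine_apply hab]
    simp only [smul_eq_mul]
    have h1 := hy.1 l hl
    have h2 := hz.1 l hl
    rcases ha.eq_or_lt with h | h
    · have : b = 1 := by linarith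
      subst this; subst h
      simpa using h2
    · have := mul_pos h h1
      have := mul_nonneg hb h2.le
      nlinarith
  · have h1 := hy.2 i
    have h2 := hz.2 i
    have h3 := (convex_Ioo (⌊x i⌋ : ℝ) (⌊x i⌋ + 1)) h1 h2 ha hb hab
    simpa using h3

end Arrangement

/-- The arrangement consists of the zero sets of differences of distinct pieces. Off these the
pieces have pairwise different values, so by continuity `g` cannot switch from one piece to another
inside an open cell. -/
theorem IsPL.isCPWL {g : Plane → ℝ} (hg : IsPL g) (Ω : Opens Plane) : IsCPWL g Ω := by
  obtain ⟨hc, s, hs, hsel⟩ := hg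
  set L : Set (Plane →ᵃ[ℝ] ℝ) := image2 (· - ·) s s \ {0} with hL
  have hLfin : L.Finite := (hs.image2 _ hs).subset sdiff_subset
  have hL0 : ∀ l ∈ L, l ≠ 0 := fun l hl => hl.2
  refine ⟨hc.continuousOn, _, isPolytopeDecomposition_arrangement hLfin hL0, ?_⟩
  rintro _ ⟨x, hx, rfl⟩
  obtain ⟨a, ha, hga⟩ := hsel x
  have hsub : openCellAt L x ⊆ {y | g y = a y} := by
    intro y hy
    by_contra hne
    -- Where `g` equals `a` and where it equals another piece are closed sets covering the cell.
    -- Connectedness gives a common point, where the difference of two distinct pieces vanishes,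
    -- which is excluded in an open cell.
    have hpre := (convex_openCellAt (L := L) x).isPreconnected
    rw [isPreconnected_closed_iff] at hpre
    obtain ⟨z, hz, hza, hzb⟩ := hpre {y | g y = a y} (⋃ b ∈ s \ {a}, {y | g y = b y})
      (isClosed_eq hc a.continuous_of_finiteDimensional)
      ((hs.subset sdiff_subset).isClosed_biUnion fun b _ =>
        isClosed_eq hc b.continuous_of_finiteDimensional)
      (fun z _ => by
        obtain ⟨b, hb, hgb⟩ := hsel z
        by_cases hba : b = a
        · exact Or.inl (hba ▸ hgb)
        · exact Or.inr (mem_biUnion (⟨hb, hba⟩ : b ∈ s \ {a}) hgb))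
      ⟨x, self_mem_openCellAt hx, hga⟩
      ⟨y, hy, by
        obtain ⟨b, hb, hgb⟩ := hsel y
        refine mem_biUnion (⟨hb, ?_⟩ : b ∈ s \ {a}) hgb
        rintro rfl
        exact hne hgb⟩
    obtain ⟨b, hb, hgb⟩ := mem_iUnion₂.1 hzb
    have hmem : a - b ∈ L := ⟨⟨a, ha, b, hb.1, rfl⟩, fun h => hb.2 (sub_eq_zero.1 h).symm⟩
    have h1 := hz.1 _ hmem
    have h2 : (a - b) z = 0 := by
      have h3 : g z = a z := hza
      have h4 : g z = b z := hgb
      simp [← h3, ← h4]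
    rw [h2, mul_zero] at h1
    exact lt_irrefl _ h1
  refine ⟨a, fun y hy => ?_⟩
  exact closure_minimal hsub (isClosed_eq hc a.continuous_of_finiteDimensional)
    (cellAt_subset_closure hx hy.1)

end HTV

/-! ### Approximation by convex piecewise affine functions. -/

namespace HTV

/-- Continuous convex piecewise affine functions. -/
structure IsConvexPL (c : Plane → ℝ) : Prop where
  pl : IsPL c
  convex : ConvexOn ℝ univ c

namespace IsConvexPL

variable {b c : Plane → ℝ}

theorem continuous (h : IsConvexPL c) : Continuous c := h.pl.1

theorem add (hb : IsConvexPL b) (hc : IsConvexPL c) : IsConvexPL fun x => b x + c x :=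
  ⟨hb.pl.add hc.pl, hb.convex.add hc.convex⟩

theorem const_mul (hc : IsConvexPL c) {t : ℝ} (ht : 0 ≤ t) : IsConvexPL fun x => t * c x :=
  ⟨hc.pl.const_mul t, hc.convex.smul ht⟩

theorem max (hb : IsConvexPL b) (hc : IsConvexPL c) : IsConvexPL fun x => max (b x) (c x) :=
  ⟨hb.pl.max hc.pl, hb.convex.sup hc.convex⟩

theorem affine (a : Plane →ᵃ[ℝ] ℝ) : IsConvexPL a :=
  ⟨IsPL.affine a, convex_univ, fun x _ y _ s t _ _ hst => by
    rw [Convex.combo_affine_apply hst]⟩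

theorem const (t : ℝ) : IsConvexPL fun _ => t := affine (AffineMap.const ℝ Plane t)

theorem finset_sup' {s : Finset (Plane →ᵃ[ℝ] ℝ)} (hs : s.Nonempty) :
    IsConvexPL fun x => s.sup' hs fun a => a x := by
  refine ⟨⟨?_, s, s.finite_toSet, fun x => ?_⟩, convex_univ, fun x _ y _ α β hα hβ h => ?_⟩
  · exact Continuous.finset_sup'_apply hs fun a _ => a.continuous_of_finiteDimensional
  · exact Finset.exists_mem_eq_sup' hs fun a => a x
  · refine Finset.sup'_le _ _ fun a ha => ?_
    rw [Convex.combo_affine_apply h]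
    have h1 := Finset.le_sup' (fun a : Plane →ᵃ[ℝ] ℝ => a x) ha
    have h2 := Finset.le_sup' (fun a : Plane →ᵃ[ℝ] ℝ => a y) ha
    simp only [smul_eq_mul]
    exact add_le_add (mul_le_mul_of_nonneg_left h1 hα) (mul_le_mul_of_nonneg_left h2 hβ)

end IsConvexPL

/-- The tangent plane of `u` at `y`. -/
noncomputable def tangent (u : Plane → ℝ) (y : Plane) : Plane →ᵃ[ℝ] ℝ :=
  (fderiv ℝ u y).toLinearMap.toAffineMap + AffineMap.const ℝ Plane (u y - fderiv ℝ u y y)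

theorem tangent_apply (u : Plane → ℝ) (x y : Plane) :
    tangent u y x = u y + dd (x - y) u y := by
  simp [tangent, dd]; ring

/-- The Hessian is nonnegative only on `S`, so convexity is used only along the segment from `y` to
`x`, which stays in `S`. -/
theorem tangent_le {u : Plane → ℝ} (hu : Smooth u) {S : Set Plane} (hS : Convex ℝ S)
    (hpos : ∀ x ∈ S, ∀ e, 0 ≤ dd e (dd e u) x) {x y : Plane} (hx : x ∈ S) (hy : y ∈ S) :
    tangent u y x ≤ u x := by
  set e := x - y with he
  have h1 := fun t => hasDerivAt_line hu y e t
  have h2 := fun t => hasDerivAt_line (hu.dd e) y e t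
  have hd : deriv (fun t : ℝ => u (y + t • e)) = fun t => dd e u (y + t • e) :=
    funext fun t => (h1 t).deriv
  have hc : ConvexOn ℝ (Icc (0 : ℝ) 1) fun t : ℝ => u (y + t • e) := by
    refine convexOn_of_deriv2_nonneg (convex_Icc 0 1)
      (fun t _ => (h1 t).continuousAt.continuousWithinAt)
      (fun t _ => (h1 t).differentiableAt.differentiableWithinAt) ?_ ?_
    · rw [hd]; exact fun t _ => (h2 t).differentiableAt.differentiableWithinAt
    · intro t ht
      rw [interior_Icc] at ht
      rw [Function.iterate_succ, Function.iterate_one, Function.comp_apply, hd, (h2 t).deriv]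
      refine hpos _ ?_ e
      rw [he]
      exact hS.add_smul_sub_mem hy hx ⟨ht.1.le, ht.2.le⟩
  have h3 := hc.le_slope_of_hasDerivAt (left_mem_Icc.2 zero_le_one) (right_mem_Icc.2 zero_le_one)
    zero_lt_one (h1 0)
  rw [tangent_apply]
  simp only [slope_def_field, he, one_smul, zero_smul, add_zero, sub_zero, div_one] at h3
  rw [add_sub_cancel] at h3
  linarith

/-- A smooth function with nonnegative Hessian on a compact convex set is a uniform limit there
of convex piecewise affine functions. -/
theorem exists_convexPL_near {u : Plane → ℝ} (hu : Smooth u) {S : Set Plane} (hS : Convex ℝ S)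
    (hSc : IsCompact S) (hpos : ∀ x ∈ S, ∀ e, 0 ≤ dd e (dd e u) x) {τ : ℝ} (hτ : 0 < τ) :
    ∃ c, IsConvexPL c ∧ ∀ x ∈ S, |c x - u x| ≤ τ := by
  rcases S.eq_empty_or_nonempty with rfl | ⟨x₀, hx₀⟩
  · exact ⟨_, IsConvexPL.const 0, fun x hx => hx.elim⟩
  -- Each tangent plane is within `τ` of `u` near its contact point. By compactness finitely many
  -- suffice, and their maximum stays below `u` on `S`. The maximum is convex on the whole plane
  -- even though `u` need not be.
  obtain ⟨t, ht, hcov⟩ := hSc.elim_nhds_subcover (fun y => {x | u x - tangent u y x < τ})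
    (fun y _ => by
      have hcont : Continuous fun x => u x - tangent u y x :=
        hu.continuous.sub (tangent u y).continuous_of_finiteDimensional
      refine (isOpen_lt hcont continuous_const).mem_nhds ?_
      simp [tangent_apply, dd, hτ])
  classical
  have hne : (t.image (tangent u)).Nonempty := by
    rw [Finset.image_nonempty]
    obtain ⟨y, hy, -⟩ := mem_iUnion₂.1 (hcov hx₀)
    exact ⟨y, hy⟩
  refine ⟨_, IsConvexPL.finset_sup' hne, fun x hx => ?_⟩
  rw [abs_le]
  constructor
  · obtain ⟨y, hy, hxy⟩ := mem_iUnion₂.1 (hcov hx)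
    have := Finset.le_sup' (fun a : Plane →ᵃ[ℝ] ℝ => a x) (Finset.mem_image_of_mem (tangent u) hy)
    have hxy : u x - tangent u y x < τ := hxy
    linarith
  · have : (t.image (tangent u)).sup' hne (fun a => a x) ≤ u x := by
      refine Finset.sup'_le _ _ fun a ha => ?_
      obtain ⟨y, hy, rfl⟩ := Finset.mem_image.1 ha
      exact tangent_le hu hS hpos hx (ht y hy)
    linarith

end HTV

/-! ### Squares, quadratic forms, and the gluing of two convex differences. -/

namespace HTV

section Squares

/-- The distance in the supremum norm. -/
noncomputable def supDist (c x : Plane) : ℝ := max |x 0 - c 0| |x 1 - c 1|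

/-- Open squares. -/
def sq (c : Plane) (r : ℝ) : Set Plane := {x | supDist c x < r}

/-- Closed squares. -/
def csq (c : Plane) (r : ℝ) : Set Plane := {x | supDist c x ≤ r}

variable {c x : Plane} {r r' : ℝ}

theorem supDist_lt_iff : supDist c x < r ↔ ∀ i, |x i - c i| < r := by
  simp [supDist, Fin.forall_fin_two]

theorem supDist_le_iff : supDist c x ≤ r ↔ ∀ i, |x i - c i| ≤ r := by
  simp [supDist, Fin.forall_fin_two]

theorem supDist_nonneg (c x : Plane) : 0 ≤ supDist c x := (abs_nonneg _).trans (le_max_left _ _)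

/-- The supremum distance is used because it is itself convex and piecewise affine: the gluing in
`exists_patch` takes its transition profile from it. -/
theorem isConvexPL_supDist (c : Plane) : IsConvexPL (supDist c) := by
  have h : ∀ i : Fin 2, IsConvexPL fun x : Plane => |x i - c i| := by
    intro i
    have := (IsConvexPL.affine (coordSub i (c i))).max (IsConvexPL.affine (-coordSub i (c i)))
    convert this using 2 with x
    simp [abs]
  exact (h 0).max (h 1)

theorem continuous_supDist (c : Plane) : Continuous (supDist c) := (isConvexPL_supDist c).continuous

theorem isOpen_sq (c : Plane) (r : ℝ) : IsOpen (sq c r) :=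
  isOpen_lt (continuous_supDist c) continuous_const

theorem isClosed_csq (c : Plane) (r : ℝ) : IsClosed (csq c r) :=
  isClosed_le (continuous_supDist c) continuous_const

theorem csq_subset_sq (h : r < r') : csq c r ⊆ sq c r' := fun _ hx => lt_of_le_of_lt hx h

theorem sq_subset_csq : sq c r ⊆ csq c r := fun x (hx : supDist c x < r) => hx.le

theorem csq_mono (h : r ≤ r') : csq c r ⊆ csq c r' := fun _ hx => le_trans hx h

theorem csq_eq_preimage (c : Plane) (r : ℝ) : csq c r =
    (MeasurableEquiv.toLp 2 (Fin 2 → ℝ)).symm ⁻¹'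
      (univ.pi fun i => Icc (c i - r) (c i + r)) := by
  ext x
  simp only [csq, mem_ofPred_eq, supDist_le_iff, mem_preimage, mem_univ_pi, mem_Icc, abs_le]
  refine forall_congr' fun i => ?_
  simp only [MeasurableEquiv.toLp_symm_apply]
  constructor <;> rintro ⟨h1, h2⟩ <;> constructor <;> linarith

theorem isCompact_csq (c : Plane) (r : ℝ) : IsCompact (csq c r) := by
  refine Metric.isCompact_of_isClosed_isBounded (isClosed_csq c r) ?_
  have hK : IsCompact (univ.pi fun i : Fin 2 => Icc (c i - r) (c i + r)) :=
    isCompact_univ_pi fun i => isCompact_Icc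
  have := (hK.image (PiLp.continuous_toLp 2 (fun _ : Fin 2 => ℝ))).isBounded
  refine this.subset fun y hy => ⟨WithLp.ofLp y, ?_, rfl⟩
  rw [csq_eq_preimage] at hy
  exact hy

theorem convex_csq (c : Plane) (r : ℝ) : Convex ℝ (csq c r) := by
  simpa [csq] using (isConvexPL_supDist c).convex.convex_le r

theorem volume_csq (c : Plane) (hr : 0 ≤ r) : volume.real (csq c r) = (2 * r) ^ 2 := by
  rw [csq_eq_preimage, Measure.real,
    (EuclideanSpace.volume_preserving_symm_measurableEquiv_toLp (Fin 2)).measure_preimage_equiv,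
    pi_univ_Icc (fun i => c i - r) (fun i => c i + r),
    Real.volume_Icc_pi_toReal fun i => by simp only; linarith]
  simp
  ring

theorem integral_cutoff_ge {χ : Plane → ℝ} {A : Set Plane} (hχ : IsTestOn A χ)
    (h0 : ∀ x, 0 ≤ χ x) (hr : 0 ≤ r) (h1 : ∀ x ∈ csq c r, χ x = 1) :
    (2 * r) ^ 2 ≤ ∫ x, χ x := by
  have hm := (isClosed_csq c r).measurableSet
  rw [← volume_csq c hr, ← integral_indicator_one hm]
  refine integral_mono ((integrable_indicator_iff hm).2 ?_) hχ.integrable fun x => ?_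
  · exact continuousOn_const.integrableOn_compact (isCompact_csq c r)
  · by_cases hx : x ∈ csq c r
    · simp [hx, h1 x hx]
    · simp [hx, h0 x]

theorem integral_cutoff_le {χ : Plane → ℝ} (hχ : IsTestOn (csq c r) χ)
    (h1 : ∀ x, χ x ≤ 1) (hr : 0 ≤ r) : ∫ x, χ x ≤ (2 * r) ^ 2 := by
  have hm := (isClosed_csq c r).measurableSet
  rw [← volume_csq c hr, ← integral_indicator_one hm]
  refine integral_mono hχ.integrable ((integrable_indicator_iff hm).2 ?_) fun x => ?_
  · exact continuousOn_const.integrableOn_compact (isCompact_csq c r)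
  · by_cases hx : x ∈ csq c r
    · simp [hx, h1 x]
    · simp [hx, hχ.eq_zero hx]

end Squares

section Quadratic

/-- The quadratic form `x ↦ ½ ⟨N x, x⟩`. -/
noncomputable def quad (N : Fin 2 → Fin 2 → ℝ) (x : Plane) : ℝ :=
  ∑ i, ∑ j, (N i j / 2) * (x i * x j)

theorem smooth_coord (i : Fin 2) : Smooth fun x : Plane => x i := by
  exact (EuclideanSpace.proj i : Plane →L[ℝ] ℝ).contDiff

theorem dd_coord (i : Fin 2) (e : Plane) : dd e (fun x : Plane => x i) = fun _ => e i := by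
  funext x
  have : HasFDerivAt (fun x : Plane => x i) (EuclideanSpace.proj i : Plane →L[ℝ] ℝ) x :=
    (EuclideanSpace.proj i : Plane →L[ℝ] ℝ).hasFDerivAt
  simp [dd, this.fderiv]

theorem smooth_quad (N : Fin 2 → Fin 2 → ℝ) : Smooth (quad N) :=
  ContDiff.sum fun i _ => ContDiff.sum fun j _ =>
    contDiff_const.mul ((smooth_coord i).mul (smooth_coord j))

theorem dd_quad (N : Fin 2 → Fin 2 → ℝ) (e : Plane) : dd e (quad N) =
    fun x => ∑ i, ∑ j, (N i j / 2) * (x i * e j + x j * e i) := by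
  have h : ∀ i j, Smooth fun x : Plane => x i * x j := fun i j =>
    (smooth_coord i).mul (smooth_coord j)
  have h2 : ∀ i j, Smooth fun x : Plane => N i j / 2 * (x i * x j) := fun i j =>
    contDiff_const.mul (h i j)
  unfold quad
  rw [dd_sum _ fun i _ => ContDiff.sum fun j _ => h2 i j]
  funext x
  refine Finset.sum_congr rfl fun i _ => ?_
  rw [dd_sum _ fun j _ => h2 i j]
  refine Finset.sum_congr rfl fun j _ => ?_
  rw [dd_const_mul (h i j), dd_mul (smooth_coord i) (smooth_coord j), dd_coord, dd_coord]

theorem dd_dd_quad {N : Fin 2 → Fin 2 → ℝ} (hN : ∀ i j, N i j = N j i) (e e' x : Plane) :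
    dd e (dd e' (quad N)) x = ∑ i, ∑ j, e i * e' j * N i j := by
  have h : ∀ i j, Smooth fun x : Plane => x i * e' j + x j * e' i := fun i j =>
    ((smooth_coord i).mul contDiff_const).add ((smooth_coord j).mul contDiff_const)
  have h2 : ∀ i j, Smooth fun x : Plane => N i j / 2 * (x i * e' j + x j * e' i) := fun i j =>
    contDiff_const.mul (h i j)
  have hc : ∀ (i : Fin 2) (t : ℝ), dd e (fun x : Plane => x i * t) x = e i * t := by
    intro i t
    have : (fun x : Plane => x i * t) = fun x => t * x i := by funext x; ring
    rw [this, dd_const_mul (smooth_coord i), dd_coord, mul_comm]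
  have hd : ∀ i j, dd e (fun x : Plane => N i j / 2 * (x i * e' j + x j * e' i)) x
      = N i j / 2 * (e i * e' j + e j * e' i) := by
    intro i j
    rw [dd_const_mul (h i j), dd_add ((smooth_coord i).mul contDiff_const)
      ((smooth_coord j).mul contDiff_const)]
    simp only [hc]
  rw [dd_quad, dd_sum _ fun i _ => ContDiff.sum fun j _ => h2 i j]
  simp only
  have : ∀ i, dd e (fun x : Plane => ∑ j, N i j / 2 * (x i * e' j + x j * e' i)) x
      = ∑ j, N i j / 2 * (e i * e' j + e j * e' i) := by
    intro i
    rw [dd_sum _ fun j _ => h2 i j]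
    exact Finset.sum_congr rfl fun j _ => hd i j
  rw [Finset.sum_congr rfl fun i _ => this i]
  simp only [Fin.sum_univ_two, hN 1 0]
  ring

theorem lap_quad {N : Fin 2 → Fin 2 → ℝ} (hN : ∀ i j, N i j = N j i) (x : Plane) :
    lap (quad N) x = ∑ i, N i i := by
  simp only [lap, dd_dd_quad hN]
  simp [Fin.sum_univ_two, bas]

/-- The negative part and the sign of a symmetric matrix. -/
theorem exists_sign_decomposition {H : Fin 2 → Fin 2 → ℝ} (hH : ∀ i j, H i j = H j i) :
    ∃ N S : Fin 2 → Fin 2 → ℝ, (∀ i j, N i j = N j i) ∧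
      (∀ e : Plane, 0 ≤ ∑ i, ∑ j, e i * e j * N i j) ∧
      (∀ e : Plane, 0 ≤ ∑ i, ∑ j, e i * e j * (H i j + N i j)) ∧ OpLe S 1 ∧
      ∑ i, ∑ j, H i j * S i j = (∑ i, H i i) + 2 * ∑ i, N i i := by
  obtain ⟨l, v, hv, h⟩ := exists_spectral H hH
  have hvv : ∀ a b, v a 0 * v b 0 + v a 1 * v b 1 = if a = b then 1 else 0 := by
    intro a b
    have := (orthonormal_iff_ite.1 hv) b a
    simp [PiLp.inner_apply, Fin.sum_univ_two] at this
    rw [this]; simp [eq_comm]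
  have h00 := hvv 0 0
  have h11 := hvv 1 1
  have h01 := hvv 0 1
  simp only [if_true, Fin.zero_ne_one, if_false] at h00 h11 h01
  -- The sign of each eigenvalue; the identity is `|l| = l + 2 l⁻`.
  obtain ⟨s, hs⟩ : ∃ s : Fin 2 → ℝ, ∀ k, |s k| ≤ 1 ∧ l k * s k = l k + 2 * max (-l k) 0 := by
    refine Classical.skolem (p := fun k s => |s| ≤ 1 ∧ l k * s = l k + 2 * max (-l k) 0).1
      fun k => ?_
    rcases le_total 0 (l k) with hk | hk
    · exact ⟨1, by simp, by rw [max_eq_right (by linarith)]; ring⟩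
    · exact ⟨-1, by simp, by rw [max_eq_left (by linarith)]; ring⟩
  have hquad : ∀ (t : Fin 2 → ℝ) (e : Plane), ∑ i, ∑ j, e i * e j * ∑ k, t k * (v k i * v k j)
      = ∑ k, t k * (v k 0 * e 0 + v k 1 * e 1) ^ 2 := by
    intro t e
    simp only [Fin.sum_univ_two]; ring
  refine ⟨fun i j => ∑ k, max (-l k) 0 * (v k i * v k j),
    fun i j => ∑ k, s k * (v k i * v k j), ?_, ?_, ?_, ?_, ?_⟩
  · intro i j
    simp only [mul_comm (v _ i)]
  · intro e
    rw [hquad]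
    exact Finset.sum_nonneg fun k _ => mul_nonneg (le_max_right _ _) (sq_nonneg _)
  · intro e
    have : ∀ i j, H i j + ∑ k, max (-l k) 0 * (v k i * v k j)
        = ∑ k, (l k + max (-l k) 0) * (v k i * v k j) := by
      intro i j
      rw [h]
      simp only [← Finset.sum_add_distrib, add_mul]
    simp only [this]
    rw [hquad]
    refine Finset.sum_nonneg fun k _ => mul_nonneg ?_ (sq_nonneg _)
    linarith [le_max_left (-l k) 0]
  · intro x y
    have hb : ∀ z : Plane, ∑ k, inner ℝ (v k) z ^ 2 ≤ ‖z‖ ^ 2 := by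
      intro z
      simpa [sq_abs] using hv.sum_inner_products_le z (s := Finset.univ)
    have e1 : ∑ i, ∑ j, x i * (∑ k, s k * (v k i * v k j)) * y j
        = ∑ k, (s k * inner ℝ (v k) x) * inner ℝ (v k) y := by
      simp [PiLp.inner_apply, Fin.sum_univ_two]; ring
    rw [e1, one_mul]
    have e2 : ∑ k, (s k * inner ℝ (v k) x) ^ 2 ≤ ‖x‖ ^ 2 := by
      refine le_trans (Finset.sum_le_sum fun k _ => ?_) (hb x)
      rw [mul_pow]
      have : s k ^ 2 ≤ 1 := by rw [← sq_abs]; nlinarith [(hs k).1, abs_nonneg (s k)]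
      nlinarith [sq_nonneg (inner ℝ (v k) x)]
    refine (Real.sum_mul_le_sqrt_mul_sqrt _ _ _).trans ?_
    exact mul_le_mul (Real.sqrt_le_iff.2 ⟨norm_nonneg _, e2⟩)
      (Real.sqrt_le_iff.2 ⟨norm_nonneg _, hb y⟩) (Real.sqrt_nonneg _) (norm_nonneg _)
  · have e1 : ∑ i, ∑ j, H i j * ∑ k, s k * (v k i * v k j) = ∑ k, l k * s k := by
      simp only [h, Fin.sum_univ_two]
      linear_combination (l 0 * s 0 * (v 0 0 * v 0 0 + v 0 1 * v 0 1 + 1)) * h00 +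
        (l 1 * s 1 * (v 1 0 * v 1 0 + v 1 1 * v 1 1 + 1)) * h11 +
        ((l 0 * s 1 + l 1 * s 0) * (v 0 0 * v 1 0 + v 0 1 * v 1 1)) * h01
    rw [e1]
    simp only [(hs _).2, h, Fin.sum_univ_two]
    linear_combination (- l 0 - 2 * max (-l 0) 0) * h00 + (- l 1 - 2 * max (-l 1) 0) * h11

end Quadratic

/-- Local surgery: a convex-difference modification, supported in a square, that replaces the
convex difference `a₀ - b₀` by `a - b` in a smaller square. -/
theorem exists_patch {a b a₀ b₀ u β β₀ : Plane → ℝ} {c : Plane} {R r₁ r₂ τ : ℝ} (hτ : 0 < τ)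
    (hr : r₁ < r₂) (hr₂ : r₂ < R) (hr₁ : 0 < r₁) (hR : R ≤ 1) (ha : IsConvexPL a) (hb : IsConvexPL b)
    (ha₀ : IsConvexPL a₀) (hb₀ : IsConvexPL b₀)
    (hau : ∀ x ∈ sq c R, |a x - (u x + β x)| ≤ τ) (hbu : ∀ x ∈ sq c R, |b x - β x| ≤ τ)
    (hau₀ : ∀ x ∈ sq c R, |a₀ x - (u x + β₀ x)| ≤ τ) (hbu₀ : ∀ x ∈ sq c R, |b₀ x - β₀ x| ≤ τ) :
    ∃ X Y : Plane → ℝ, IsConvexPL X ∧ IsConvexPL Y ∧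
      (∀ x ∈ sq c r₁, X x - Y x = (a x - b x) - (a₀ x - b₀ x)) ∧
      (∀ x ∉ sq c r₂, X x - Y x = 0) ∧ (∀ x, |X x - Y x| ≤ (2 + 12 / (r₂ - r₁)) * τ) ∧
      (∀ x ∈ sq c R, |X x - (u x + β x + β₀ x)| ≤ (2 + 12 / (r₂ - r₁)) * τ) ∧
      (∀ x ∈ sq c R, |Y x - (u x + β x + β₀ x)| ≤ (2 + 12 / (r₂ - r₁)) * τ) := by
  have hd : 0 < r₂ - r₁ := sub_pos.2 hr
  -- The sums `A = a + b₀` and `B = b + a₀` are both within `2τ` of `u + β + β₀`, so `|A - B| ≤ 4τ`.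
  -- The slope `ε` makes the profile `d` below at least `4τ` on the inner square.
  obtain ⟨ε, hε⟩ : ∃ ε, ε = 4 * τ / (r₂ - r₁) := ⟨_, rfl⟩
  have hε0 : 0 < ε := by rw [hε]; positivity
  have hεr : ε * (r₂ - r₁) = 4 * τ := by rw [hε]; field_simp
  have hC : (2 + 12 / (r₂ - r₁)) * τ = 2 * τ + 3 * ε := by rw [hε]; field_simp; ring
  rw [hC]
  have hm := (isConvexPL_supDist c).const_mul hε0.le
  have hp := ((isConvexPL_supDist c).max (IsConvexPL.const r₂)).const_mul hε0.le
  have hA := ha.add hb₀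
  have hB := hb.add ha₀
  have hM := (hB.add hp).max (hA.add hm)
  -- Write `m` and `p` for the convex functions of `hm` and `hp`, and `d = p - m ≥ 0`. With `M = max
  -- (B + p) (A + m)`, `X = max (A + 2p) (m + M)` and `Y = M + p`, one finds `X - Y = max (min (A -
  -- B) d) (-d)`, the truncation of `A - B` to `[-d, d]`. It equals `A - B` where `d ≥ 4τ` and
  -- vanishes where `d = 0`, that is, outside the square of radius `r₂`.
  refine ⟨_, _, (hA.add (hp.const_mul zero_le_two)).max (hm.add hM), hM.add hp, ?_, ?_, ?_, ?_, ?_⟩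
  all_goals intro x
  all_goals
    have hm0 := supDist_nonneg c x
    obtain ⟨m, hmx⟩ : ∃ m, supDist c x = m := ⟨_, rfl⟩
    obtain ⟨p, hpx⟩ : ∃ p, max m r₂ = p := ⟨_, rfl⟩
    have hp1 : m ≤ p := by rw [← hpx]; exact le_max_left _ _
    have hp2 : r₂ ≤ p := by rw [← hpx]; exact le_max_right _ _
    rw [hmx] at hm0
    have hmem : ∀ t, x ∈ sq c t ↔ m < t := fun t => by rw [← hmx]; rfl
    simp only [hmem, hmx, hpx]
  · intro hx
    have hx' : x ∈ sq c R := by rw [hmem]; linarith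
    have h1 := abs_le.1 (hau x hx')
    have h2 := abs_le.1 (hbu x hx')
    have h3 := abs_le.1 (hau₀ x hx')
    have h4 := abs_le.1 (hbu₀ x hx')
    have h5 : 4 * τ ≤ ε * p - ε * m := by nlinarith
    rcases le_total (b x + a₀ x + ε * p) (a x + b₀ x + ε * m) with h | h
    · rw [max_eq_right h, max_eq_left (by linarith)]; linarith
    · rw [max_eq_left h, max_eq_left (by linarith)]; linarith
  · intro hx
    have hpm : p = m := by rw [← hpx]; exact max_eq_left (not_lt.1 hx)
    rw [hpm]
    rcases le_total (b x + a₀ x + ε * m) (a x + b₀ x + ε * m) with h | h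
    · rw [max_eq_right h, max_eq_left (by linarith)]; linarith
    · rw [max_eq_left h, max_eq_right (by linarith)]; linarith
  -- The bound `|X - Y| ≤ d ≤ ε` uses no closeness to `u`, so it holds on the whole plane.
  · have h5 : ε * p - ε * m ≤ ε := by
      have : p - m ≤ 1 := by
        rw [← hpx]
        rcases le_total m r₂ with h | h
        · rw [max_eq_right h]; linarith
        · rw [max_eq_left h]; linarith
      nlinarith
    have h6 : ε * m ≤ ε * p := by nlinarith
    rw [abs_le]
    rcases le_total (b x + a₀ x + ε * p) (a x + b₀ x + ε * m) with h | h
    · rw [max_eq_right h]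
      rcases le_total (a x + b₀ x + 2 * (ε * p)) (ε * m + (a x + b₀ x + ε * m)) with h' | h'
      · rw [max_eq_right h']; constructor <;> linarith
      · rw [max_eq_left h']; constructor <;> linarith
    · rw [max_eq_left h]
      rcases le_total (a x + b₀ x + 2 * (ε * p)) (ε * m + (b x + a₀ x + ε * p)) with h' | h'
      · rw [max_eq_right h']; constructor <;> linarith
      · rw [max_eq_left h']; constructor <;> linarith
  all_goals
    intro hx
    have hx' : x ∈ sq c R := (hmem R).2 hx
    have h1 := abs_le.1 (hau x hx')
    have h2 := abs_le.1 (hbu x hx')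
    have h3 := abs_le.1 (hau₀ x hx')
    have h4 := abs_le.1 (hbu₀ x hx')
    have hm1 : ε * m ≤ ε := by nlinarith
    have hm2 : 0 ≤ ε * m := by positivity
    have hp3 : p ≤ 1 := by rw [← hpx]; exact max_le (by linarith) (by linarith)
    have hp4 : ε * p ≤ ε := by nlinarith
    have hp5 : 0 ≤ ε * p := by nlinarith
    have hM1 := le_max_left (b x + a₀ x + ε * p) (a x + b₀ x + ε * m)
    have hM2 : max (b x + a₀ x + ε * p) (a x + b₀ x + ε * m) ≤ u x + β x + β₀ x + 2 * τ + ε :=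
      max_le (by linarith) (by linarith)
  · rw [abs_le]
    constructor
    · have := le_max_left (a x + b₀ x + 2 * (ε * p))
        (ε * m + max (b x + a₀ x + ε * p) (a x + b₀ x + ε * m))
      linarith
    · have : max (a x + b₀ x + 2 * (ε * p))
        (ε * m + max (b x + a₀ x + ε * p) (a x + b₀ x + ε * m)) ≤ u x + β x + β₀ x + 2 * τ + 3 * ε :=
        max_le (by linarith) (by linarith)
      linarith
  · rw [abs_le]
    constructor <;> linarith

end HTV

/-! ### Energy estimate for the function assembled from disjoint squares. -/

namespace HTV

theorem ddiv_congr_eventually {F G : Fin 2 → Fin 2 → Plane → ℝ} {x : Plane}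
    (h : ∀ i j, F i j =ᶠ[𝓝 x] G i j) : ddiv F x = ddiv G x := by
  refine Finset.sum_congr rfl fun i _ => Finset.sum_congr rfl fun j _ => ?_
  have h1 : dd (bas j) (F i j) =ᶠ[𝓝 x] dd (bas j) (G i j) := by
    filter_upwards [(h i j).eventuallyEq_nhds] with y hy
    simp only [dd, hy.fderiv_eq]
  simp only [dd] at h1 ⊢
  rw [h1.fderiv_eq]

theorem lap_add {φ ψ : Plane → ℝ} (hφ : Smooth φ) (hψ : Smooth ψ) :
    lap (fun x => φ x + ψ x) = fun x => lap φ x + lap ψ x := by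
  funext x
  simp only [lap, ← Finset.sum_add_distrib]
  refine Finset.sum_congr rfl fun i _ => ?_
  rw [dd_add hφ hψ, dd_add (hφ.dd _) (hψ.dd _)]

theorem dd_dd_add {φ ψ : Plane → ℝ} (hφ : Smooth φ) (hψ : Smooth ψ) (e e' : Plane) :
    dd e (dd e' (fun x => φ x + ψ x)) = fun x => dd e (dd e' φ) x + dd e (dd e' ψ) x := by
  rw [dd_add hφ hψ, dd_add (hφ.dd _) (hψ.dd _)]

theorem Smooth.locallyIntegrableOn {φ : Plane → ℝ} (h : Smooth φ) (A : Set Plane) :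
    LocallyIntegrableOn φ A := h.continuous.locallyIntegrable.locallyIntegrableOn A

section Assembly

variable {ι : Type*} [Fintype ι] {c : ι → Plane} {R : ℝ}

theorem sum_le_of_disjoint_squares (hdisj : ∀ k l x, x ∈ sq (c k) R → x ∈ sq (c l) R → k = l)
    {ψ : ι → Plane → ℝ} (hψ : ∀ k, ∀ x ∉ sq (c k) R, ψ k x = 0) {x : Plane} {t : ℝ} (ht : 0 ≤ t)
    (h : ∀ k, x ∈ sq (c k) R → ψ k x ≤ t) : ∑ k, ψ k x ≤ t := by
  by_cases hx : ∃ k, x ∈ sq (c k) R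
  · obtain ⟨k, hk⟩ := hx
    rw [Finset.sum_eq_single k (fun l _ hl => hψ l x fun hl' => hl (hdisj l k x hl' hk))
      (fun h => (h (Finset.mem_univ k)).elim)]
    exact h k hk
  · push Not at hx
    rw [Finset.sum_eq_zero fun k _ => hψ k x (hx k)]
    exact ht

/-- Assembling local convex-difference approximations on a family of disjoint squares. -/
theorem exists_PL_of_squares {Ω : Opens Plane} {f : Plane → ℝ} (hf : Smooth f)
    (hfin : hessianSchattenVariation 1 f Ω ≠ ∞) {r₁ r₂ ω K : ℝ} {c₀ : Plane}
    (hr₁ : 0 < r₁) (hr : r₁ < r₂) (hr₂ : r₂ < R) (hR : R ≤ 1) (hω : 0 ≤ ω) (hK : 0 ≤ K)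
    (hdisj : ∀ k l x, x ∈ sq (c k) R → x ∈ sq (c l) R → k = l)
    (hsub : ∀ k, csq (c k) R ⊆ csq c₀ 1) (hsubΩ : ∀ k, sq (c k) R ⊆ Ω) (hΩ : (Ω : Set Plane) ⊆ csq c₀ 1)
    {χ : ι → Plane → ℝ} (hχ : ∀ k, IsTestOn (sq (c k) r₁) (χ k)) (hχ0 : ∀ k x, 0 ≤ χ k x)
    (hχ1 : ∀ k x, χ k x ≤ 1) {Ξ : Plane → ℝ} (hΞ : IsTestOn (csq c₀ 1) Ξ) (hΞ0 : ∀ x, 0 ≤ Ξ x)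
    (hΞ1 : ∀ x ∈ Ω, Ξ x = 1) {β : ι → Plane → ℝ} {β₀ : Plane → ℝ}
    {S : ι → Fin 2 → Fin 2 → ℝ} (hβ : ∀ k, Smooth (β k)) (hβ₀ : Smooth β₀) (hS : ∀ k, OpLe (S k) 1)
    (hβp : ∀ k x e, 0 ≤ dd e (dd e (β k)) x) (hβ₀p : ∀ x e, 0 ≤ dd e (dd e β₀) x)
    (hfβ : ∀ k, ∀ x ∈ csq (c k) R, ∀ e, 0 ≤ dd e (dd e (fun x => f x + β k x)) x)
    (hfβ₀ : ∀ x ∈ csq c₀ 1, ∀ e, 0 ≤ dd e (dd e (fun x => f x + β₀ x)) x)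
    (hS' : ∀ k, ∀ x ∈ csq (c k) R, lap f x + 2 * lap (β k) x ≤
      (∑ i, ∑ j, dd (bas i) (dd (bas j) f) x * S k i j) + ω)
    (hK₀ : ∀ x ∈ csq c₀ 1, lap f x + 2 * lap β₀ x ≤ K)
    (hKk : ∀ k, ∀ x ∈ csq (c k) R, 2 * (lap f x + lap (β k) x + lap β₀ x) ≤ K)
    {δ : ℝ} (hδ : 0 < δ) :
    ∃ g, IsPL g ∧ (∀ x ∈ Ω, |g x - f x| ≤ δ) ∧ ∀ F, Adm Ω F →
      pr g F ≤ (hessianSchattenVariation 1 f Ω).toReal + ω * (∫ x, Ξ x)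
        + 2 * K * ((∫ x, Ξ x) - ∑ k, ∫ x, χ k x) + δ := by
  -- The functions `X k` and `Y k` are known to be close to a smooth function only in the square of
  -- radius `R`. The cutoff `ζ k` confines the test field to that square without changing its
  -- pairing with `X k - Y k`, which vanishes outside radius `r₂`.
  have hζ : ∀ k, ∃ ζ : Plane → ℝ, IsTestOn (sq (c k) R) ζ ∧ (∀ x, 0 ≤ ζ x) ∧ (∀ x, ζ x ≤ 1) ∧
      (∀ᶠ x in 𝓝ˢ (csq (c k) r₂), ζ x = 1) ∧ ∀ x ∈ csq (c k) r₂, ζ x = 1 := fun k =>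
    exists_cutoff (isCompact_csq _ _) (isOpen_sq _ _) (csq_subset_sq hr₂)
  choose ζ hζ hζ0 hζ1 _ hζe using hζ
  have hχR : ∀ k, ∀ x ∉ sq (c k) R, χ k x = 0 := fun k x hx => (hχ k).eq_zero fun h =>
    hx (lt_trans h (hr.trans hr₂))
  -- the remaining weight
  set χ₀ : Plane → ℝ := fun x => Ξ x - ∑ k, χ k x with hχ₀
  have hχ₀t : IsTestOn (csq c₀ 1) χ₀ := hΞ.sub (IsTestOn.sum _ fun k _ => (hχ k).mono
    fun x hx => hsub k (le_of_lt (lt_trans hx (hr.trans hr₂))))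
  have hχ₀0 : ∀ x, 0 ≤ χ₀ x := fun x => sub_nonneg.2 <|
    sum_le_of_disjoint_squares hdisj hχR (hΞ0 x) fun k hx => by
      rw [hΞ1 x (hsubΩ k hx)]; exact hχ1 k x
  have hζχ : ∀ k, IsTestOn (sq (c k) R) fun x => ζ k x * χ₀ x := fun k =>
    (hζ k).mul_right hχ₀t.smooth
  -- choice of the accuracy
  obtain ⟨C, hC⟩ : ∃ C, C = 2 + 12 / (r₂ - r₁) := ⟨_, rfl⟩
  have hC2 : 2 ≤ C := by
    rw [hC]
    have : 0 < 12 / (r₂ - r₁) := div_pos (by norm_num) (sub_pos.2 hr)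
    linarith
  obtain ⟨D₁, hD₁⟩ : ∃ D, D = ∑ k, ∫ x, |lap (χ k) x| := ⟨_, rfl⟩
  obtain ⟨D₂, hD₂⟩ : ∃ D, D = ∫ x, |lap χ₀ x| := ⟨_, rfl⟩
  obtain ⟨D₃, hD₃⟩ : ∃ D, D = ∑ k, ∫ x, |lap (fun x => ζ k x * χ₀ x) x| := ⟨_, rfl⟩
  have hD₁0 : 0 ≤ D₁ := hD₁ ▸ Finset.sum_nonneg fun k _ => integral_nonneg fun _ => abs_nonneg _
  have hD₂0 : 0 ≤ D₂ := hD₂ ▸ integral_nonneg fun _ => abs_nonneg _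
  have hD₃0 : 0 ≤ D₃ := hD₃ ▸ Finset.sum_nonneg fun k _ => integral_nonneg fun _ => abs_nonneg _
  obtain ⟨Z, hZ⟩ : ∃ Z, Z = 2 * D₁ + 2 * D₂ + 2 * C * D₃ + 2 + Fintype.card ι * C := ⟨_, rfl⟩
  have hZ0 : 0 < Z := by rw [hZ]; positivity
  obtain ⟨τ, hτ⟩ : ∃ τ, τ = δ / Z := ⟨_, rfl⟩
  have hτ0 : 0 < τ := by rw [hτ]; positivity
  have hτZ : τ * Z = δ := by rw [hτ]; field_simp
  have hτ1 : 2 * τ * D₁ + 2 * τ * D₂ + 2 * (C * τ) * D₃ ≤ δ := by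
    rw [← hτZ, hZ]
    have : 0 ≤ τ * (2 + Fintype.card ι * C) := by positivity
    linarith
  have hτ2 : 2 * τ + Fintype.card ι * (C * τ) ≤ δ := by
    rw [← hτZ, hZ]
    have : 0 ≤ τ * (2 * D₁ + 2 * D₂ + 2 * C * D₃) := by positivity
    linarith
  -- the local approximations
  have hfβs : ∀ k, Smooth fun x => f x + β k x := fun k => hf.add (hβ k)
  obtain ⟨a₀, ha₀, hau₀⟩ := exists_convexPL_near (hf.add hβ₀) (convex_csq c₀ 1) (isCompact_csq c₀ 1)
    hfβ₀ hτ0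
  obtain ⟨b₀, hb₀, hbu₀⟩ := exists_convexPL_near hβ₀ (convex_csq c₀ 1) (isCompact_csq c₀ 1)
    (fun x _ e => hβ₀p x e) hτ0
  choose a ha hau using fun k => exists_convexPL_near (hfβs k) (convex_csq (c k) R)
    (isCompact_csq (c k) R) (hfβ k) hτ0
  choose b hb hbu using fun k => exists_convexPL_near (hβ k) (convex_csq (c k) R)
    (isCompact_csq (c k) R) (fun x _ e => hβp k x e) hτ0
  choose X Y hX hY hXY₁ hXY₂ hXYC hXw hYw using fun k => exists_patch (u := f) (β := β k) (β₀ := β₀)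
    (c := c k) hτ0 hr hr₂ hr₁ hR (ha k) (hb k) ha₀ hb₀
    (fun x hx => hau k x (sq_subset_csq hx)) (fun x hx => hbu k x (sq_subset_csq hx))
    (fun x hx => hau₀ x (hsub k (sq_subset_csq hx))) (fun x hx => hbu₀ x (hsub k (sq_subset_csq hx)))
  simp only [← hC] at hXYC hXw hYw
  have hT : ∀ k, IsPL fun x => X k x - Y k x := fun k => (hX k).pl.sub (hY k).pl
  have hg₀ : IsPL fun x => a₀ x - b₀ x := ha₀.pl.sub hb₀.pl
  have hg₁ : IsPL fun x => ∑ k, (X k x - Y k x) := IsPL.sum _ fun k _ => hT k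
  have hg : IsPL fun x => (a₀ x - b₀ x) + ∑ k, (X k x - Y k x) := hg₀.add hg₁
  have hLI : ∀ {u : Plane → ℝ}, IsPL u → ∀ A : Set Plane, LocallyIntegrableOn u A := fun hu A =>
    hu.1.locallyIntegrable.locallyIntegrableOn A
  refine ⟨_, hg, fun x hx => ?_, fun F hF => ?_⟩
  · have h1 := abs_le.1 (hau₀ x (hΩ hx))
    have h2 := abs_le.1 (hbu₀ x (hΩ hx))
    have h3 : |∑ k, (X k x - Y k x)| ≤ Fintype.card ι * (C * τ) := by
      refine (Finset.abs_sum_le_sum_abs _ _).trans ((Finset.sum_le_sum fun k _ => hXYC k x).trans ?_)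
      simp
    have h3 := abs_le.1 h3
    rw [abs_le]
    constructor <;> linarith
  -- decomposition of the test field
  have hFs : ∀ i j, Smooth (F i j) := fun i j => (hF.1 i j).smooth
  have hFdec : F = fun i j x => (∑ k, χ k x * F i j x) + χ₀ x * F i j x := by
    funext i j x
    rw [← Finset.sum_mul, ← add_mul]
    by_cases hx : x ∈ Ω
    · simp [hχ₀, hΞ1 x hx]
    · simp [(hF.1 i j).eq_zero hx]
  have hFk : ∀ k, IsField Ω fun i j x => χ k x * F i j x := fun k => hF.1.smul (hχ k).smooth
  have hFk' : ∀ k, IsField (sq (c k) r₁) fun i j x => χ k x * F i j x := fun k =>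
    IsField.smul_test (hχ k) hFs
  have hF₀ : IsField Ω fun i j x => χ₀ x * F i j x := hF.1.smul hχ₀t.smooth
  have hop : ∀ {ψ : Plane → ℝ}, (∀ x, 0 ≤ ψ x) → ∀ x, OpLe (fun i j => ψ x * F i j x) (ψ x) := by
    intro ψ hψ x
    simpa using (hF.2 x).const_mul (hψ x)
  rw [show pr (fun x => (a₀ x - b₀ x) + ∑ k, (X k x - Y k x)) F
      = pr (fun x => (a₀ x - b₀ x) + ∑ k, (X k x - Y k x))
        (fun i j x => (∑ k, χ k x * F i j x) + χ₀ x * F i j x) from congrArg _ hFdec,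
    pr_add (hLI hg Ω) (IsField.sum _ fun k _ => hFk k) hF₀,
    pr_sum _ (hLI hg Ω) fun k _ => hFk k, pr_fun_add (hLI hg₀ Ω) (hLI hg₁ Ω) hF₀,
    pr_fun_sum _ (fun k _ => hLI (hT k) Ω) hF₀]
  -- the contribution of the inner squares
  have hin : ∀ k, pr (fun x => (a₀ x - b₀ x) + ∑ k, (X k x - Y k x)) (fun i j x => χ k x * F i j x)
      ≤ pr f (fun i j x => χ k x * S k i j) + ω * (∫ x, χ k x) + 2 * τ * ∫ x, |lap (χ k) x| := by
    intro k
    -- On the inner square the patch `k` exchanges `a₀ - b₀` for `a k - b k`, and the other patches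
    -- vanish there.
    have h1 : pr (fun x => (a₀ x - b₀ x) + ∑ k, (X k x - Y k x)) (fun i j x => χ k x * F i j x)
        = pr (fun x => a k x - b k x) (fun i j x => χ k x * F i j x) := by
      refine pr_congr (hFk' k) fun x hx => ?_
      have hxR : x ∈ sq (c k) R := lt_trans hx (hr.trans hr₂)
      rw [Finset.sum_eq_single k (fun l _ hl => hXY₂ l x fun hl' => hl
        (hdisj l k x (lt_trans hl' hr₂) hxR)) (fun h => (h (Finset.mem_univ k)).elim), hXY₁ k x hx]
      ring
    rw [h1]
    have hsqR : sq (c k) r₁ ⊆ csq (c k) R := fun x hx => le_of_lt (lt_trans hx (hr.trans hr₂))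
    refine (pr_sub_le_of_convex_near (ha k).continuous (ha k).convex (hb k).continuous (hb k).convex
      (hfβs k) (hβ k) (hFk' k) (hχ k) (hop (hχ0 k)) (fun x hx => hau k x (hsqR hx))
      (fun x hx => hbu k x (hsqR hx))).trans ?_
    rw [pr_smooth hf (IsField.smul_test (hχ k) fun i j => contDiff_const), ← integral_const_mul ω]
    refine add_le_add_left ?_ _
    have hi1 : Integrable fun x => ∑ i, ∑ j, dd (bas i) (dd (bas j) f) x * (χ k x * S k i j) :=
      integrable_finsetSum _ fun i _ => integrable_finsetSum _ fun j _ =>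
        ((hχ k).mul_right contDiff_const).integrable_mul_cont ((hf.dd _).dd _).continuous
    rw [← integral_add hi1 ((hχ k).integrable.const_mul ω)]
    refine integral_mono ((hχ k).integrable_mul_cont
      ((hfβs k).lap.continuous.add (hβ k).lap.continuous))
      (hi1.add ((hχ k).integrable.const_mul ω)) fun x => ?_
    simp only [lap_add hf (hβ k)]
    by_cases hx : x ∈ sq (c k) r₁
    · have h2 := mul_le_mul_of_nonneg_right (hS' k x (hsqR hx)) (hχ0 k x)
      simp only [Fin.sum_univ_two] at h2 ⊢
      linarith
    · simp [(hχ k).eq_zero hx]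
  -- the contribution of the remaining weight
  have hout : pr (fun x => a₀ x - b₀ x) (fun i j x => χ₀ x * F i j x)
      ≤ K * (∫ x, χ₀ x) + 2 * τ * ∫ x, |lap χ₀ x| := by
    refine (pr_sub_le_of_convex_near ha₀.continuous ha₀.convex hb₀.continuous hb₀.convex
      (hf.add hβ₀) hβ₀ hF₀ hχ₀t (hop hχ₀0) hau₀ hbu₀).trans ?_
    refine add_le_add_left ?_ _
    rw [← integral_const_mul]
    have hfβ₀s : Smooth fun x => f x + β₀ x := hf.add hβ₀
    refine integral_mono (hχ₀t.integrable_mul_cont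
      (hfβ₀s.lap.continuous.add hβ₀.lap.continuous)) (hχ₀t.integrable.const_mul K) fun x => ?_
    simp only [lap_add hf hβ₀]
    by_cases hx : x ∈ csq c₀ 1
    · have h2 := mul_le_mul_of_nonneg_right (hK₀ x hx) (hχ₀0 x)
      linarith
    · simp [hχ₀t.eq_zero hx]
  have htr : ∀ k, pr (fun x => X k x - Y k x) (fun i j x => χ₀ x * F i j x)
      ≤ K * (∫ x, ζ k x * χ₀ x) + 2 * (C * τ) * ∫ x, |lap (fun x => ζ k x * χ₀ x) x| := by
    intro k
    -- Inserting `ζ k` is harmless: it is `1` on the open square of radius `r₂`, so derivatives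
    -- agree there, and elsewhere `X k - Y k = 0`.
    have h1 : pr (fun x => X k x - Y k x) (fun i j x => χ₀ x * F i j x)
        = pr (fun x => X k x - Y k x) (fun i j x => (ζ k x * χ₀ x) * F i j x) := by
      refine integral_congr_ae (ae_of_all _ fun x => ?_)
      by_cases hx : x ∈ sq (c k) r₂
      · simp only
        congr 1
        refine ddiv_congr_eventually fun i j => ?_
        filter_upwards [(isOpen_sq (c k) r₂).mem_nhds hx] with y hy
        rw [hζe k y (sq_subset_csq hy), one_mul]
      · simp [hXY₂ k x hx]
    rw [h1]
    have hw : Smooth fun x => f x + β k x + β₀ x := (hfβs k).add hβ₀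
    -- Both `X k` and `Y k` are close to the same smooth `f + β k + β₀`. The energy density of their
    -- difference is thus bounded by twice its Laplacian, not made small; smallness comes from the
    -- mass of `χ₀`.
    refine (pr_sub_le_of_convex_near (hX k).continuous (hX k).convex (hY k).continuous (hY k).convex
      hw hw (IsField.smul_test (hζχ k) hFs) (hζχ k)
      (hop fun x => mul_nonneg (hζ0 k x) (hχ₀0 x)) (hXw k) (hYw k)).trans ?_
    refine add_le_add_left ?_ _
    rw [← integral_const_mul]
    refine integral_mono ((hζχ k).integrable_mul_cont (hw.lap.continuous.add hw.lap.continuous))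
      ((hζχ k).integrable.const_mul K) fun x => ?_
    simp only [lap_add (hfβs k) hβ₀, lap_add hf (hβ k)]
    by_cases hx : x ∈ sq (c k) R
    · have h2 := mul_le_mul_of_nonneg_right (hKk k x (sq_subset_csq hx))
        (mul_nonneg (hζ0 k x) (hχ₀0 x))
      linarith
    · simp [(hζ k).eq_zero hx]
  -- summation
  have hadm : Adm Ω fun i j x => ∑ k, χ k x * S k i j := by
    refine ⟨IsField.sum _ fun k _ => IsField.smul_test ((hχ k).mono fun x hx =>
      hsubΩ k (lt_trans hx (hr.trans hr₂))) fun i j => contDiff_const, fun x => ?_⟩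
    by_cases hx : ∃ k, x ∈ sq (c k) R
    · obtain ⟨k, hk⟩ := hx
      have : ∀ i j, ∑ l, χ l x * S l i j = χ k x * S k i j := fun i j =>
        Finset.sum_eq_single k (fun l _ hl => by
          rw [hχR l x fun hl' => hl (hdisj l k x hl' hk), zero_mul])
          (fun h => (h (Finset.mem_univ k)).elim)
      simp only [this]
      exact ((hS k).const_mul (hχ0 k x)).mono (by simpa using hχ1 k x)
    · push Not at hx
      have : ∀ i j, ∑ l, χ l x * S l i j = 0 := fun i j =>
        Finset.sum_eq_zero fun l _ => by rw [hχR l x (hx l), zero_mul]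
      simp only [this]
      exact OpLe.zero.mono zero_le_one
  -- The field `∑ χ k S k` is itself admissible because the supports are disjoint. It turns the sum
  -- of the inner bounds into at most the true energy of `f`, so the leading constant is exactly
  -- one.
  have hlow : ∑ k, pr f (fun i j x => χ k x * S k i j) ≤ (hessianSchattenVariation 1 f Ω).toReal := by
    rw [← pr_sum _ (hf.locallyIntegrableOn Ω) fun k _ => IsField.smul_test ((hχ k).mono fun x hx =>
      hsubΩ k (lt_trans hx (hr.trans hr₂))) fun i j => contDiff_const]
    exact pr_le_toReal hfin hadm
  have hχint : ∫ x, χ₀ x = (∫ x, Ξ x) - ∑ k, ∫ x, χ k x := by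
    rw [← integral_finsetSum _ fun k _ => (hχ k).integrable,
      ← integral_sub hΞ.integrable (integrable_finsetSum _ fun k _ => (hχ k).integrable)]
  have hχ₀i : 0 ≤ ∫ x, χ₀ x := integral_nonneg hχ₀0
  have hζsum : ∑ k, ∫ x, ζ k x * χ₀ x ≤ ∫ x, χ₀ x := by
    rw [← integral_finsetSum _ fun k _ => (hζχ k).integrable]
    refine integral_mono (integrable_finsetSum _ fun k _ => (hζχ k).integrable)
      hχ₀t.integrable fun x => ?_
    refine sum_le_of_disjoint_squares hdisj (ψ := fun k x => ζ k x * χ₀ x) (fun k x hx => ?_)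
      (hχ₀0 x) fun k _ => ?_
    · simp [(hζ k).eq_zero hx]
    · simpa using mul_le_mul_of_nonneg_right (hζ1 k x) (hχ₀0 x)
  have hs1 := Finset.sum_le_sum fun k (_ : k ∈ Finset.univ) => hin k
  have hs2 := Finset.sum_le_sum fun k (_ : k ∈ Finset.univ) => htr k
  simp only [Finset.sum_add_distrib, ← Finset.mul_sum] at hs1 hs2
  rw [← hD₁] at hs1
  rw [← hD₃] at hs2
  rw [← hD₂] at hout
  have h3 := mul_le_mul_of_nonneg_left hζsum hK
  have h4 : ω * ∑ k, ∫ x, χ k x ≤ ω * ∫ x, Ξ x :=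
    mul_le_mul_of_nonneg_left (by linarith) hω
  rw [← hχint]
  linarith

end Assembly

end HTV

/-! ### Smooth functions: local convex splitting on a fine grid. -/

namespace HTV

theorem quadForm_le {M : Fin 2 → Fin 2 → ℝ} {ω : ℝ} (hM : ∀ i j, |M i j| ≤ ω) (e : Plane) :
    |∑ i, ∑ j, e i * e j * M i j| ≤ 2 * ω * ∑ i, e i ^ 2 := by
  have hω : 0 ≤ ω := (abs_nonneg _).trans (hM 0 0)
  refine (Finset.abs_sum_le_sum_abs _ _).trans ((Finset.sum_le_sum fun i _ =>
    (Finset.abs_sum_le_sum_abs _ _).trans (Finset.sum_le_sum fun j _ => ?_)).trans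
    (b := ∑ i, ∑ j, (|e i| * |e j|) * ω) ?_)
  · rw [abs_mul, abs_mul]
    exact mul_le_mul_of_nonneg_left (hM i j) (by positivity)
  · simp only [Fin.sum_univ_two]
    rw [← sq_abs (e 0), ← sq_abs (e 1)]
    nlinarith [mul_nonneg hω (sq_nonneg (|e 0| - |e 1|))]

/-- Local convex splitting of a smooth function whose Hessian is almost constant on `A`. -/
theorem exists_square_data {f : Plane → ℝ} (hf : Smooth f) {c : Plane} {A : Set Plane} {ω K : ℝ}
    (hω : 0 ≤ ω) (hc : ∀ i j, |dd (bas i) (dd (bas j) f) c| ≤ K)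
    (hosc : ∀ x ∈ A, ∀ i j,
      |dd (bas i) (dd (bas j) f) x - dd (bas i) (dd (bas j) f) c| ≤ ω / 2) :
    ∃ (β : Plane → ℝ) (S : Fin 2 → Fin 2 → ℝ), Smooth β ∧ OpLe S 1 ∧
      (∀ x e, 0 ≤ dd e (dd e β) x) ∧
      (∀ x ∈ A, ∀ e, 0 ≤ dd e (dd e (fun x => f x + β x)) x) ∧
      (∀ x ∈ A, lap f x + 2 * lap β x ≤
        (∑ i, ∑ j, dd (bas i) (dd (bas j) f) x * S i j) + 7 * ω) ∧
      ∀ x, lap β x ≤ 3 * K + 2 * ω := by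
  obtain ⟨H, hH⟩ : ∃ H : Fin 2 → Fin 2 → ℝ, H = fun i j => dd (bas i) (dd (bas j) f) c := ⟨_, rfl⟩
  have hHs : ∀ i j, H i j = H j i := fun i j => by rw [hH]; simp only [dd_comm hf (bas i)]
  obtain ⟨N, S, hN, hN0, hHN, hS, htr⟩ := exists_sign_decomposition hHs
  have hSe := hS.abs_entry_le
  -- The negative part is increased by `ω` times the identity. By `quadForm_le`, an oscillation `ω /
  -- 2` of the entries changes the quadratic form by at most `ω |e|²`, which this absorbs.
  obtain ⟨N', hN'⟩ : ∃ N' : Fin 2 → Fin 2 → ℝ, N' = fun i j => N i j + if i = j then ω else 0 :=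
    ⟨_, rfl⟩
  have hN's : ∀ i j, N' i j = N' j i := fun i j => by
    rcases eq_or_ne i j with rfl | h
    · rfl
    · simp only [hN', hN i j, if_neg h, if_neg h.symm]
  have h00 : N' 0 0 = N 0 0 + ω := by rw [hN']; rfl
  have h01 : N' 0 1 = N 0 1 + 0 := by rw [hN']; rfl
  have h10 : N' 1 0 = N 1 0 + 0 := by rw [hN']; rfl
  have h11 : N' 1 1 = N 1 1 + ω := by rw [hN']; rfl
  have hN'q : ∀ e : Plane, ∑ i, ∑ j, e i * e j * N' i j
      = (∑ i, ∑ j, e i * e j * N i j) + ω * ∑ i, e i ^ 2 := by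
    intro e
    simp only [Fin.sum_univ_two, h00, h01, h10, h11]
    ring
  have hN'tr : ∑ i, N' i i = ∑ i, N i i + 2 * ω := by
    simp only [Fin.sum_univ_two, h00, h11]
    ring
  have hsq : ∀ e : Plane, 0 ≤ ∑ i, e i ^ 2 := fun e => Finset.sum_nonneg fun i _ => sq_nonneg _
  have hsub : ∀ x ∈ A, ∀ i j, |dd (bas i) (dd (bas j) f) x - H i j| ≤ ω / 2 := fun x hx i j => by
    rw [hH]; exact hosc x hx i j
  refine ⟨quad N', S, smooth_quad N', hS, fun x e => ?_, fun x hx e => ?_, fun x hx => ?_,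
    fun x => ?_⟩
  · rw [dd_dd_quad hN's, hN'q]
    have := hN0 e
    have := mul_nonneg hω (hsq e)
    linarith
  · rw [dd_dd_add hf (smooth_quad N')]
    beta_reduce
    rw [dd_dd_quad hN's, hN'q, dd_dd_eq_sum hf]
    have h1 := (abs_le.1 (quadForm_le (hsub x hx) e)).1
    have h2 := hHN e
    simp only [Fin.sum_univ_two] at h1 h2 ⊢
    linarith
  -- The error `7ω` splits as `4ω` from the added identity (trace `2ω`, counted twice), `ω` from the
  -- trace of the Hessian, and `2ω` from its four entries paired with `S`.
  · rw [lap_quad hN's, hN'tr]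
    have h1 : ∀ i j, -(ω / 2) ≤ (dd (bas i) (dd (bas j) f) x - H i j) * S i j := by
      intro i j
      have h2 : |(dd (bas i) (dd (bas j) f) x - H i j) * S i j| ≤ ω / 2 * 1 := by
        rw [abs_mul]
        exact mul_le_mul (hsub x hx i j) (hSe i j) (abs_nonneg _) (by linarith)
      linarith [(abs_le.1 h2).1]
    have h3 := fun i j => (abs_le.1 (hsub x hx i j)).2
    have h00 := h1 0 0
    have h01 := h1 0 1
    have h10 := h1 1 0
    have h11 := h1 1 1
    have g00 := h3 0 0
    have g11 := h3 1 1
    simp only [lap, Fin.sum_univ_two] at htr ⊢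
    linarith
  -- Twice the trace of `N` is the pairing of `H` with `S`, at most `4K`, minus the trace of `H`, at
  -- least `-2K`; hence `3K`.
  · rw [lap_quad hN's, hN'tr]
    have h1 : ∀ i j, H i j * S i j ≤ K := by
      intro i j
      have h2 : |H i j * S i j| ≤ K * 1 := by
        rw [abs_mul, hH]
        exact mul_le_mul (hc i j) (hSe i j) (abs_nonneg _) ((abs_nonneg _).trans (hc i j))
      linarith [(abs_le.1 h2).2]
    have h2 : ∀ i, -K ≤ H i i := fun i => by rw [hH]; exact (abs_le.1 (hc i i)).1
    have h00 := h1 0 0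
    have h01 := h1 0 1
    have h10 := h1 1 0
    have h11 := h1 1 1
    have g0 := h2 0
    have g1 := h2 1
    simp only [Fin.sum_univ_two] at htr ⊢
    linarith

/-- The centre of the unit square. -/
noncomputable def ctr : Plane := WithLp.toLp 2 fun _ => 1 / 2

theorem unitSquare_eq : (unitSquare : Set Plane) = sq ctr (1 / 2) := by
  ext x
  change (∀ i, x i ∈ Ioo (0 : ℝ) 1) ↔ supDist ctr x < 1 / 2
  rw [supDist_lt_iff]
  refine forall_congr' fun i => ?_
  simp only [ctr, mem_Ioo, abs_lt]
  constructor <;> rintro ⟨h1, h2⟩ <;> constructor <;> linarith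

/-- The centres of the squares of the regular grid with `N ^ 2` squares. -/
noncomputable def gridCtr (N : ℕ) (k : Fin 2 → Fin N) : Plane :=
  WithLp.toLp 2 fun i => ((k i : ℝ) + 1 / 2) / N

section Grid

variable {N : ℕ} {x : Plane}

theorem abs_sub_gridCtr (hN : 0 < N) (k : Fin 2 → Fin N) (i : Fin 2) :
    |x i - gridCtr N k i| = |N * x i - (k i + 1 / 2)| / N := by
  have hN' : (0 : ℝ) < N := Nat.cast_pos.2 hN
  have h : x i - gridCtr N k i = (N * x i - (k i + 1 / 2)) / N := by
    simp only [gridCtr]; field_simp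
  rw [h, abs_div, abs_of_pos hN']

theorem mem_sq_gridCtr (hN : 0 < N) (k : Fin 2 → Fin N) :
    x ∈ sq (gridCtr N k) (1 / (2 * N)) ↔ ∀ i, (k i : ℝ) < N * x i ∧ N * x i < k i + 1 := by
  have hN' : (0 : ℝ) < N := Nat.cast_pos.2 hN
  change supDist _ _ < _ ↔ _
  rw [supDist_lt_iff]
  refine forall_congr' fun i => ?_
  rw [abs_sub_gridCtr hN, div_lt_iff₀ hN', show 1 / (2 * (N : ℝ)) * N = 1 / 2 by field_simp, abs_lt]
  constructor <;> rintro ⟨h1, h2⟩ <;> constructor <;> linarith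

theorem mem_csq_gridCtr (hN : 0 < N) (k : Fin 2 → Fin N) :
    x ∈ csq (gridCtr N k) (1 / (2 * N)) ↔ ∀ i, (k i : ℝ) ≤ N * x i ∧ N * x i ≤ k i + 1 := by
  have hN' : (0 : ℝ) < N := Nat.cast_pos.2 hN
  change supDist _ _ ≤ _ ↔ _
  rw [supDist_le_iff]
  refine forall_congr' fun i => ?_
  rw [abs_sub_gridCtr hN, div_le_iff₀ hN', show 1 / (2 * (N : ℝ)) * N = 1 / 2 by field_simp, abs_le]
  constructor <;> rintro ⟨h1, h2⟩ <;> constructor <;> linarith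

theorem grid_disjoint (hN : 0 < N) (k l : Fin 2 → Fin N) (x : Plane)
    (hk : x ∈ sq (gridCtr N k) (1 / (2 * N))) (hl : x ∈ sq (gridCtr N l) (1 / (2 * N))) :
    k = l := by
  funext i
  have h1 := (mem_sq_gridCtr hN k).1 hk i
  have h2 := (mem_sq_gridCtr hN l).1 hl i
  have h3 : ((k i : ℕ) : ℝ) < (l i : ℕ) + 1 := h1.1.trans h2.2
  have h4 : ((l i : ℕ) : ℝ) < (k i : ℕ) + 1 := h2.1.trans h1.2
  norm_cast at h3 h4
  exact Fin.ext (by omega)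

theorem grid_subset_unitSquare (hN : 0 < N) (k : Fin 2 → Fin N) :
    sq (gridCtr N k) (1 / (2 * N)) ⊆ unitSquare := by
  intro x hx i
  have hN' : (0 : ℝ) < N := Nat.cast_pos.2 hN
  have h1 := (mem_sq_gridCtr hN k).1 hx i
  have h2 : ((k i : ℕ) : ℝ) + 1 ≤ N := by exact_mod_cast (k i).2
  have h3 : (0 : ℝ) ≤ (k i : ℕ) := Nat.cast_nonneg _
  constructor <;> nlinarith

theorem grid_subset_csq (hN : 0 < N) (k : Fin 2 → Fin N) :
    csq (gridCtr N k) (1 / (2 * N)) ⊆ csq ctr 1 := by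
  intro x hx
  change supDist _ _ ≤ _
  rw [supDist_le_iff]
  intro i
  have hN' : (0 : ℝ) < N := Nat.cast_pos.2 hN
  have h1 := (mem_csq_gridCtr hN k).1 hx i
  have h2 : ((k i : ℕ) : ℝ) + 1 ≤ N := by exact_mod_cast (k i).2
  have h3 : (0 : ℝ) ≤ (k i : ℕ) := Nat.cast_nonneg _
  have h4 : 0 ≤ x i := by
    by_contra h; push Not at h; nlinarith
  have h5 : x i ≤ 1 := by
    by_contra h; push Not at h; nlinarith
  simp only [ctr, abs_le]
  constructor <;> linarith

end Grid

theorem dist_le_of_mem_csq {c x : Plane} {r : ℝ} (hx : x ∈ csq c r) : dist c x ≤ 2 * r := by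
  have h := supDist_le_iff.1 hx
  have hr : 0 ≤ r := (supDist_nonneg c x).trans hx
  rw [EuclideanSpace.dist_eq, Real.sqrt_le_left (by linarith), Fin.sum_univ_two, Real.dist_eq,
    Real.dist_eq, abs_sub_comm (c 0), abs_sub_comm (c 1)]
  nlinarith [h 0, h 1, abs_nonneg (x 0 - c 0), abs_nonneg (x 1 - c 1)]

/-- Approximation in energy of smooth functions by piecewise affine ones. -/
theorem exists_PL_near_smooth {f : Plane → ℝ} (hf : Smooth f)
    (hfin : hessianSchattenVariation 1 f unitSquare ≠ ∞) {δ : ℝ} (hδ : 0 < δ) :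
    ∃ g, IsPL g ∧ (∀ x ∈ unitSquare, |g x - f x| ≤ δ) ∧
      hessianSchattenVariation 1 g unitSquare ≤
        hessianSchattenVariation 1 f unitSquare + ENNReal.ofReal δ := by
  have hH : ∀ i j, Continuous (dd (bas i) (dd (bas j) f)) := fun i j => ((hf.dd _).dd _).continuous
  -- a bound for the second derivatives
  obtain ⟨K, hK1, hK⟩ : ∃ K : ℝ, 1 ≤ K ∧ ∀ x ∈ csq ctr 1, ∀ i j,
      |dd (bas i) (dd (bas j) f) x| ≤ K := by
    have h1 : ∀ i j, ∃ C, ∀ x ∈ csq ctr 1, ‖dd (bas i) (dd (bas j) f) x‖ ≤ C := fun i j =>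
      (isCompact_csq ctr 1).exists_bound_of_continuousOn (hH i j).continuousOn
    choose C hC using h1
    refine ⟨1 + ∑ i, ∑ j, |C i j|, ?_, fun x hx i j => ?_⟩
    · have : 0 ≤ ∑ i, ∑ j, |C i j| := by positivity
      linarith
    · have h2 : |C i j| ≤ ∑ j, |C i j| :=
        Finset.single_le_sum (f := fun j => |C i j|) (fun _ _ => abs_nonneg _) (Finset.mem_univ j)
      have h3 : ∑ j, |C i j| ≤ ∑ i, ∑ j, |C i j| :=
        Finset.single_le_sum (f := fun i => ∑ j, |C i j|)
          (fun _ _ => Finset.sum_nonneg fun _ _ => abs_nonneg _) (Finset.mem_univ i)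
      have h4 := (hC i j x hx).trans (le_abs_self _)
      rw [Real.norm_eq_abs] at h4
      linarith
  -- oscillation
  obtain ⟨ω, hω0, hω1, hωδ⟩ : ∃ ω : ℝ, 0 < ω ∧ ω ≤ 1 ∧ 28 * ω ≤ δ / 3 := by
    refine ⟨min 1 (δ / 84), by positivity, min_le_left _ _, ?_⟩
    have := min_le_right 1 (δ / 84)
    linarith
  obtain ⟨ε, hε, hosc⟩ : ∃ ε > 0, ∀ x ∈ csq ctr 1, ∀ y, dist x y < ε → ∀ i j,
      |dd (bas i) (dd (bas j) f) y - dd (bas i) (dd (bas j) f) x| ≤ ω / 2 := by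
    choose d hd h using fun i j => exists_unif_near (hH i j) (isCompact_csq ctr 1)
      (half_pos hω0)
    refine ⟨min (min (d 0 0) (d 0 1)) (min (d 1 0) (d 1 1)), lt_min (lt_min (hd _ _) (hd _ _))
      (lt_min (hd _ _) (hd _ _)), fun x hx y hxy i j => (h i j x hx y ?_).le⟩
    simp only [lt_min_iff] at hxy
    fin_cases i <;> fin_cases j
    exacts [hxy.1.1, hxy.1.2, hxy.2.1, hxy.2.2]
  obtain ⟨N, hN⟩ := exists_nat_gt (1 / ε)
  have hNpos' : (0 : ℝ) < N := (by positivity : 0 < 1 / ε).trans hN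
  have hNpos : 0 < N := Nat.cast_pos.1 hNpos'
  have hN1 : (1 : ℝ) ≤ N := by exact_mod_cast hNpos
  have hNε : 2 * (1 / (2 * (N : ℝ))) < ε := by
    rw [div_lt_iff₀ hε] at hN
    rw [show 2 * (1 / (2 * (N : ℝ))) = 1 / N by field_simp, div_lt_iff₀ hNpos']
    linarith
  obtain ⟨R, hRdef⟩ : ∃ R : ℝ, R = 1 / (2 * N) := ⟨_, rfl⟩
  have hR0 : 0 < R := by rw [hRdef]; positivity
  have hR1 : R ≤ 1 := by
    rw [hRdef, div_le_one (by positivity)]; linarith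
  have hRN : N * (2 * R) = 1 := by rw [hRdef]; field_simp
  -- The parameter `s` is the relative width of the gaps. The mass not covered by the inner squares
  -- will be at most `(1 + s)² - (1 - s)² = 4s`.
  obtain ⟨s, hs0, hs1, hsδ⟩ : ∃ s : ℝ, 0 < s ∧ s ≤ 1 / 2 ∧ 2 * (22 * K) * (4 * s) ≤ δ / 3 := by
    refine ⟨min (1 / 2) (δ / (528 * K)), by positivity, min_le_left _ _, ?_⟩
    have h1 := min_le_right (1 / 2) (δ / (528 * K))
    have h2 : 0 ≤ 2 * (22 * K) * 4 := by positivity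
    calc 2 * (22 * K) * (4 * min (1 / 2) (δ / (528 * K)))
        = 2 * (22 * K) * 4 * min (1 / 2) (δ / (528 * K)) := by ring
      _ ≤ 2 * (22 * K) * 4 * (δ / (528 * K)) := mul_le_mul_of_nonneg_left h1 h2
      _ = δ / 3 := by field_simp; norm_num
  -- cutoffs
  have hχ : ∀ k : Fin 2 → Fin N, ∃ χ : Plane → ℝ, IsTestOn (sq (gridCtr N k) ((1 - s / 2) * R)) χ ∧
      (∀ x, 0 ≤ χ x) ∧ (∀ x, χ x ≤ 1) ∧
      (∀ᶠ x in 𝓝ˢ (csq (gridCtr N k) ((1 - s) * R)), χ x = 1) ∧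
      ∀ x ∈ csq (gridCtr N k) ((1 - s) * R), χ x = 1 := fun k =>
    exists_cutoff (isCompact_csq _ _) (isOpen_sq _ _) (csq_subset_sq (by nlinarith))
  choose χ hχt hχ0 hχ1 _ hχe using hχ
  obtain ⟨Ξ, hΞt, hΞ0, hΞ1, -, hΞe⟩ := exists_cutoff (isCompact_csq ctr (1 / 2))
    (isOpen_sq ctr ((1 + s) / 2)) (csq_subset_sq (by linarith))
  have hΩ : (unitSquare : Set Plane) ⊆ csq ctr (1 / 2) := by
    rw [unitSquare_eq]; exact sq_subset_csq
  -- local data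
  have hctr : ∀ k : Fin 2 → Fin N, gridCtr N k ∈ csq (gridCtr N k) R := fun k => by
    change supDist _ _ ≤ _
    rw [supDist_le_iff]; simp [hR0.le]
  have hsub : ∀ k : Fin 2 → Fin N, csq (gridCtr N k) R ⊆ csq ctr 1 := fun k => by
    rw [hRdef]; exact grid_subset_csq hNpos k
  choose β S hβ hS hβp hfβ hS' hβK using fun k : Fin 2 → Fin N =>
    exists_square_data hf (c := gridCtr N k) (A := csq (gridCtr N k) R) hω0.le
      (hK _ (hsub k (hctr k))) (fun x hx => hosc _ (hsub k (hctr k)) x (by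
        refine (dist_le_of_mem_csq hx).trans_lt ?_
        rw [hRdef]; exact hNε))
  -- The crude splitting: entries bounded by `K` give a form bounded by `2K |e|²`, so adding `2K`
  -- times the identity makes the Hessian of `f` nonnegative everywhere on the large square.
  obtain ⟨N₀, hN₀⟩ : ∃ N₀ : Fin 2 → Fin 2 → ℝ, N₀ = fun i j => if i = j then 2 * K else 0 := ⟨_, rfl⟩
  have hN₀s : ∀ i j, N₀ i j = N₀ j i := fun i j => by
    rcases eq_or_ne i j with rfl | h
    · rfl
    · simp only [hN₀, if_neg h, if_neg h.symm]
  have h00 : N₀ 0 0 = 2 * K := by rw [hN₀]; rfl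
  have h01 : N₀ 0 1 = 0 := by rw [hN₀]; rfl
  have h10 : N₀ 1 0 = 0 := by rw [hN₀]; rfl
  have h11 : N₀ 1 1 = 2 * K := by rw [hN₀]; rfl
  have hN₀q : ∀ e : Plane, ∑ i, ∑ j, e i * e j * N₀ i j = 2 * K * ∑ i, e i ^ 2 := by
    intro e
    simp only [Fin.sum_univ_two, h00, h01, h10, h11]
    ring
  have hN₀tr : ∑ i, N₀ i i = 4 * K := by
    simp only [Fin.sum_univ_two, h00, h11]; ring
  have hlap : ∀ x ∈ csq ctr 1, lap f x ≤ 2 * K := by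
    intro x hx
    have h1 := fun i => (abs_le.1 (hK x hx i i)).2
    simp only [lap, Fin.sum_univ_two]
    linarith [h1 0, h1 1]
  -- The constant `22K` dominates `2 (2K + (3K + 2ω) + 4K)`, using `ω ≤ 1 ≤ K`. The budget `δ` is
  -- shared equally among oscillation, gaps and the accuracy of the convex approximations.
  obtain ⟨g, hg, hgf, hgE⟩ := exists_PL_of_squares (Ω := unitSquare) (c := gridCtr N) (R := R) hf hfin
    (r₁ := (1 - s / 2) * R) (r₂ := (1 - s / 4) * R) (ω := 7 * ω) (K := 22 * K) (c₀ := ctr)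
    (by nlinarith) (by nlinarith) (by nlinarith) hR1 (by positivity) (by linarith)
    (by rw [hRdef]; exact grid_disjoint hNpos) hsub
    (by rw [hRdef]; exact grid_subset_unitSquare hNpos)
    (hΩ.trans (csq_mono (by norm_num))) hχt hχ0 hχ1
    (hΞt.mono (sq_subset_csq.trans (csq_mono (by linarith)))) hΞ0 (fun x hx => hΞe x (hΩ hx))
    hβ (smooth_quad N₀) hS hβp
    (fun x e => by
      rw [dd_dd_quad hN₀s, hN₀q]
      have : 0 ≤ ∑ i, e i ^ 2 := Finset.sum_nonneg fun i _ => sq_nonneg _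
      positivity) hfβ
    (fun x hx e => by
      rw [dd_dd_add hf (smooth_quad N₀)]
      beta_reduce
      rw [dd_dd_quad hN₀s, hN₀q, dd_dd_eq_sum hf]
      have h1 := (abs_le.1 (quadForm_le (hK x hx) e)).1
      linarith) hS'
    (fun x hx => by
      rw [lap_quad hN₀s, hN₀tr]
      linarith [hlap x hx])
    (fun k x hx => by
      rw [lap_quad hN₀s, hN₀tr]
      linarith [hlap x (hsub k hx), hβK k x])
    (δ := δ / 3) (by positivity)
  refine ⟨g, hg, fun x hx => (hgf x hx).trans (by linarith), ?_⟩
  have hI1 : ∫ x, Ξ x ≤ (1 + s) ^ 2 := by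
    refine (integral_cutoff_le (hΞt.mono sq_subset_csq) hΞ1 (by linarith)).trans_eq ?_
    ring
  have hI2 : (1 - s) ^ 2 ≤ ∑ k, ∫ x, χ k x := by
    have h1 : ∀ k ∈ Finset.univ, (2 * ((1 - s) * R)) ^ 2 ≤ ∫ x, χ k x := fun k _ =>
      integral_cutoff_ge (hχt k) (hχ0 k) (by nlinarith) (hχe k)
    refine le_trans (le_of_eq ?_) (Finset.sum_le_sum h1)
    rw [Finset.sum_const, Finset.card_univ, Fintype.card_fun, Fintype.card_fin, Fintype.card_fin,
      nsmul_eq_mul]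
    push_cast
    calc (1 - s) ^ 2 = (1 - s) ^ 2 * (N * (2 * R)) ^ 2 := by rw [hRN]; ring
      _ = _ := by ring
  have hI3 : (1 + s) ^ 2 ≤ 4 := by nlinarith
  have hE : ∀ F, Adm unitSquare F →
      pr g F ≤ (hessianSchattenVariation 1 f unitSquare).toReal + δ := by
    intro F hF
    refine (hgE F hF).trans ?_
    have h1 : 7 * ω * ∫ x, Ξ x ≤ 28 * ω := by nlinarith
    have h2 : (∫ x, Ξ x) - ∑ k, ∫ x, χ k x ≤ 4 * s := by nlinarith
    have h3 := mul_le_mul_of_nonneg_left h2 (by positivity : 0 ≤ 2 * (22 * K))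
    linarith
  refine (hsv_le_of_pr_le hE).trans (le_of_eq ?_)
  rw [ENNReal.ofReal_add ENNReal.toReal_nonneg hδ.le, ENNReal.ofReal_toReal hfin]

end HTV

/-! ### The Hessian measure has no atoms. -/

namespace HTV

/-- A smooth transition from the value `1` on `(-∞, 1/2]` to the value `0` on `[1, ∞)`. -/
noncomputable def cut (t : ℝ) : ℝ := Real.smoothTransition (2 - 2 * t)

theorem contDiff_cut {n : WithTop ℕ∞} (hn : n ≤ ((⊤ : ℕ∞) : WithTop ℕ∞)) : ContDiff ℝ n cut :=
  (Real.smoothTransition.contDiff (n := ⊤)).of_le hn |>.comp (by fun_prop)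

theorem cut_eq_one {t : ℝ} (ht : t ≤ 1 / 2) : cut t = 1 :=
  Real.smoothTransition.one_of_one_le (by linarith)

theorem cut_eq_zero {t : ℝ} (ht : 1 ≤ t) : cut t = 0 :=
  Real.smoothTransition.zero_of_nonpos (by linarith)

theorem cut_nonneg (t : ℝ) : 0 ≤ cut t := Real.smoothTransition.nonneg _

theorem cut_le_one (t : ℝ) : cut t ≤ 1 := Real.smoothTransition.le_one _

/-- The field `φ e ⊗ e`. -/
def rankOneField (e : Plane) (φ : Plane → ℝ) : Fin 2 → Fin 2 → Plane → ℝ :=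
  fun i j x => (e i * e j) * φ x

theorem IsTestOn.rankOneField {A : Set Plane} {φ : Plane → ℝ} (h : IsTestOn A φ) (e : Plane) :
    IsField A (rankOneField e φ) := fun i j => h.const_mul (e i * e j)

theorem ddiv_rankOneField {φ : Plane → ℝ} (h : Smooth φ) (e : Plane) :
    ddiv (rankOneField e φ) = dd e (dd e φ) := by
  funext x
  rw [dd_dd_eq_sum h]
  refine Finset.sum_congr rfl fun i _ => Finset.sum_congr rfl fun j _ => ?_
  change dd (bas i) (dd (bas j) fun x => (e i * e j) * φ x) x = _
  rw [dd_const_mul h, dd_const_mul (h.dd _)]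

theorem pr_rankOneField_le {U : Opens Plane} {f : Plane → ℝ}
    (hfin : hessianSchattenVariation 1 f U ≠ ∞) {φ : Plane → ℝ} (hφ : IsTestOn U φ) {c : ℝ}
    (hc : 0 < c) (hφc : ∀ x, |φ x| ≤ c) {e : Plane} (he : e ≠ 0) :
    pr f (rankOneField e φ) ≤ c * (‖e‖ * ‖e‖) * (hessianSchattenVariation 1 f U).toReal := by
  have h0 : 0 < ‖e‖ := norm_pos_iff.2 he
  refine pr_le_mul_toReal hfin (hφ.rankOneField e) (by positivity) fun x => ?_
  refine (show OpLe (fun i j => rankOneField e φ i j x) (|φ x| * (‖e‖ * ‖e‖)) from ?_).mono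
    (mul_le_mul_of_nonneg_right (hφc x) (by positivity))
  simpa only [rankOneField, mul_comm] using OpLe.rankOne e e (φ x)

/-- The linear functional vanishing in the direction `e`. -/
def cross (e x : Plane) : ℝ := e 0 * x 1 - e 1 * x 0

theorem smooth_cross (e a : Plane) : Smooth fun x => cross e (x - a) := by
  have h0 := smooth_coord 0
  have h1 := smooth_coord 1
  exact (contDiff_const.mul (h1.sub contDiff_const)).sub
    (contDiff_const.mul (h0.sub contDiff_const))

theorem dd_comp_cross {κ : ℝ → ℝ} (hκ : ContDiff ℝ ((⊤ : ℕ∞) : WithTop ℕ∞) κ) (e a : Plane) :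
    dd e (fun x => κ (cross e (x - a))) = fun _ => 0 := by
  funext x
  have h1 : HasDerivAt (fun t : ℝ => κ (cross e ((x + t • e) - a)))
      (dd e (fun x => κ (cross e (x - a))) (x + (0 : ℝ) • e)) 0 :=
    hasDerivAt_line (hκ.comp (smooth_cross e a)) x e 0
  have h2 : (fun t : ℝ => κ (cross e ((x + t • e) - a))) = fun _ => κ (cross e (x - a)) := by
    funext t
    congr 1
    simp [cross]
    ring
  rw [h2, zero_smul, add_zero] at h1
  exact h1.unique (hasDerivAt_const _ _)

theorem volume_cross_eq_zero {e : Plane} (he : e ≠ 0) (a : Plane) :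
    volume {x : Plane | cross e (x - a) = 0} = 0 := by
  let l : Plane →ₗ[ℝ] ℝ :=
    { toFun := cross e
      map_add' := fun x y => by simp [cross]; ring
      map_smul' := fun c x => by simp [cross]; ring }
  have h1 : {x : Plane | cross e (x - a) = 0} = (fun x => x - a) ⁻¹' (LinearMap.ker l : Set Plane) := by
    ext x; simp [l]
  rw [h1]
  simp only [sub_eq_add_neg]
  rw [measure_preimage_add_right]
  refine Measure.addHaar_submodule _ _ fun h => he ?_
  have h2 : !₂[-e 1, e 0] ∈ LinearMap.ker l := by rw [h]; trivial
  have h3 : e 0 * e 0 + e 1 * e 1 = 0 := by simpa [l, cross] using h2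
  ext i
  have h4 : e 0 = 0 := by nlinarith [sq_nonneg (e 0), sq_nonneg (e 1)]
  have h5 : e 1 = 0 := by nlinarith [sq_nonneg (e 0), sq_nonneg (e 1)]
  fin_cases i <;> simp [h4, h5]

/-- For a field `φ e ⊗ e` only the second derivative along `e` matters. The cutoff `η n` to a strip
around the line through `a` in direction `e` is constant along `e`, so it commutes with that
derivative. Hence the contribution of the strip is `∫ f η n ∂ₑ²φ`, which tends to zero by dominated
convergence, and the rest of `φ` vanishes near `a`. -/
theorem pr_rankOneField_le_diff_singleton {U V : Opens Plane} {f : Plane → ℝ} (a : Plane)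
    (hV : (V : Set Plane) = (U : Set Plane) \ {a}) (hf : LocallyIntegrableOn f U)
    (hfin : hessianSchattenVariation 1 f V ≠ ∞) {φ : Plane → ℝ} (hφ : IsTestOn U φ) {c : ℝ}
    (hc : 0 < c) (hφc : ∀ x, |φ x| ≤ c) {e : Plane} (he : e ≠ 0) :
    pr f (rankOneField e φ) ≤ c * (‖e‖ * ‖e‖) * (hessianSchattenVariation 1 f V).toReal := by
  set κ : ℕ → ℝ → ℝ := fun n t => cut (n * t ^ 2) with hκ
  have hκs : ∀ n, ContDiff ℝ ((⊤ : ℕ∞) : WithTop ℕ∞) (κ n) := fun n =>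
    (contDiff_cut le_rfl).comp (by fun_prop)
  set η : ℕ → Plane → ℝ := fun n x => κ n (cross e (x - a)) with hη
  have hηs : ∀ n, Smooth (η n) := fun n => (hκs n).comp (smooth_cross e a)
  have hη0 : ∀ n, dd e (η n) = fun _ => 0 := fun n => dd_comp_cross (hκs n) e a
  have hηφ : ∀ n, dd e (dd e fun x => η n x * φ x) = fun x => η n x * dd e (dd e φ) x := by
    intro n
    rw [dd_mul (hηs n) hφ.smooth, hη0]
    simp only [mul_zero, add_zero]
    rw [dd_mul (hηs n) (hφ.smooth.dd e), hη0]
    simp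
  have hlim : Tendsto (fun n => ∫ x, f x * (η n x * dd e (dd e φ) x)) atTop (𝓝 0) := by
    have hint := ((hφ.dd e).dd e).integrable_mul hf
    have := tendsto_integral_of_dominated_convergence
      (F := fun n x => f x * (η n x * dd e (dd e φ) x)) (f := fun _ => (0 : ℝ))
      (μ := (volume : Measure Plane)) (fun x => ‖f x * dd e (dd e φ) x‖)
      (fun n => ((((hφ.dd e).dd e).mul_left (hηs n)).integrable_mul hf).1) hint.norm
      (fun n => ae_of_all _ fun x => by
        have h1 : |η n x| ≤ 1 := by
          rw [abs_of_nonneg (cut_nonneg _)]; exact cut_le_one _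
        rw [Real.norm_eq_abs, Real.norm_eq_abs, abs_mul, abs_mul, abs_mul]
        nlinarith [abs_nonneg (f x), abs_nonneg (dd e (dd e φ) x),
          mul_nonneg (abs_nonneg (f x)) (abs_nonneg (dd e (dd e φ) x))])
      (by
        have h1 : ∀ᵐ x : Plane, cross e (x - a) ≠ 0 := by
          rw [ae_iff]
          simpa using volume_cross_eq_zero he a
        filter_upwards [h1] with x hx
        refine tendsto_const_nhds.congr' ?_
        have h2 : 0 < cross e (x - a) ^ 2 := by positivity
        obtain ⟨N, hN⟩ := exists_nat_ge (cross e (x - a) ^ 2)⁻¹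
        filter_upwards [eventually_ge_atTop N] with n hn
        have h3 : (1 : ℝ) ≤ n * cross e (x - a) ^ 2 := by
          rw [← inv_le_iff_one_le_mul₀ h2]
          exact hN.trans (by exact_mod_cast hn)
        simp only [hη, hκ, cut_eq_zero h3]
        simp)
    simpa using this
  have key : ∀ n, 0 < n → pr f (rankOneField e φ) ≤ (∫ x, f x * (η n x * dd e (dd e φ) x))
      + c * (‖e‖ * ‖e‖) * (hessianSchattenVariation 1 f V).toReal := by
    intro n hn
    have ht1 : IsTestOn (U : Set Plane) fun x => η n x * φ x := hφ.mul_left (hηs n)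
    have ht2 : IsTestOn (U : Set Plane) fun x => φ x - η n x * φ x := hφ.sub ht1
    have ht3 : IsTestOn (V : Set Plane) fun x => φ x - η n x * φ x := by
      refine ⟨ht2.smooth, ht2.compact, fun x hx => ?_⟩
      rw [hV]
      refine ⟨ht2.supp hx, fun hxa => ?_⟩
      rw [mem_singleton_iff] at hxa
      subst hxa
      refine notMem_tsupport_iff_eventuallyEq.2 ?_ hx
      have hc1 : Continuous fun y : Plane => (n : ℝ) * cross e (y - x) ^ 2 :=
        continuous_const.mul ((smooth_cross e x).continuous.pow 2)
      have hc2 : ∀ᶠ y in 𝓝 x, (n : ℝ) * cross e (y - x) ^ 2 < 1 / 2 := by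
        refine hc1.tendsto x (Iio_mem_nhds ?_)
        simp [cross]
      filter_upwards [hc2] with y hy
      simp only [hη, hκ, cut_eq_one hy.le, one_mul, sub_self, Pi.zero_apply]
    have h1 := pr_rankOneField_le hfin ht3 hc (fun x => by
      have h1 := cut_nonneg ((n : ℝ) * cross e (x - a) ^ 2)
      have h2 := cut_le_one ((n : ℝ) * cross e (x - a) ^ 2)
      have h3 : φ x - η n x * φ x = (1 - η n x) * φ x := by ring
      rw [h3, abs_mul, abs_of_nonneg (by simp only [hη, hκ]; linarith)]
      have h4 := hφc x
      have h5 : 1 - η n x ≤ 1 := by simp only [hη, hκ]; linarith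
      have h6 : 0 ≤ 1 - η n x := by simp only [hη, hκ]; linarith
      nlinarith [abs_nonneg (φ x)]) he
    refine le_trans (le_of_eq ?_) (add_le_add_right h1 _)
    rw [pr, pr, ddiv_rankOneField hφ.smooth, ddiv_rankOneField ht3.smooth,
      dd_sub hφ.smooth ht1.smooth, dd_sub (hφ.smooth.dd e) (ht1.smooth.dd e), hηφ,
      ← integral_add]
    · congr 1; funext x; ring
    · exact (((hφ.dd e).dd e).mul_left (hηs n)).integrable_mul hf
    · exact (((hφ.dd e).dd e).sub (((hφ.dd e).dd e).mul_left (hηs n))).integrable_mul hf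
  refine ge_of_tendsto' (x := atTop) (f := fun n => (∫ x, f x * (η (n + 1) x * dd e (dd e φ) x))
      + c * (‖e‖ * ‖e‖) * (hessianSchattenVariation 1 f V).toReal) ?_ fun n => key _ n.succ_pos
  simpa using (hlim.comp (tendsto_add_atTop_nat 1)).add_const _

theorem dd_dd_sub {φ ψ : Plane → ℝ} (hφ : Smooth φ) (hψ : Smooth ψ) (e e' : Plane) :
    dd e (dd e' (fun x => φ x - ψ x)) = fun x => dd e (dd e' φ) x - dd e (dd e' ψ) x := by
  rw [dd_sub hφ hψ, dd_sub (hφ.dd _) (hψ.dd _)]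

/-- By symmetry of second derivatives a field acts as a combination of three rank-one fields, in the
directions `e₀`, `e₁` and `e₀ + e₁`. Their sizes give `6 = 2 + 2 + 1 · 2`, the last factor being the
squared length of `e₀ + e₁`. Only finiteness of the constant matters. -/
theorem hsv_le_diff_singleton {U V : Opens Plane} {f : Plane → ℝ} (a : Plane)
    (hV : (V : Set Plane) = (U : Set Plane) \ {a}) (hf : LocallyIntegrableOn f U)
    (hfin : hessianSchattenVariation 1 f V ≠ ∞) :
    hessianSchattenVariation 1 f U ≤ ENNReal.ofReal
      (6 * (hessianSchattenVariation 1 f V).toReal) := by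
  refine hsv_le_of_pr_le fun F hF => ?_
  have hb := fun x i j => (hF.2 x).abs_entry_le i j
  have hG : IsTestOn (U : Set Plane) fun x => (1 / 2) * (F 0 1 x + F 1 0 x) :=
    ((hF.1 0 1).add (hF.1 1 0)).const_mul _
  have h1 := (hF.1 0 0).sub hG
  have h2 := (hF.1 1 1).sub hG
  have e0 : bas 0 ≠ 0 := by simp [bas]
  have e1 : bas 1 ≠ 0 := by simp [bas]
  have e2 : bas 0 + bas 1 ≠ 0 := fun h => by simpa using congrFun (congrArg WithLp.ofLp h) 0
  have b0 : ∀ x, |F 0 0 x - (1 / 2) * (F 0 1 x + F 1 0 x)| ≤ 2 := fun x => by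
    have := abs_le.1 (hb x 0 0)
    have := abs_le.1 (hb x 0 1)
    have := abs_le.1 (hb x 1 0)
    rw [abs_le]; constructor <;> linarith
  have b1 : ∀ x, |F 1 1 x - (1 / 2) * (F 0 1 x + F 1 0 x)| ≤ 2 := fun x => by
    have := abs_le.1 (hb x 1 1)
    have := abs_le.1 (hb x 0 1)
    have := abs_le.1 (hb x 1 0)
    rw [abs_le]; constructor <;> linarith
  have b2 : ∀ x, |(1 / 2) * (F 0 1 x + F 1 0 x)| ≤ 1 := fun x => by
    have := abs_le.1 (hb x 0 1)
    have := abs_le.1 (hb x 1 0)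
    rw [abs_le]; constructor <;> linarith
  have p0 := pr_rankOneField_le_diff_singleton a hV hf hfin h1 two_pos b0 e0
  have p1 := pr_rankOneField_le_diff_singleton a hV hf hfin h2 two_pos b1 e1
  have p2 := pr_rankOneField_le_diff_singleton a hV hf hfin hG one_pos b2 e2
  have n2 : ‖bas 0 + bas 1‖ * ‖bas 0 + bas 1‖ = 2 := by
    rw [← pow_two, EuclideanSpace.norm_sq_eq]
    simp [Fin.sum_univ_two]; norm_num
  have hsum : pr f F = pr f (rankOneField (bas 0) fun x => F 0 0 x - (1 / 2) * (F 0 1 x + F 1 0 x))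
      + pr f (rankOneField (bas 1) fun x => F 1 1 x - (1 / 2) * (F 0 1 x + F 1 0 x))
      + pr f (rankOneField (bas 0 + bas 1) fun x => (1 / 2) * (F 0 1 x + F 1 0 x)) := by
    rw [← pr_add hf (h1.rankOneField _) (h2.rankOneField _), ← pr_add hf
      ((h1.rankOneField _).add (h2.rankOneField _)) (hG.rankOneField _)]
    simp only [pr]
    congr 1
    funext x
    congr 1
    rw [ddiv_add ((h1.rankOneField _).add (h2.rankOneField _)) (hG.rankOneField _),
      ddiv_add (h1.rankOneField _) (h2.rankOneField _)]
    rw [ddiv_rankOneField h1.smooth, ddiv_rankOneField h2.smooth, ddiv_rankOneField hG.smooth]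
    beta_reduce
    rw [dd_dd_eq_sum hG.smooth, dd_dd_sub (hF.1 0 0).smooth hG.smooth,
      dd_dd_sub (hF.1 1 1).smooth hG.smooth]
    have hs := ((hF.1 0 1).add (hF.1 1 0)).smooth
    have h3 : ∀ i j, dd (bas i) (dd (bas j) fun x => (1 / 2) * (F 0 1 x + F 1 0 x)) x
        = (1 / 2) * (dd (bas i) (dd (bas j) (F 0 1)) x + dd (bas i) (dd (bas j) (F 1 0)) x) := by
      intro i j
      rw [dd_const_mul hs, dd_const_mul (hs.dd _), dd_dd_add (hF.1 0 1).smooth (hF.1 1 0).smooth]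
    simp only [h3, Fin.sum_univ_two, ddiv]
    rw [dd_comm (hF.1 0 1).smooth (bas 1) (bas 0), dd_comm (hF.1 1 0).smooth (bas 1) (bas 0)]
    simp [bas]
    ring
  rw [n2] at p2
  simp only [bas, PiLp.norm_single, norm_one] at p0 p1
  rw [hsum]
  linarith

/-- The intersection of the open set `U` with a ball. -/
def capBall (U : Opens Plane) (p : Plane) (r : ℝ) : Opens Plane :=
  ⟨U ∩ Metric.ball p r, U.isOpen.inter Metric.isOpen_ball⟩

theorem Adm.add_of_disjoint {A B C : Set Plane} {F G : Fin 2 → Fin 2 → Plane → ℝ} (hF : Adm A F)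
    (hG : Adm B G) (hA : A ⊆ C) (hB : B ⊆ C) (h : ∀ x ∈ B, ∀ i j, F i j x = 0) :
    Adm C fun i j x => F i j x + G i j x := by
  refine ⟨(hF.1.mono hA).add (hG.1.mono hB), fun x => ?_⟩
  by_cases hx : x ∈ B
  · simpa only [h x hx, zero_add] using hG.2 x
  · simpa only [(hG.1 _ _).eq_zero hx, add_zero] using hF.2 x

/-- A nearly optimal field on the set punctured at `a` has compact support, so it vanishes on some
ball around `a`. Any admissible field in the punctured ball can be added to it without increasing
the norm, hence gains at most `δ`. -/
theorem exists_hsv_capBall_diff_le {U : Opens Plane} {f : Plane → ℝ}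
    (hf : LocallyIntegrableOn f U) (hfin : hessianSchattenVariation 1 f U ≠ ∞) (a : Plane)
    {δ : ℝ} (hδ : 0 < δ) : ∃ r > 0, ∀ V : Opens Plane,
      (V : Set Plane) = (capBall U a r : Set Plane) \ {a} →
      hessianSchattenVariation 1 f V ≤ ENNReal.ofReal δ := by
  set W : Opens Plane := ⟨(U : Set Plane) \ {a}, U.isOpen.sdiff isClosed_singleton⟩ with hW
  have hWU : (W : Set Plane) ⊆ U := sdiff_subset
  have hWfin : hessianSchattenVariation 1 f W ≠ ∞ := ne_top_of_le_ne_top hfin (hsv_mono f hWU)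
  obtain ⟨F, hF, hFe⟩ : ∃ F, Adm W F ∧ (hessianSchattenVariation 1 f W).toReal - δ ≤ pr f F := by
    by_contra! hcon
    have h1 : hessianSchattenVariation 1 f W
        ≤ ENNReal.ofReal ((hessianSchattenVariation 1 f W).toReal - δ) :=
      hsv_le_of_pr_le fun F hF => (hcon F hF).le
    have h0 := hcon (fun _ _ _ => 0) ⟨fun _ _ => IsTestOn.zero, fun x => OpLe.zero.mono zero_le_one⟩
    have h2 : pr f (fun _ _ _ => 0) = 0 := by simp [pr, ddiv_zero]
    rw [h2] at h0
    have h3 := ENNReal.toReal_le_of_le_ofReal h0.le h1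
    linarith
  have hev : ∀ᶠ x in 𝓝 a, ∀ i j, F i j x = 0 := by
    rw [eventually_all]
    intro i
    rw [eventually_all]
    intro j
    exact notMem_tsupport_iff_eventuallyEq.1 fun h => ((hF.1 i j).supp h).2 rfl
  obtain ⟨r, hr, hball⟩ := Metric.eventually_nhds_iff_ball.1 hev
  refine ⟨r, hr, fun V hV => hsv_le_of_pr_le fun G hG => ?_⟩
  have hVW : (V : Set Plane) ⊆ W := fun x hx => by
    rw [hV] at hx
    exact ⟨hx.1.1, hx.2⟩
  have h1 := hF.add_of_disjoint hG subset_rfl hVW fun x hx => hball x (by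
    rw [hV] at hx
    exact hx.1.2)
  have h2 := pr_le_toReal hWfin h1
  rw [pr_add (hf.mono_set hWU) hF.1 (hG.1.mono hVW)] at h2
  linarith

/-- The Hessian–Schatten variation has no atoms. -/
theorem exists_hsv_capBall_le {U : Opens Plane} {f : Plane → ℝ}
    (hf : LocallyIntegrableOn f U) (hfin : hessianSchattenVariation 1 f U ≠ ∞) (a : Plane)
    {δ : ℝ} (hδ : 0 < δ) : ∃ r > 0,
      hessianSchattenVariation 1 f (capBall U a r) ≤ ENNReal.ofReal δ := by
  obtain ⟨r, hr, h⟩ := exists_hsv_capBall_diff_le hf hfin a (show 0 < δ / 6 by positivity)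
  refine ⟨r, hr, ?_⟩
  set V : Opens Plane := ⟨(capBall U a r : Set Plane) \ {a},
    (capBall U a r).isOpen.sdiff isClosed_singleton⟩ with hV
  have h1 := h V rfl
  refine (hsv_le_diff_singleton (V := V) a rfl (hf.mono_set inter_subset_left)
    (ne_top_of_le_ne_top ENNReal.ofReal_ne_top h1)).trans (ENNReal.ofReal_le_ofReal ?_)
  have := ENNReal.toReal_le_of_le_ofReal (by positivity) h1
  linarith

/-- Uniform smallness of the Hessian–Schatten variation on small balls. -/
theorem exists_forall_hsv_capBall_le {U : Opens Plane} {f : Plane → ℝ}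
    (hf : LocallyIntegrableOn f U) (hfin : hessianSchattenVariation 1 f U ≠ ∞) {K : Set Plane}
    (hK : IsCompact K) {δ : ℝ} (hδ : 0 < δ) : ∃ r > 0, ∀ p ∈ K,
      hessianSchattenVariation 1 f (capBall U p r) ≤ ENNReal.ofReal δ := by
  choose r hr h using fun a => exists_hsv_capBall_le hf hfin a hδ
  obtain ⟨ρ, hρ, hcov⟩ := lebesgue_number_lemma_of_metric (c := fun a => Metric.ball a (r a)) hK
    (fun a => Metric.isOpen_ball) (fun x _ => mem_iUnion.2 ⟨x, Metric.mem_ball_self (hr x)⟩)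
  refine ⟨ρ, hρ, fun p hp => ?_⟩
  obtain ⟨a, ha⟩ := hcov p hp
  exact (hsv_mono f (inter_subset_inter_right _ ha)).trans (h a)

end HTV

/-! ### A representation of point values by second derivatives. -/

namespace HTV

/-- The derivative of `cut`. -/
noncomputable def cut' : ℝ → ℝ := deriv cut

/-- The weight obtained by integrating by parts twice against `t * cut t`. -/
noncomputable def cutW (t : ℝ) : ℝ := 2 * cut' t + t * deriv cut' t

theorem contDiff_cut' : ContDiff ℝ ((⊤ : ℕ∞) : WithTop ℕ∞) cut' :=
  ((contDiff_infty_iff_deriv).1 (contDiff_cut le_rfl)).2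

theorem contDiff_deriv_cut' : ContDiff ℝ ((⊤ : ℕ∞) : WithTop ℕ∞) (deriv cut') :=
  ((contDiff_infty_iff_deriv).1 contDiff_cut').2

theorem contDiff_cutW : ContDiff ℝ ((⊤ : ℕ∞) : WithTop ℕ∞) cutW :=
  (contDiff_const.mul contDiff_cut').add (contDiff_id.mul contDiff_deriv_cut')

theorem hasDerivAt_cut (t : ℝ) : HasDerivAt cut (cut' t) t :=
  (((contDiff_infty_iff_deriv).1 (contDiff_cut le_rfl)).1 t).hasDerivAt

theorem hasDerivAt_cut' (t : ℝ) : HasDerivAt cut' (deriv cut' t) t :=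
  (((contDiff_infty_iff_deriv).1 contDiff_cut').1 t).hasDerivAt

theorem cut'_eq_zero {t : ℝ} (ht : t ∉ Icc (1 / 2) 1) : cut' t = 0 := by
  rcases lt_or_ge t (1 / 2) with h | h
  · have : cut =ᶠ[𝓝 t] fun _ => 1 := by
      filter_upwards [Iio_mem_nhds h] with s hs using cut_eq_one (le_of_lt hs)
    rw [cut', this.deriv_eq, deriv_const]
  · have : cut =ᶠ[𝓝 t] fun _ => 0 := by
      filter_upwards [Ioi_mem_nhds (not_le.1 fun h' => ht ⟨h, h'⟩)] with s hs
        using cut_eq_zero (le_of_lt hs)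
    rw [cut', this.deriv_eq, deriv_const]

theorem deriv_cut'_eq_zero {t : ℝ} (ht : t ∉ Icc (1 / 2) 1) : deriv cut' t = 0 := by
  have : cut' =ᶠ[𝓝 t] fun _ => 0 := by
    filter_upwards [isClosed_Icc.isOpen_compl.mem_nhds ht] with s hs using cut'_eq_zero hs
  rw [this.deriv_eq, deriv_const]

theorem cutW_eq_zero {t : ℝ} (ht : t ∉ Icc (1 / 2) 1) : cutW t = 0 := by
  rw [cutW, cut'_eq_zero ht, deriv_cut'_eq_zero ht]; simp

theorem cut'_one : cut' 1 = 0 := by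
  have h : cut' 1 ∈ closure {(0 : ℝ)} := by
    refine map_mem_closure (s := Ioi (1 : ℝ)) contDiff_cut'.continuous ?_ fun t ht => ?_
    · rw [closure_Ioi]; exact self_mem_Ici
    · exact cut'_eq_zero fun h => not_le.2 ht h.2
  simpa using h

/-- The fundamental theorem of calculus for `cut * w`, with `cut 0 = 1` and `cut 1 = 0`. -/
theorem eq_integral_deriv {w w' : ℝ → ℝ} (hw : ∀ t, HasDerivAt w (w' t) t)
    (hw' : Continuous w') :
    w 0 = - (∫ t in (0 : ℝ)..1, cut' t * w t) - ∫ t in (0 : ℝ)..1, cut t * w' t := by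
  have hwc : Continuous w := continuous_iff_continuousAt.2 fun t => (hw t).continuousAt
  have hc := contDiff_cut'.continuous
  have hc0 := (contDiff_cut le_rfl).continuous
  have h := intervalIntegral.integral_eq_sub_of_hasDerivAt (a := 0) (b := 1)
    (fun t _ => (hasDerivAt_cut t).mul (hw t))
    ((by fun_prop : Continuous fun t => cut' t * w t + cut t * w' t).intervalIntegrable _ _)
  rw [intervalIntegral.integral_add ((by fun_prop : Continuous _).intervalIntegrable _ _)
    ((by fun_prop : Continuous _).intervalIntegrable _ _)] at h
  simp only [Pi.mul_apply, cut_eq_zero le_rfl, cut_eq_one (show (0 : ℝ) ≤ 1 / 2 by norm_num)] at h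
  linarith

/-- The primitive `cut w - t cut w' + t cut' w` is chosen so that the terms in `w'` cancel in its
derivative. The weight `cutW` on `w` lives away from `0`. -/
theorem eq_integral_deriv_deriv {w w' w'' : ℝ → ℝ} (hw : ∀ t, HasDerivAt w (w' t) t)
    (hw' : ∀ t, HasDerivAt w' (w'' t) t) (hw'' : Continuous w'') :
    w 0 = - (∫ t in (0 : ℝ)..1, cutW t * w t) + ∫ t in (0 : ℝ)..1, t * cut t * w'' t := by
  have hwc : Continuous w := continuous_iff_continuousAt.2 fun t => (hw t).continuousAt
  have hc := contDiff_cutW.continuous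
  have hc0 := (contDiff_cut le_rfl).continuous
  have hF : ∀ t : ℝ, HasDerivAt (fun t => cut t * w t - t * cut t * w' t + t * cut' t * w t)
      (cutW t * w t - t * cut t * w'' t) t := by
    intro t
    have h := (((hasDerivAt_cut t).mul (hw t)).sub
      (((hasDerivAt_id t).mul (hasDerivAt_cut t)).mul (hw' t))).add
      (((hasDerivAt_id t).mul (hasDerivAt_cut' t)).mul (hw t))
    refine h.congr_deriv ?_
    simp only [cutW, id, Pi.mul_apply]
    ring
  have h := intervalIntegral.integral_eq_sub_of_hasDerivAt (a := 0) (b := 1)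
    (fun t _ => hF t)
    ((by fun_prop : Continuous fun t => cutW t * w t - t * cut t * w'' t).intervalIntegrable _ _)
  rw [intervalIntegral.integral_sub ((by fun_prop : Continuous _).intervalIntegrable _ _)
    ((by fun_prop : Continuous _).intervalIntegrable _ _)] at h
  simp only [cut_eq_zero le_rfl, cut_eq_one (show (0 : ℝ) ≤ 1 / 2 by norm_num), cut'_one] at h
  linarith

/-- The plane as a product of lines. -/
noncomputable def planeEquiv : Plane ≃ᵐ ℝ × ℝ :=
  (MeasurableEquiv.toLp 2 (Fin 2 → ℝ)).symm.trans MeasurableEquiv.finTwoArrow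

theorem measurePreserving_planeEquiv : MeasurePreserving planeEquiv :=
  (EuclideanSpace.volume_preserving_symm_measurableEquiv_toLp (Fin 2)).trans
    (volume_preserving_finTwoArrow ℝ)

theorem planeEquiv_apply (x : Plane) : planeEquiv x = (x 0, x 1) := rfl

theorem mem_csq_ctr {x : Plane} : x ∈ csq ctr (1 / 2) ↔ ∀ i, x i ∈ Icc (0 : ℝ) 1 := by
  change supDist ctr x ≤ 1 / 2 ↔ _
  rw [supDist_le_iff]
  refine forall_congr' fun i => ?_
  simp only [ctr, abs_le, mem_Icc]
  constructor <;> rintro ⟨h1, h2⟩ <;> constructor <;> linarith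

theorem setIntegral_csq_eq (h : Plane → ℝ) :
    ∫ x in csq ctr (1 / 2), h x = ∫ y in Ioc (0 : ℝ) 1 ×ˢ Ioc (0 : ℝ) 1, h !₂[y.1, y.2] := by
  have h1 : ∫ y in Icc (0 : ℝ) 1 ×ˢ Icc (0 : ℝ) 1, h !₂[y.1, y.2]
      = ∫ x in csq ctr (1 / 2), h x := by
    rw [← measurePreserving_planeEquiv.setIntegral_preimage_emb planeEquiv.measurableEmbedding]
    have h2 : planeEquiv ⁻¹' (Icc (0 : ℝ) 1 ×ˢ Icc (0 : ℝ) 1) = csq ctr (1 / 2) := by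
      ext x
      rw [mem_csq_ctr, mem_preimage, planeEquiv_apply, mem_prod, Fin.forall_fin_two]
    rw [h2]
    congr 1
    funext x
    congr 1
    ext i; fin_cases i <;> rfl
  rw [← h1]
  refine setIntegral_congr_set ?_
  exact (Measure.set_prod_ae_eq Ioc_ae_eq_Icc Ioc_ae_eq_Icc).symm

theorem continuous_mk {g₁ g₂ : ℝ × ℝ → ℝ} (h₁ : Continuous g₁) (h₂ : Continuous g₂) :
    Continuous fun y : ℝ × ℝ => (!₂[g₁ y, g₂ y] : Plane) := by
  refine (PiLp.continuous_toLp 2 (fun _ : Fin 2 => ℝ)).comp (continuous_pi fun i => ?_)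
  fin_cases i <;> simpa

theorem integral_slice_fst {h : Plane → ℝ} (hh : Continuous h) {a c : ℝ → ℝ} (ha : Continuous a)
    (hc : Continuous c) :
    ∫ s in (0 : ℝ)..1, c s * ∫ t in (0 : ℝ)..1, a t * h !₂[s, t]
      = ∫ x in csq ctr (1 / 2), c (x 0) * a (x 1) * h x := by
  have hg : Continuous fun y : ℝ × ℝ => c y.1 * a y.2 * h !₂[y.1, y.2] := by
    have := continuous_mk continuous_fst continuous_snd
    fun_prop
  rw [setIntegral_csq_eq]
  simp only [intervalIntegral.integral_of_le zero_le_one, ← integral_const_mul]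
  rw [Measure.volume_eq_prod, setIntegral_prod]
  · simp [mul_assoc]
  · exact (hg.continuousOn.integrableOn_compact (isCompact_Icc.prod isCompact_Icc)).mono_set
      (prod_mono Ioc_subset_Icc_self Ioc_subset_Icc_self)

theorem integral_slice_snd {h : Plane → ℝ} (hh : Continuous h) {a c : ℝ → ℝ} (ha : Continuous a)
    (hc : Continuous c) :
    ∫ t in (0 : ℝ)..1, c t * ∫ s in (0 : ℝ)..1, a s * h !₂[s, t]
      = ∫ x in csq ctr (1 / 2), c (x 1) * a (x 0) * h x := by
  have hg : Continuous fun y : ℝ × ℝ => c y.2 * a y.1 * h !₂[y.1, y.2] := by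
    have := continuous_mk continuous_fst continuous_snd
    fun_prop
  rw [setIntegral_csq_eq]
  simp only [intervalIntegral.integral_of_le zero_le_one, ← integral_const_mul]
  rw [Measure.volume_eq_prod, ← Measure.prod_restrict, integral_prod_symm]
  · simp [mul_assoc]
  · rw [Measure.prod_restrict]
    exact (hg.continuousOn.integrableOn_compact (isCompact_Icc.prod isCompact_Icc)).mono_set
      (prod_mono Ioc_subset_Icc_self Ioc_subset_Icc_self)

theorem continuous_slice_fst {h : Plane → ℝ} (hh : Continuous h) {a : ℝ → ℝ} (ha : Continuous a) :
    Continuous fun s => ∫ t in (0 : ℝ)..1, a t * h !₂[s, t] := by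
  refine intervalIntegral.continuous_parametric_intervalIntegral_of_continuous' ?_ _ _
  have := continuous_mk continuous_fst continuous_snd
  simp only [Function.uncurry_def]
  fun_prop

theorem continuous_slice_snd {h : Plane → ℝ} (hh : Continuous h) {a : ℝ → ℝ} (ha : Continuous a) :
    Continuous fun t => ∫ s in (0 : ℝ)..1, a s * h !₂[s, t] := by
  refine intervalIntegral.continuous_parametric_intervalIntegral_of_continuous' ?_ _ _
  have := continuous_mk continuous_snd continuous_fst
  simp only [Function.uncurry_def]
  fun_prop

theorem hasDerivAt_fst {v : Plane → ℝ} (hv : Smooth v) (s t : ℝ) :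
    HasDerivAt (fun s => v !₂[s, t]) (dd (bas 0) v !₂[s, t]) s := by
  have h := hasDerivAt_line hv !₂[0, t] (bas 0) s
  have h1 : ∀ s : ℝ, !₂[0, t] + s • bas 0 = !₂[s, t] := fun s => by
    ext i; fin_cases i <;> simp [bas]
  simpa only [h1] using h

theorem hasDerivAt_snd {v : Plane → ℝ} (hv : Smooth v) (s t : ℝ) :
    HasDerivAt (fun t => v !₂[s, t]) (dd (bas 1) v !₂[s, t]) t := by
  have h := hasDerivAt_line hv !₂[s, 0] (bas 1) t
  have h1 : ∀ t : ℝ, !₂[s, 0] + t • bas 1 = !₂[s, t] := fun s => by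
    ext i; fin_cases i <;> simp [bas]
  simpa only [h1] using h

/-- The weight in the representation formula `exists_abs_sub_integral_le`. -/
noncomputable def repW (x : Plane) : ℝ :=
  cut' (x 0) * cutW (x 1) + cutW (x 0) * cut' (x 1) - cut' (x 0) * cut' (x 1)

theorem repW_eq_zero {x : Plane} (h : ∃ i, x i ∉ Icc (1 / 2 : ℝ) 1) : repW x = 0 := by
  obtain ⟨i, hi⟩ := h
  fin_cases i <;> simp at hi <;>
    simp [repW, cut'_eq_zero (t := x _) (by simpa using hi), cutW_eq_zero (t := x _) (by simpa using hi)]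

theorem smooth_repW : Smooth repW := by
  have h0 := smooth_coord 0
  have h1 := smooth_coord 1
  exact (((contDiff_cut'.comp h0).mul (contDiff_cutW.comp h1)).add
    ((contDiff_cutW.comp h0).mul (contDiff_cut'.comp h1))).sub
    ((contDiff_cut'.comp h0).mul (contDiff_cut'.comp h1))

/-- One integration from the corner along an edge leaves `v` and `∂₀v` on that edge. Integrating in
the transverse variable, to second order for `v` and to first order for `∂₀v`, leaves second
derivatives, values of `v`, and one area integral of `∂₀v`. -/
theorem repW_formula {v : Plane → ℝ} (hv : Smooth v) :
    v 0 - ∫ x in csq ctr (1 / 2), repW x * v x = ∫ x in csq ctr (1 / 2),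
      (cut (x 0) * cut (x 1) * dd (bas 1) (dd (bas 0) v) x
        - cut' (x 0) * (x 1 * cut (x 1)) * dd (bas 1) (dd (bas 1) v) x
        - cut' (x 1) * (x 0 * cut (x 0)) * dd (bas 0) (dd (bas 0) v) x) := by
  have c0 := (contDiff_cut le_rfl).continuous
  have c1 := contDiff_cut'.continuous
  have c2 := contDiff_cutW.continuous
  have c3 : Continuous fun t => t * cut t := continuous_id.mul c0
  have x0 := (smooth_coord 0).continuous
  have x1 := (smooth_coord 1).continuous
  have k := hv.continuous
  have k0 := (hv.dd (bas 0)).continuous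
  have k1 := (hv.dd (bas 1)).continuous
  have k00 := ((hv.dd (bas 0)).dd (bas 0)).continuous
  have k10 := ((hv.dd (bas 0)).dd (bas 1)).continuous
  have k11 := ((hv.dd (bas 1)).dd (bas 1)).continuous
  have l1 : Continuous fun s : ℝ => (!₂[s, 0] : Plane) :=
    (continuous_mk continuous_fst continuous_snd).comp (by fun_prop : Continuous fun s : ℝ => (s, (0 : ℝ)))
  have l2 : Continuous fun t : ℝ => (!₂[0, t] : Plane) :=
    (continuous_mk continuous_fst continuous_snd).comp (by fun_prop : Continuous fun t : ℝ => ((0 : ℝ), t))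
  have l3 : ∀ s, Continuous fun t : ℝ => (!₂[s, t] : Plane) := fun s =>
    (continuous_mk continuous_fst continuous_snd).comp (by fun_prop : Continuous fun t : ℝ => (s, t))
  have l4 : ∀ t, Continuous fun s : ℝ => (!₂[s, t] : Plane) := fun t =>
    (continuous_mk continuous_fst continuous_snd).comp (by fun_prop : Continuous fun s : ℝ => (s, t))
  have z : (!₂[0, 0] : Plane) = 0 := by ext i; fin_cases i <;> rfl
  have hI : ∀ {h : Plane → ℝ}, Continuous h → IntegrableOn h (csq ctr (1 / 2)) := fun hh =>
    hh.continuousOn.integrableOn_compact (isCompact_csq _ _)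
  have e1 := eq_integral_deriv (fun s => hasDerivAt_fst hv s 0) (by fun_prop)
  rw [z] at e1
  have e2 : ∫ s in (0 : ℝ)..1, cut' s * v !₂[s, 0]
      = -(∫ x in csq ctr (1 / 2), cut' (x 0) * cutW (x 1) * v x)
        + ∫ x in csq ctr (1 / 2), cut' (x 0) * (x 1 * cut (x 1)) * dd (bas 1) (dd (bas 1) v) x := by
    rw [← integral_slice_fst k c2 c1, ← integral_slice_fst k11 c3 c1,
      ← intervalIntegral.integral_neg, ← intervalIntegral.integral_add]
    · congr 1
      funext s
      rw [eq_integral_deriv_deriv (fun t => hasDerivAt_snd hv s t)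
        (fun t => hasDerivAt_snd (hv.dd _) s t) (k11.comp (l3 s))]
      ring
    · exact (c1.mul (continuous_slice_fst k c2)).neg.intervalIntegrable _ _
    · exact (c1.mul (continuous_slice_fst k11 c3)).intervalIntegrable _ _
  have e3 : ∫ s in (0 : ℝ)..1, cut s * dd (bas 0) v !₂[s, 0]
      = -(∫ x in csq ctr (1 / 2), cut (x 0) * cut' (x 1) * dd (bas 0) v x)
        - ∫ x in csq ctr (1 / 2), cut (x 0) * cut (x 1) * dd (bas 1) (dd (bas 0) v) x := by
    rw [← integral_slice_fst k0 c1 c0, ← integral_slice_fst k10 c0 c0,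
      ← intervalIntegral.integral_neg, ← intervalIntegral.integral_sub]
    · congr 1
      funext s
      rw [eq_integral_deriv (fun t => hasDerivAt_snd (hv.dd _) s t) (k10.comp (l3 s))]
      ring
    · exact (c0.mul (continuous_slice_fst k0 c1)).neg.intervalIntegrable _ _
    · exact (c0.mul (continuous_slice_fst k10 c0)).intervalIntegrable _ _
  -- This integral along the other edge is expanded here to second order and in `e5` to first order.
  -- Equating the two eliminates the area integral of `∂₀v` left by `e3`.
  have e4 : ∫ t in (0 : ℝ)..1, cut' t * v !₂[0, t]
      = -(∫ x in csq ctr (1 / 2), cut' (x 1) * cutW (x 0) * v x)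
        + ∫ x in csq ctr (1 / 2), cut' (x 1) * (x 0 * cut (x 0)) * dd (bas 0) (dd (bas 0) v) x := by
    rw [← integral_slice_snd k c2 c1, ← integral_slice_snd k00 c3 c1,
      ← intervalIntegral.integral_neg, ← intervalIntegral.integral_add]
    · congr 1
      funext s
      rw [eq_integral_deriv_deriv (fun t => hasDerivAt_fst hv t s)
        (fun t => hasDerivAt_fst (hv.dd _) t s) (k00.comp (l4 s))]
      ring
    · exact (c1.mul (continuous_slice_snd k c2)).neg.intervalIntegrable _ _
    · exact (c1.mul (continuous_slice_snd k00 c3)).intervalIntegrable _ _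
  have e5 : ∫ t in (0 : ℝ)..1, cut' t * v !₂[0, t]
      = -(∫ x in csq ctr (1 / 2), cut' (x 1) * cut' (x 0) * v x)
        - ∫ x in csq ctr (1 / 2), cut' (x 1) * cut (x 0) * dd (bas 0) v x := by
    rw [← integral_slice_snd k c1 c1, ← integral_slice_snd k0 c0 c1,
      ← intervalIntegral.integral_neg, ← intervalIntegral.integral_sub]
    · congr 1
      funext s
      rw [eq_integral_deriv (fun t => hasDerivAt_fst hv t s) (k0.comp (l4 s))]
      ring
    · exact (c1.mul (continuous_slice_snd k c1)).neg.intervalIntegrable _ _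
    · exact (c1.mul (continuous_slice_snd k0 c0)).intervalIntegrable _ _
  have e6 : ∫ x in csq ctr (1 / 2), repW x * v x
      = (∫ x in csq ctr (1 / 2), cut' (x 0) * cutW (x 1) * v x)
        + (∫ x in csq ctr (1 / 2), cut' (x 1) * cutW (x 0) * v x)
        - ∫ x in csq ctr (1 / 2), cut' (x 1) * cut' (x 0) * v x := by
    rw [← integral_add (hI (by fun_prop)) (hI (by fun_prop)),
      ← integral_sub (hI (by fun_prop)) (hI (by fun_prop))]
    congr 1
    funext x
    simp only [repW]
    ring
  rw [integral_sub (hI (by fun_prop)) (hI (by fun_prop)),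
    integral_sub (hI (by fun_prop)) (hI (by fun_prop))]
  have e7 : ∫ x in csq ctr (1 / 2), cut (x 0) * cut' (x 1) * dd (bas 0) v x
      = ∫ x in csq ctr (1 / 2), cut' (x 1) * cut (x 0) * dd (bas 0) v x := by
    congr 1
    funext x
    ring
  linarith

/-- Pointwise values of smooth functions are controlled by a weighted mean and the Hessian. -/
theorem exists_abs_sub_integral_le : ∃ C : ℝ, 0 < C ∧ ∀ v : Plane → ℝ, Smooth v →
    |v 0 - ∫ x, repW x * v x|
      ≤ C * ∑ i, ∑ j, ∫ x in csq ctr (1 / 2), |dd (bas i) (dd (bas j) v) x| := by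
  obtain ⟨C, hC⟩ := (isCompact_Icc (a := (0 : ℝ)) (b := 1)).exists_bound_of_continuousOn
    contDiff_cut'.continuous.continuousOn
  have hC0 : 0 ≤ C := (norm_nonneg _).trans (hC 0 (by simp))
  refine ⟨C + 1, by linarith, fun v hv => ?_⟩
  have h1 : ∫ x, repW x * v x = ∫ x in csq ctr (1 / 2), repW x * v x := by
    rw [setIntegral_eq_integral_of_forall_compl_eq_zero]
    intro x hx
    rw [mem_csq_ctr] at hx
    push Not at hx
    obtain ⟨i, hi⟩ := hx
    rw [repW_eq_zero ⟨i, fun h => hi ⟨by linarith [h.1], h.2⟩⟩, zero_mul]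
  have hI : ∀ i j, IntegrableOn (fun x => |dd (bas i) (dd (bas j) v) x|) (csq ctr (1 / 2)) :=
    fun i j => ((hv.dd _).dd _).continuous.abs.continuousOn.integrableOn_compact (isCompact_csq _ _)
  rw [h1, repW_formula hv, ← Real.norm_eq_abs]
  have h2 : (C + 1) * ∑ i, ∑ j, ∫ x in csq ctr (1 / 2), |dd (bas i) (dd (bas j) v) x|
      = ∫ x in csq ctr (1 / 2), (C + 1) * ∑ i, ∑ j, |dd (bas i) (dd (bas j) v) x| := by
    rw [integral_const_mul, integral_finsetSum _ fun i _ => integrable_finsetSum _ fun j _ => hI i j]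
    congr 1
    exact Finset.sum_congr rfl fun i _ => (integral_finsetSum _ fun j _ => hI i j).symm
  rw [h2]
  refine norm_integral_le_of_norm_le ((integrable_finsetSum _ fun i _ =>
    integrable_finsetSum _ fun j _ => hI i j).const_mul _) ?_
  refine (ae_restrict_iff' (isClosed_csq _ _).measurableSet).2 (ae_of_all _ fun x hx => ?_)
  rw [mem_csq_ctr] at hx
  have b1 : ∀ i, |cut' (x i)| ≤ C := fun i => hC _ (hx i)
  have b2 : ∀ i, |cut (x i)| ≤ 1 := fun i => by
    rw [abs_of_nonneg (cut_nonneg _)]; exact cut_le_one _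
  have b3 : ∀ i, |x i| ≤ 1 := fun i => by
    rw [abs_of_nonneg (hx i).1]; exact (hx i).2
  have b4 : |cut (x 0) * cut (x 1)| ≤ C + 1 := by
    rw [abs_mul]; nlinarith [b2 0, b2 1, abs_nonneg (cut (x 0)), abs_nonneg (cut (x 1))]
  have b5 : ∀ i j, |cut' (x i) * (x j * cut (x j))| ≤ C + 1 := fun i j => by
    have h1 : |x j * cut (x j)| ≤ 1 := by
      rw [abs_mul]; nlinarith [b2 j, b3 j, abs_nonneg (cut (x j)), abs_nonneg (x j)]
    rw [abs_mul]
    nlinarith [b1 i, abs_nonneg (cut' (x i)), abs_nonneg (x j * cut (x j))]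
  have h3 : ∀ {a d : ℝ}, |a| ≤ C + 1 → |a * d| ≤ (C + 1) * |d| := fun h => by
    rw [abs_mul]; exact mul_le_mul_of_nonneg_right h (abs_nonneg _)
  rw [Real.norm_eq_abs]
  have t1 := h3 (d := dd (bas 1) (dd (bas 0) v) x) b4
  have t2 := h3 (d := dd (bas 1) (dd (bas 1) v) x) (b5 0 1)
  have t3 := h3 (d := dd (bas 0) (dd (bas 0) v) x) (b5 1 0)
  have t4 : 0 ≤ (C + 1) * |dd (bas 0) (dd (bas 1) v) x| := by positivity
  rw [Fin.sum_univ_two, Fin.sum_univ_two, Fin.sum_univ_two]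
  refine (abs_sub _ _).trans ((add_le_add_left (abs_sub _ _) _).trans ?_)
  linarith

end HTV

/-! ### Rescaling and reflecting the representation formula to an arbitrary point of the square. -/

namespace HTV

/-- The similarity `x ↦ a + r R x`. -/
noncomputable def sim (a : Plane) (r : ℝ) (R : Plane ≃ₗᵢ[ℝ] Plane) (x : Plane) : Plane := a + r • R x

section Sim

variable {a : Plane} {r : ℝ} {R : Plane ≃ₗᵢ[ℝ] Plane}

theorem sim_symm_sim (hr : r ≠ 0) (x : Plane) :
    sim (-(r⁻¹ • R.symm a)) r⁻¹ R.symm (sim a r R x) = x := by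
  simp [sim, smul_smul, hr]

theorem sim_sim_symm (hr : r ≠ 0) (x : Plane) :
    sim a r R (sim (-(r⁻¹ • R.symm a)) r⁻¹ R.symm x) = x := by
  simp [sim, smul_smul, hr]

theorem contDiff_sim {n : WithTop ℕ∞} : ContDiff ℝ n (sim a r R) :=
  contDiff_const.add (R.contDiff.const_smul r)

/-- A similarity as a homeomorphism. -/
noncomputable def simHomeo (a : Plane) (R : Plane ≃ₗᵢ[ℝ] Plane) (hr : r ≠ 0) : Plane ≃ₜ Plane where
  toFun := sim a r R
  invFun := sim (-(r⁻¹ • R.symm a)) r⁻¹ R.symm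
  left_inv := sim_symm_sim hr
  right_inv := sim_sim_symm hr
  continuous_toFun := (contDiff_sim (n := 0)).continuous
  continuous_invFun := (contDiff_sim (n := 0)).continuous

theorem Smooth.comp_sim {φ : Plane → ℝ} (h : Smooth φ) : Smooth fun x => φ (sim a r R x) :=
  h.comp contDiff_sim

theorem dd_comp_sim {φ : Plane → ℝ} (h : Smooth φ) (e : Plane) :
    dd e (fun x => φ (sim a r R x)) = fun x => dd (r • R e) φ (sim a r R x) := by
  funext x
  have h1 : HasFDerivAt (sim a r R) (r • (R.toContinuousLinearEquiv : Plane →L[ℝ] Plane)) x :=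
    ((R.toContinuousLinearEquiv.hasFDerivAt (x := x)).const_smul r).const_add a
  have h2 := ((h.differentiable _).hasFDerivAt).comp x h1
  simp only [dd]
  rw [show (fun x => φ (sim a r R x)) = φ ∘ sim a r R from rfl, h2.fderiv]
  rfl

theorem IsTestOn.comp_sim {A : Set Plane} {φ : Plane → ℝ} (h : IsTestOn A φ) (hr : r ≠ 0) :
    IsTestOn (sim a r R ⁻¹' A) fun x => φ (sim a r R x) := by
  have h1 : tsupport (fun x => φ (sim a r R x)) = sim a r R ⁻¹' tsupport φ :=
    tsupport_comp_eq_preimage φ (simHomeo a R hr)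
  exact ⟨h.smooth.comp_sim, h.compact.comp_homeomorph (simHomeo a R hr),
    h1 ▸ preimage_mono h.supp⟩

theorem integral_comp_sim (hr : 0 < r) (h : Plane → ℝ) :
    ∫ x, h (sim a r R x) = (r ^ 2)⁻¹ * ∫ x, h x := by
  have h1 : ∫ x, h (sim a r R x) = ∫ x, h (a + r • x) :=
    (R.measurePreserving.integral_comp R.toHomeomorph.measurableEmbedding (fun x => h (a + r • x)))
  rw [h1, Measure.integral_comp_smul volume (fun x => h (a + x)) r, integral_add_left_eq_self]
  simp [abs_of_pos hr]

theorem setIntegral_comp_sim (hr : 0 < r) (h : Plane → ℝ) {A : Set Plane} (hA : MeasurableSet A) :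
    ∫ x in sim a r R ⁻¹' A, h (sim a r R x) = (r ^ 2)⁻¹ * ∫ x in A, h x := by
  rw [← integral_indicator hA, ← integral_comp_sim hr (a := a) (R := R), ← integral_indicator
    ((contDiff_sim (n := 0)).continuous.measurable hA)]
  rfl

end Sim

/-- The reflection of the coordinates `i` with `σ i = true`. -/
noncomputable def reflect (σ : Fin 2 → Bool) : Plane ≃ₗᵢ[ℝ] Plane :=
  LinearIsometryEquiv.piLpCongrRight 2 fun i =>
    if σ i then LinearIsometryEquiv.neg ℝ else LinearIsometryEquiv.refl ℝ ℝ

theorem reflect_apply (σ : Fin 2 → Bool) (x : Plane) (i : Fin 2) :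
    reflect σ x i = if σ i then - x i else x i := by
  simp only [reflect, LinearIsometryEquiv.piLpCongrRight_apply]
  split_ifs <;> simp

theorem reflect_bas (σ : Fin 2 → Bool) (i : Fin 2) :
    reflect σ (bas i) = (if σ i then (-1 : ℝ) else 1) • bas i := by
  ext j
  rw [reflect_apply]
  fin_cases i <;> fin_cases j <;> simp [bas] <;> split_ifs <;> simp

theorem isTestOn_repW : IsTestOn {x | ∀ i, x i ∈ Icc (1 / 2 : ℝ) 1} repW := by
  have hcl : IsClosed {x : Plane | ∀ i, x i ∈ Icc (1 / 2 : ℝ) 1} := by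
    simp only [Set.ofPred_forall]
    exact isClosed_iInter fun i =>
      isClosed_Icc.preimage (by fun_prop : Continuous fun x : Plane => x i)
  have hsub : tsupport repW ⊆ {x : Plane | ∀ i, x i ∈ Icc (1 / 2 : ℝ) 1} := by
    refine closure_minimal (fun x hx => ?_) hcl
    by_contra h
    simp only [mem_ofPred_eq, not_forall] at h
    exact hx (repW_eq_zero h)
  refine ⟨smooth_repW, (isCompact_csq ctr (1 / 2)).of_isClosed_subset (isClosed_tsupport _)
    fun x hx => ?_, hsub⟩
  rw [mem_csq_ctr]
  exact fun i => ⟨by linarith [(hsub hx i).1], (hsub hx i).2⟩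

/-- The quadrant-wise embedding of smooth functions with small Hessian into bounded functions. -/
theorem exists_abs_sub_integral_le_capBall : ∃ C : ℝ, 0 < C ∧ ∀ r : ℝ, 0 < r → r ≤ 1 / 4 →
    ∃ L : ℝ, 0 < L ∧ ∀ p ∈ unitSquare, ∃ ψ : Plane → ℝ, IsTestOn (csq ctr (1 / 2 - r / 2)) ψ ∧
      (∀ x, |ψ x| ≤ L) ∧ (∀ x y, |ψ x - ψ y| ≤ L * ‖x - y‖) ∧
      ∀ u : Plane → ℝ, Smooth u → |u p - ∫ x, ψ x * u x|
        ≤ C * ∑ i, ∑ j, ∫ x in (capBall unitSquare p (2 * r) : Set Plane),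
          |dd (bas i) (dd (bas j) u) x| := by
  obtain ⟨C, hC0, hC⟩ := exists_abs_sub_integral_le
  refine ⟨C, hC0, fun r hr hr4 => ?_⟩
  obtain ⟨M, hM⟩ := isTestOn_repW.continuous.bounded_above_of_compact_support isTestOn_repW.compact
  obtain ⟨N, hN⟩ := ContDiff.lipschitzWith_of_hasCompactSupport isTestOn_repW.compact
    isTestOn_repW.smooth (by simp)
  have hM0 : 0 ≤ M := (norm_nonneg _).trans (hM 0)
  have hL1 : (r ^ 2)⁻¹ * M ≤ (r ^ 2)⁻¹ * (M + N * r⁻¹ + 1) := by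
    have : 0 ≤ N * r⁻¹ := by positivity
    gcongr
    linarith
  have hL2 : (r ^ 2)⁻¹ * (N * r⁻¹) ≤ (r ^ 2)⁻¹ * (M + N * r⁻¹ + 1) := by
    gcongr
    linarith
  refine ⟨(r ^ 2)⁻¹ * (M + N * r⁻¹ + 1), by positivity, fun p hp => ?_⟩
  -- Reflections point the small square with corner `p` towards the interior. Its weight, supported
  -- in the far part of it, then stays at distance at least `r / 2` from the boundary, even when `p`
  -- is close to the boundary.
  set σ : Fin 2 → Bool := fun i => decide (1 / 2 < p i) with hσ
  set R := reflect σ with hR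
  set b := -(r⁻¹ • R.symm p) with hb
  have hr' : 0 < r⁻¹ := inv_pos.2 hr
  have hcoord : ∀ x i, sim p r R x i = if 1 / 2 < p i then p i - r * x i else p i + r * x i := by
    intro x i
    simp only [sim, PiLp.add_apply, PiLp.smul_apply, hR, reflect_apply, hσ, decide_eq_true_eq]
    split_ifs <;> simp [sub_eq_add_neg]
  have hQ : ∀ x ∈ csq ctr (1 / 2), sim p r R x ∈ (capBall unitSquare p (2 * r) : Set Plane) := by
    intro x hx
    rw [mem_csq_ctr] at hx
    refine ⟨fun i => ?_, ?_⟩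
    · rw [hcoord]
      have h1 := hp i
      have h2 := hx i
      have h3 : 0 ≤ r * x i := mul_nonneg hr.le h2.1
      have h4 : r * x i ≤ r := by nlinarith [h2.2]
      split_ifs with h
      · exact ⟨by linarith, by linarith [h1.2]⟩
      · exact ⟨by linarith [h1.1], by linarith⟩
    · rw [mem_ball_iff_norm, sim, add_sub_cancel_left, norm_smul, LinearIsometryEquiv.norm_map,
        Real.norm_eq_abs, abs_of_pos hr, mul_comm]
      refine mul_lt_mul_of_pos_right ?_ hr
      rw [EuclideanSpace.norm_eq, Real.sqrt_lt' two_pos, Fin.sum_univ_two]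
      have h2 : ∀ i, ‖x i‖ ^ 2 ≤ 1 := fun i => by
        rw [Real.norm_eq_abs, sq_abs]; nlinarith [(hx i).1, (hx i).2]
      linarith [h2 0, h2 1]
  have htest : IsTestOn (sim b r⁻¹ R.symm ⁻¹' {x | ∀ i, x i ∈ Icc (1 / 2 : ℝ) 1})
      fun y => repW (sim b r⁻¹ R.symm y) := isTestOn_repW.comp_sim hr'.ne'
  refine ⟨fun y => (r ^ 2)⁻¹ * repW (sim b r⁻¹ R.symm y), (htest.const_mul _).mono ?_, ?_, ?_, ?_⟩
  · intro y hy
    change supDist _ _ ≤ _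
    rw [supDist_le_iff]
    intro i
    have h1 := hcoord (sim b r⁻¹ R.symm y) i
    rw [hb, sim_sim_symm hr.ne', ← hb] at h1
    have h2 := hy i
    have h3 := hp i
    have h4 : r / 2 ≤ r * sim b r⁻¹ R.symm y i := by nlinarith [h2.1]
    have h5 : r * sim b r⁻¹ R.symm y i ≤ r := by nlinarith [h2.2]
    rw [h1, abs_le]
    simp only [ctr]
    split_ifs with h
    · exact ⟨by linarith, by linarith [h3.2]⟩
    · exact ⟨by linarith [h3.1], by linarith⟩
  · intro y
    rw [abs_mul, abs_of_pos (by positivity)]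
    refine le_trans ?_ hL1
    gcongr
    exact hM _
  · intro x y
    have h1 := hN.dist_le_mul (sim b r⁻¹ R.symm x) (sim b r⁻¹ R.symm y)
    rw [dist_eq_norm, dist_eq_norm, sim, sim, add_sub_add_left_eq_sub, ← smul_sub, ← map_sub,
      norm_smul, LinearIsometryEquiv.norm_map, Real.norm_eq_abs, Real.norm_eq_abs,
      abs_of_pos hr', ← mul_assoc] at h1
    rw [← mul_sub, abs_mul, abs_of_pos (by positivity)]
    calc _ ≤ (r ^ 2)⁻¹ * (N * r⁻¹ * ‖x - y‖) := by gcongr; exact h1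
      _ = ((r ^ 2)⁻¹ * (N * r⁻¹)) * ‖x - y‖ := by ring
      _ ≤ _ := by gcongr
  · intro u hu
    have h1 := hC _ (hu.comp_sim (a := p) (r := r) (R := R))
    have h2 : ∫ x, (r ^ 2)⁻¹ * repW (sim b r⁻¹ R.symm x) * u x
        = ∫ x, repW x * u (sim p r R x) := by
      have := integral_comp_sim (a := p) (R := R) hr
        fun y => repW (sim b r⁻¹ R.symm y) * u y
      simp only [hb, sim_symm_sim hr.ne'] at this
      rw [this, ← integral_const_mul, hb]
      simp only [mul_assoc]
    have h3 : sim p r R 0 = p := by simp [sim]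
    beta_reduce at h1
    rw [h3, ← h2] at h1
    refine h1.trans (mul_le_mul_of_nonneg_left ?_ hC0.le)
    refine Finset.sum_le_sum fun i _ => Finset.sum_le_sum fun j _ => ?_
    -- Two derivatives produce `r²`, which cancels the planar Jacobian `r⁻²`. This is why `C` does
    -- not depend on `r`.
    have h4 : ∀ x, |dd (bas i) (dd (bas j) fun x => u (sim p r R x)) x|
        = r ^ 2 * |dd (bas i) (dd (bas j) u) (sim p r R x)| := by
      intro x
      rw [dd_comp_sim hu, dd_comp_sim (hu.dd _), hR, reflect_bas, reflect_bas, smul_smul, smul_smul]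
      simp only [dd_vec_smul]
      rw [dd_const_mul (hu.dd _)]
      beta_reduce
      rw [abs_mul _ (_ * _), abs_mul _ (dd _ _ _)]
      have : ∀ i, |r * (if σ i then (-1 : ℝ) else 1)| = r := fun i => by
        split_ifs <;> simp [abs_of_pos hr]
      rw [this, this]
      ring
    simp only [h4]
    rw [integral_const_mul]
    have h5 : csq ctr (1 / 2) = sim p r R ⁻¹' (sim b r⁻¹ R.symm ⁻¹' csq ctr (1 / 2)) := by
      ext x
      simp only [mem_preimage, hb, sim_symm_sim hr.ne']
    have h6 : MeasurableSet (sim b r⁻¹ R.symm ⁻¹' csq ctr (1 / 2)) :=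
      (contDiff_sim (n := 0)).continuous.measurable (isClosed_csq _ _).measurableSet
    rw [h5, setIntegral_comp_sim hr (fun y => |dd (bas i) (dd (bas j) u) y|) h6, ← mul_assoc,
      mul_inv_cancel₀ (by positivity), one_mul]
    refine setIntegral_mono_set ?_ (ae_of_all _ fun x => abs_nonneg _) (Eventually.of_forall ?_)
    · refine (((hu.dd _).dd _).continuous.abs.continuousOn.integrableOn_compact
        (isCompact_csq ctr (1 / 2))).mono_set ?_
      refine inter_subset_left.trans ?_
      rw [unitSquare_eq]
      exact sq_subset_csq
    · intro y hy
      have := hQ _ hy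
      rwa [hb, sim_sim_symm hr.ne'] at this

end HTV

/-! ### The variation controls the second derivatives of smooth functions in mean. -/

namespace HTV

/-- The test field has a single nonzero entry, a cutoff times the smooth sign `v / √(v² + δ²)` of
the derivative `v`. Its product with `v` is nonnegative and at least `|v| - δ`. -/
theorem setIntegral_sub_le_of_isCompact {U : Opens Plane} {u : Plane → ℝ} (hu : Smooth u)
    (hfin : hessianSchattenVariation 1 u U ≠ ∞) {L : Set Plane} (hL : IsCompact L)
    (hLU : L ⊆ U) {δ : ℝ} (hδ : 0 < δ) (i j : Fin 2) :
    (∫ x in L, |dd (bas i) (dd (bas j) u) x|) - δ * volume.real L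
      ≤ (hessianSchattenVariation 1 u U).toReal := by
  obtain ⟨χ, hχ, hχ0, hχ1, -, hχe⟩ := exists_cutoff hL U.isOpen hLU
  set v := dd (bas i) (dd (bas j) u) with hv
  have hvs : Smooth v := (hu.dd _).dd _
  have hpos : ∀ x, 0 < v x ^ 2 + δ ^ 2 := fun x => by positivity
  set w : Plane → ℝ := fun x => v x / √(v x ^ 2 + δ ^ 2) with hw
  have hws : Smooth w := hvs.div (((hvs.pow 2).add contDiff_const).sqrt fun x => (hpos x).ne')
    fun x => (Real.sqrt_pos.2 (hpos x)).ne'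
  have hsq : ∀ x, |v x| ≤ √(v x ^ 2 + δ ^ 2) := fun x =>
    Real.abs_le_sqrt (by nlinarith)
  have hw1 : ∀ x, |w x| ≤ 1 := fun x => by
    rw [hw, abs_div, abs_of_pos (Real.sqrt_pos.2 (hpos x))]
    exact div_le_one_of_le₀ (hsq x) (Real.sqrt_nonneg _)
  have hvw : ∀ x, |v x| - δ ≤ v x * w x := fun x => by
    have h1 : √(v x ^ 2 + δ ^ 2) ≤ |v x| + δ := by
      rw [Real.sqrt_le_left (by positivity), ← sq_abs (v x)]
      nlinarith [abs_nonneg (v x)]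
    have h2 := Real.sqrt_pos.2 (hpos x)
    have h3 : v x * w x = v x ^ 2 / √(v x ^ 2 + δ ^ 2) := by simp only [hw]; ring
    rw [h3, le_div_iff₀ h2]
    have h4 := sq_abs (v x)
    rcases le_total (|v x|) δ with h | h
    · exact (mul_nonpos_of_nonpos_of_nonneg (by linarith) h2.le).trans (sq_nonneg _)
    · nlinarith [mul_le_mul_of_nonneg_left h1 (show 0 ≤ |v x| - δ by linarith)]
  have hvw0 : ∀ x, 0 ≤ v x * w x := fun x => by
    have h3 : v x * w x = v x ^ 2 / √(v x ^ 2 + δ ^ 2) := by simp only [hw]; ring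
    rw [h3]; positivity
  have hψ : IsTestOn (U : Set Plane) fun x => χ x * w x := hχ.mul_right hws
  set F : Fin 2 → Fin 2 → Plane → ℝ := fun i' j' x => if i' = i ∧ j' = j then χ x * w x else 0
    with hF
  have hadm : Adm U F := by
    refine ⟨fun i' j' => ?_, fun x => (OpLe.of_abs_entry i j _).mono ?_⟩
    · by_cases h : i' = i ∧ j' = j
      · simpa only [hF, if_pos h] using hψ
      · simpa only [hF, if_neg h] using IsTestOn.zero
    · rw [abs_mul, abs_of_nonneg (hχ0 x)]
      nlinarith [hχ1 x, hw1 x, hχ0 x, abs_nonneg (w x)]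
  have h1 := pr_le_toReal hfin hadm
  rw [pr_smooth hu hadm.1] at h1
  refine le_trans ?_ h1
  have h2 : ∀ x, ∑ i', ∑ j', dd (bas i') (dd (bas j') u) x * F i' j' x = v x * (χ x * w x) := by
    intro x
    simp only [hF, ite_and, mul_ite, mul_zero, Finset.sum_ite_irrel, Finset.sum_const_zero,
      Finset.sum_ite_eq', Finset.mem_univ, if_true, hv]
  simp only [h2]
  have hI : Integrable fun x => v x * (χ x * w x) := hψ.integrable_mul_cont hvs.continuous
  have hIL : IntegrableOn (fun x => |v x|) L := hvs.continuous.abs.continuousOn.integrableOn_compact hL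
  calc (∫ x in L, |v x|) - δ * volume.real L = ∫ x in L, (|v x| - δ) := by
        rw [integral_sub hIL (integrableOn_const hL.measure_lt_top.ne), setIntegral_const,
          smul_eq_mul, mul_comm]
    _ ≤ ∫ x in L, v x * (χ x * w x) := by
        refine setIntegral_mono_on (hIL.sub (integrableOn_const hL.measure_lt_top.ne))
          hI.integrableOn hL.measurableSet fun x hx => ?_
        rw [hχe x hx, one_mul]
        exact hvw x
    _ ≤ ∫ x, v x * (χ x * w x) := by
        refine setIntegral_le_integral hI (ae_of_all _ fun x => ?_)
        have := mul_nonneg (hχ0 x) (hvw0 x)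
        simp only [Pi.zero_apply]
        linarith

/-- The entries of the Hessian of a smooth function are controlled in `L¹`. -/
theorem setIntegral_abs_dd_dd_le {U : Opens Plane} {K : Set Plane} (hK : IsCompact K)
    (hUK : (U : Set Plane) ⊆ K) {u : Plane → ℝ} (hu : Smooth u)
    (hfin : hessianSchattenVariation 1 u U ≠ ∞) (i j : Fin 2) :
    ∫ x in (U : Set Plane), |dd (bas i) (dd (bas j) u) x|
      ≤ (hessianSchattenVariation 1 u U).toReal := by
  have hvc : Continuous fun x => |dd (bas i) (dd (bas j) u) x| := ((hu.dd _).dd _).continuous.abs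
  obtain ⟨M, hM⟩ := hK.exists_bound_of_continuousOn hvc.continuousOn
  have hUfin : volume (U : Set Plane) ≠ ∞ := ((measure_mono hUK).trans_lt hK.measure_lt_top).ne
  have hI : IntegrableOn (fun x => |dd (bas i) (dd (bas j) u) x|) (U : Set Plane) :=
    (hvc.continuousOn.integrableOn_compact hK).mono_set hUK
  set V := volume.real (U : Set Plane) with hV
  have hV0 : 0 ≤ V := measureReal_nonneg
  refine le_of_forall_pos_le_add fun ε hε => ?_
  set η := ε / (|M| + V + 1) with hη
  have hden : 0 < |M| + V + 1 := by positivity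
  have hη0 : 0 < η := by positivity
  -- Inner regularity: outside `L` the integrand is bounded by `|M|` on a set of measure below `η`.
  -- The two errors `η V` and `|M| η` fit into `ε`.
  obtain ⟨L, hLU, hL, hLd⟩ := U.isOpen.measurableSet.exists_isCompact_sdiff_lt hUfin
    (ENNReal.ofReal_pos.2 hη0).ne'
  have h1 := setIntegral_sub_le_of_isCompact hu hfin hL hLU hη0 i j
  have h2 : volume.real L ≤ V := measureReal_mono hLU hUfin
  have h3 : ∫ x in (U : Set Plane), |dd (bas i) (dd (bas j) u) x|
      = (∫ x in L, |dd (bas i) (dd (bas j) u) x|)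
        + ∫ x in (U : Set Plane) \ L, |dd (bas i) (dd (bas j) u) x| := by
    rw [← setIntegral_union disjoint_sdiff_right (MeasurableSet.diff U.isOpen.measurableSet hL.measurableSet)
      (hI.mono_set hLU) (hI.mono_set sdiff_subset), union_sdiff_cancel hLU]
  have h4 : ∫ x in (U : Set Plane) \ L, |dd (bas i) (dd (bas j) u) x| ≤ |M| * η := by
    have h5 := norm_setIntegral_le_of_norm_le_const (μ := volume) (s := (U : Set Plane) \ L)
      (C := |M|) (f := fun x => |dd (bas i) (dd (bas j) u) x|)
      (hLd.trans ENNReal.ofReal_lt_top) fun x hx => (hM x (hUK hx.1)).trans (le_abs_self M)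
    refine (le_abs_self _).trans (h5.trans (mul_le_mul_of_nonneg_left ?_ (abs_nonneg _)))
    exact ENNReal.toReal_le_of_le_ofReal hη0.le hLd.le
  have h6 : (|M| + V + 1) * η = ε := by rw [hη]; field_simp
  nlinarith [mul_le_mul_of_nonneg_left h2 hη0.le]

end HTV

/-! ### Behaviour of the variation under convolution and under scaling. -/

namespace HTV

section Moll

variable {s : ℝ} {ρ : Plane → ℝ} {A B : Set Plane}

/-- Fubini together with the symmetry of the kernel: convolution with `ρ` is self-adjoint. -/
theorem integral_moll_mul (hρ : IsMollifier s ρ) {g ψ : Plane → ℝ} (hg : Integrable g)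
    (hψ : IsTestOn A ψ) : ∫ x, moll ρ g x * ψ x = ∫ y, g y * moll ρ ψ y := by
  obtain ⟨M, hM⟩ := hψ.continuous.bounded_above_of_compact_support hψ.compact
  have h1 : Integrable (fun p : Plane × Plane => ρ p.2 * g (p.1 - p.2) * ψ p.1) :=
    (hρ.test.integrable.convolution_integrand (ContinuousLinearMap.lsmul ℝ ℝ) hg).mul_bdd (c := M)
      (hψ.continuous.comp continuous_fst).aestronglyMeasurable (ae_of_all _ fun p => hM _)
  have h2 : Integrable (fun p : Plane × Plane => g p.1 * ρ p.2 * ψ (p.1 + p.2)) :=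
    (hg.mul_prod hρ.test.integrable).mul_bdd (c := M)
      (hψ.continuous.comp (continuous_fst.add continuous_snd)).aestronglyMeasurable
      (ae_of_all _ fun p => hM _)
  calc ∫ x, moll ρ g x * ψ x = ∫ x, ∫ t, ρ t * g (x - t) * ψ x := by
        simp only [moll_apply, integral_mul_const]
    _ = ∫ t, ∫ x, ρ t * g (x - t) * ψ x := integral_integral_swap h1
    _ = ∫ t, ∫ y, g y * ρ t * ψ (y + t) := by
        congr 1
        funext t
        rw [← integral_sub_right_eq_self (fun y => g y * ρ t * ψ (y + t)) t]
        congr 1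
        funext x
        rw [sub_add_cancel]
        ring
    _ = ∫ y, ∫ t, g y * ρ t * ψ (y + t) := (integral_integral_swap h2).symm
    _ = ∫ y, g y * moll ρ ψ y := by
        congr 1
        funext y
        rw [moll_apply, ← integral_const_mul, ← integral_neg_eq_self]
        congr 1
        funext t
        rw [hρ.symm, ← sub_eq_add_neg, mul_assoc]

theorem dd_moll (hρ : IsMollifier s ρ) {ψ : Plane → ℝ} (hψ : IsTestOn A ψ) (e : Plane) :
    dd e (moll ρ ψ) = moll ρ (dd e ψ) := by
  funext x
  have h := hψ.compact.hasFDerivAt_convolution_right (ContinuousLinearMap.lsmul ℝ ℝ)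
    (hρ.test.integrable.locallyIntegrable (μ := volume)) (hψ.smooth.of_le (by simp)) x
  simp only [dd]
  rw [show moll ρ ψ = convolution ρ ψ (ContinuousLinearMap.lsmul ℝ ℝ) volume from rfl, h.fderiv]
  exact convolution_precompR_apply _ hρ.test.integrable.locallyIntegrable (hψ.compact.fderiv ℝ)
    (hψ.smooth.continuous_fderiv (by simp)) _ _

open scoped Pointwise in
theorem IsMollifier.isTestOn_moll (hρ : IsMollifier s ρ) {ψ : Plane → ℝ} (hψ : IsTestOn A ψ)
    (hAB : ∀ x ∈ A, ∀ y, dist y x < s → y ∈ B) : IsTestOn B (moll ρ ψ) := by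
  refine ⟨hρ.smooth_moll hψ.continuous.locallyIntegrable, hρ.test.compact.convolution _ hψ.compact,
    ?_⟩
  have h1 : tsupport (moll ρ ψ) ⊆ tsupport ρ + tsupport ψ := by
    refine closure_minimal ((support_convolution_subset _).trans
      (add_subset_add (subset_tsupport _) (subset_tsupport _))) ?_
    exact (IsCompact.add hρ.test.compact hψ.compact).isClosed
  refine h1.trans ?_
  rintro _ ⟨t, ht, x, hx, rfl⟩
  refine hAB x (hψ.supp hx) _ ?_
  have := hρ.test.supp ht
  rw [mem_ball_zero_iff] at this
  simpa [dist_eq_norm] using this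

theorem ddiv_moll (hρ : IsMollifier s ρ) {F : Fin 2 → Fin 2 → Plane → ℝ} (hF : IsField A F) :
    ddiv (fun i j => moll ρ (F i j)) = moll ρ (ddiv F) := by
  funext x
  have hI : ∀ i j, Integrable fun t => ρ t * dd (bas i) (dd (bas j) (F i j)) (x - t) := fun i j =>
    hρ.test.integrable_mul_cont ((((hF i j).dd _).dd _).continuous.comp
      (continuous_const.sub continuous_id)) |>.congr (ae_of_all _ fun t => mul_comm _ _)
  simp only [ddiv, dd_moll hρ (hF _ _), dd_moll hρ ((hF _ _).dd _), moll_apply, Finset.mul_sum]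
  rw [integral_finsetSum _ fun i _ => integrable_finsetSum _ fun j _ => hI i j]
  exact Finset.sum_congr rfl fun i _ => (integral_finsetSum _ fun j _ => hI i j).symm

/-- The operator bound is a family of linear inequalities in the matrix, so it is preserved by
averaging against a probability density. -/
theorem Adm.moll (hρ : IsMollifier s ρ) {F : Fin 2 → Fin 2 → Plane → ℝ} (hF : Adm A F)
    (hAB : ∀ x ∈ A, ∀ y, dist y x < s → y ∈ B) : Adm B fun i j => moll ρ (F i j) := by
  refine ⟨fun i j => hρ.isTestOn_moll (hF.1 i j) hAB, fun x v w => ?_⟩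
  have hI : ∀ i j, Integrable fun t => ρ t * F i j (x - t) := fun i j =>
    hρ.test.integrable_mul_cont ((hF.1 i j).continuous.comp
      (continuous_const.sub continuous_id)) |>.congr (ae_of_all _ fun t => mul_comm _ _)
  have hI2 : ∀ i j, Integrable fun t => v i * (ρ t * F i j (x - t)) * w j := fun i j =>
    ((hI i j).const_mul _).mul_const _
  have h1 : ∑ i, ∑ j, v i * HTV.moll ρ (F i j) x * w j
      = ∫ t, ∑ i, ∑ j, v i * (ρ t * F i j (x - t)) * w j := by
    rw [integral_finsetSum _ fun i _ => integrable_finsetSum _ fun j _ => hI2 i j]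
    refine Finset.sum_congr rfl fun i _ => ?_
    rw [integral_finsetSum _ fun j _ => hI2 i j]
    refine Finset.sum_congr rfl fun j _ => ?_
    rw [integral_mul_const, integral_const_mul, moll_apply]
  have h2 : 1 * (‖v‖ * ‖w‖) = ∫ t, ρ t * (‖v‖ * ‖w‖) := by
    rw [integral_mul_const, hρ.integral_eq]
  rw [h1, h2]
  refine integral_mono (integrable_finsetSum _ fun i _ => integrable_finsetSum _ fun j _ => hI2 i j)
    (hρ.test.integrable.mul_const _) fun t => ?_
  have h3 := mul_le_mul_of_nonneg_left (hF.2 (x - t) v w) (hρ.nonneg t)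
  simp only [Fin.sum_univ_two] at h3 ⊢
  linarith

/-- The convolution is moved from the function to the test field, which remains admissible on a set
enlarged by `s`. -/
theorem hsv_moll_le (hρ : IsMollifier s ρ) {g : Plane → ℝ} (hg : Integrable g) {U V : Opens Plane}
    (hUV : ∀ x ∈ U, ∀ y, dist y x < s → y ∈ V) :
    hessianSchattenVariation 1 (moll ρ g) U ≤ hessianSchattenVariation 1 g V := by
  refine hsv_le fun F hF => ?_
  have h1 : pr (moll ρ g) F = pr g fun i j => moll ρ (F i j) := by
    rw [pr, pr, integral_moll_mul hρ hg hF.1.ddiv, ddiv_moll hρ hF.1]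
  rw [h1]
  exact le_hsv g (hF.moll hρ hUV)

end Moll

theorem hsv_congr {U : Opens Plane} {f g : Plane → ℝ} (h : ∀ x ∈ U, f x = g x) :
    hessianSchattenVariation 1 f U = hessianSchattenVariation 1 g U :=
  le_antisymm (hsv_le fun F hF => by rw [pr_congr hF.1 h]; exact le_hsv g hF)
    (hsv_le fun F hF => by rw [← pr_congr hF.1 h]; exact le_hsv f hF)

/-- Transporting the field by the inverse map divides its double divergence by `r²`, exactly the
Jacobian in dimension two, so the energy is scale invariant. -/
theorem hsv_comp_sim_le {a : Plane} {r : ℝ} (hr : 0 < r) {h : Plane → ℝ} {U V : Opens Plane}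
    (hUV : ∀ x ∈ U, sim a r (LinearIsometryEquiv.refl ℝ Plane) x ∈ V) :
    hessianSchattenVariation 1 (fun x => h (sim a r (LinearIsometryEquiv.refl ℝ Plane) x)) U
      ≤ hessianSchattenVariation 1 h V := by
  refine hsv_le fun F hF => ?_
  set I := LinearIsometryEquiv.refl ℝ Plane with hI
  set b : Plane := -(r⁻¹ • I.symm a) with hb
  have hr' : r⁻¹ ≠ 0 := (inv_pos.2 hr).ne'
  set G : Fin 2 → Fin 2 → Plane → ℝ := fun i j y => F i j (sim b r⁻¹ I.symm y) with hG
  have hGV : Adm V G := by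
    refine ⟨fun i j => ((hF.1 i j).comp_sim hr').mono fun y hy => ?_, fun y => hF.2 _⟩
    have := hUV _ hy
    rwa [hb, sim_sim_symm hr.ne'] at this
  have h1 : ∀ y, ddiv G y = (r ^ 2)⁻¹ * ddiv F (sim b r⁻¹ I.symm y) := by
    intro y
    simp only [ddiv, Finset.mul_sum]
    refine Finset.sum_congr rfl fun i _ => Finset.sum_congr rfl fun j _ => ?_
    simp only [hG]
    rw [dd_comp_sim (hF.1 i j).smooth, dd_comp_sim ((hF.1 i j).smooth.dd _)]
    have : ∀ e, I.symm e = e := fun e => rfl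
    simp only [this, dd_vec_smul]
    rw [dd_const_mul ((hF.1 i j).smooth.dd _)]
    field_simp
  have h2 : pr (fun x => h (sim a r I x)) F = pr h G := by
    have := integral_comp_sim (a := a) (R := I) hr fun y => h y * ddiv F (sim b r⁻¹ I.symm y)
    simp only [hb, sim_symm_sim hr.ne'] at this
    rw [pr, this, pr, ← integral_const_mul]
    congr 1
    funext y
    rw [h1]
    ring
  rw [h2]
  exact le_hsv h hGV

end HTV

/-! ### Regularization on the unit square and its uniform convergence. -/

namespace HTV

/-- The contraction of the unit square towards its centre. -/
noncomputable def dil (s : ℝ) (x : Plane) : Plane :=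
  sim ((4 * s) • ctr) (1 - 4 * s) (LinearIsometryEquiv.refl ℝ Plane) x

theorem dil_sub (s : ℝ) (x : Plane) (i : Fin 2) :
    dil s x i - ctr i = (1 - 4 * s) * (x i - ctr i) := by
  simp only [dil, sim, PiLp.add_apply, PiLp.smul_apply, smul_eq_mul, LinearIsometryEquiv.coe_refl,
    id]
  ring

theorem norm_dil_sub_self {s : ℝ} (hs : 0 ≤ s) (x : Plane) :
    ‖dil s x - x‖ = 4 * s * ‖x - ctr‖ := by
  have h : dil s x - x = -((4 * s) • (x - ctr)) := by
    ext i
    have := dil_sub s x i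
    simp only [PiLp.sub_apply, PiLp.neg_apply, PiLp.smul_apply, smul_eq_mul]
    linarith
  rw [h, norm_neg, norm_smul, Real.norm_eq_abs, abs_of_nonneg (by positivity)]

theorem norm_sub_ctr_le {x : Plane} (hx : x ∈ csq ctr (1 / 2)) : ‖x - ctr‖ ≤ 1 := by
  rw [EuclideanSpace.norm_eq, Real.sqrt_le_left zero_le_one, Fin.sum_univ_two]
  have h := supDist_le_iff.1 (show supDist ctr x ≤ 1 / 2 from hx)
  have h1 : ∀ i, ‖(x - ctr) i‖ ^ 2 ≤ 1 / 4 := fun i => by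
    rw [Real.norm_eq_abs, PiLp.sub_apply]
    nlinarith [h i, abs_nonneg (x i - ctr i)]
  linarith [h1 0, h1 1]

theorem csq_ctr_subset_unitSquare {r : ℝ} (hr : r < 1 / 2) : csq ctr r ⊆ unitSquare := by
  rw [unitSquare_eq]
  exact csq_subset_sq hr

/-- A regularization of a function on the unit square. -/
noncomputable def regularize (s : ℝ) (ρ f : Plane → ℝ) (x : Plane) : ℝ :=
  moll ρ ((csq ctr (1 / 2 - s)).indicator f) (dil s x)

section Regularize

variable {f : Plane → ℝ} {s : ℝ} {ρ : Plane → ℝ}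

theorem integrable_indicator_csq (hf : LocallyIntegrableOn f (unitSquare : Set Plane)) (hs : 0 < s) :
    Integrable ((csq ctr (1 / 2 - s)).indicator f) :=
  (integrable_indicator_iff (isClosed_csq _ _).measurableSet).2
    (hf.integrableOn_compact_subset (csq_ctr_subset_unitSquare (by linarith)) (isCompact_csq _ _))

theorem smooth_regularize (hf : LocallyIntegrableOn f (unitSquare : Set Plane)) (hs : 0 < s)
    (hρ : IsMollifier s ρ) : Smooth (regularize s ρ f) :=
  (hρ.smooth_moll (integrable_indicator_csq hf hs).locallyIntegrable).comp_sim

theorem supDist_dil (hs8 : s ≤ 1 / 8) {x : Plane} {r : ℝ} (hx : ∀ i, |x i - ctr i| < r) (i : Fin 2) :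
    |dil s x i - ctr i| < (1 - 4 * s) * r := by
  rw [dil_sub, abs_mul, abs_of_pos (by linarith)]
  exact mul_lt_mul_of_pos_left (hx i) (by linarith)

/-- The contraction sends the unit square to the concentric one of half-side `1/2 - 2s`.
Mollification at scale `s` then reads only values in the square of half-side `1/2 - s`, where the
truncation by the indicator is invisible. Points move by at most `4s` and the kernel adds `s`, hence
`5s`. -/
theorem hsv_regularize_le (hf : LocallyIntegrableOn f (unitSquare : Set Plane)) (hs : 0 < s)
    (hs8 : s ≤ 1 / 8) (hρ : IsMollifier s ρ) {U V : Opens Plane}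
    (hU : (U : Set Plane) ⊆ unitSquare)
    (hUV : ∀ x ∈ U, ∀ y ∈ unitSquare, dist y x < 5 * s → y ∈ V) :
    hessianSchattenVariation 1 (regularize s ρ f) U ≤ hessianSchattenVariation 1 f V := by
  have hr : 0 < 1 - 4 * s := by linarith
  set I := LinearIsometryEquiv.refl ℝ Plane
  set b : Plane := -((1 - 4 * s)⁻¹ • I.symm ((4 * s) • ctr)) with hb
  let W : Opens Plane := ⟨sim b (1 - 4 * s)⁻¹ I.symm ⁻¹' U,
    U.isOpen.preimage (contDiff_sim (n := 0)).continuous⟩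
  let W' : Opens Plane := ⟨V ∩ sq ctr (1 / 2 - s), V.isOpen.inter (isOpen_sq _ _)⟩
  have h1 : hessianSchattenVariation 1 (regularize s ρ f) U
      ≤ hessianSchattenVariation 1 (moll ρ ((csq ctr (1 / 2 - s)).indicator f)) W :=
    hsv_comp_sim_le hr fun x hx => by
      change sim b (1 - 4 * s)⁻¹ I.symm (sim ((4 * s) • ctr) (1 - 4 * s) I x) ∈ U
      rw [hb, sim_symm_sim hr.ne']
      exact hx
  have h2 : hessianSchattenVariation 1 (moll ρ ((csq ctr (1 / 2 - s)).indicator f)) W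
      ≤ hessianSchattenVariation 1 ((csq ctr (1 / 2 - s)).indicator f) W' := by
    refine hsv_moll_le hρ (integrable_indicator_csq hf hs) fun x hx y hy => ?_
    set z := sim b (1 - 4 * s)⁻¹ I.symm x with hz
    have hzU : z ∈ U := hx
    have hxz : x = dil s z := by
      rw [hz, hb]
      exact (sim_sim_symm hr.ne' x).symm
    have hzΩ := hU hzU
    rw [unitSquare_eq] at hzΩ
    have h3 := supDist_lt_iff.1 (show supDist ctr z < 1 / 2 from hzΩ)
    have h4 : y ∈ sq ctr (1 / 2 - s) := by
      change supDist ctr y < _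
      rw [supDist_lt_iff]
      intro i
      have h5 := supDist_dil hs8 h3 i
      rw [← hxz] at h5
      have h6 : |y i - x i| < s := by
        rw [dist_eq_norm] at hy
        exact (OpLe.abs_coord_le (y - x) i).trans_lt hy
      have h7 := abs_sub_le (y i) (x i) (ctr i)
      linarith
    refine ⟨hUV z hzU y ?_ ?_, h4⟩
    · exact csq_ctr_subset_unitSquare (r := 1 / 2 - s) (by linarith) (sq_subset_csq h4)
    · have h5 := norm_dil_sub_self hs.le z
      have h6 := norm_sub_ctr_le (sq_subset_csq hzΩ)
      rw [← hxz, ← dist_eq_norm] at h5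
      have h7 := dist_triangle y x z
      nlinarith
  have h3 : hessianSchattenVariation 1 ((csq ctr (1 / 2 - s)).indicator f) W'
      = hessianSchattenVariation 1 f W' := hsv_congr fun x hx =>
    indicator_of_mem (sq_subset_csq hx.2) f
  exact h1.trans (h2.trans (h3.le.trans (hsv_mono f inter_subset_left)))

/-- By adjunction the regularization acts on `ψ`, turning it into a function within `100 L s` of
`ψ`, supported away from the boundary. This needs only local integrability of `f`. The constant is
`4 · 17 + 32`: the displacement by dilation and kernel, and the Jacobian. -/
theorem abs_integral_mul_regularize_sub_le (hf : LocallyIntegrableOn f (unitSquare : Set Plane))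
    (hs : 0 < s) (hs8 : s ≤ 1 / 8) (hρ : IsMollifier s ρ) {r : ℝ} (hsr : s ≤ r / 4)
    {ψ : Plane → ℝ} (hψ : IsTestOn (csq ctr (1 / 2 - r / 2)) ψ) {L : ℝ} (hL : ∀ x, |ψ x| ≤ L)
    (hlip : ∀ x y, |ψ x - ψ y| ≤ L * ‖x - y‖) :
    |(∫ x, ψ x * regularize s ρ f x) - ∫ x, ψ x * f x|
      ≤ 100 * L * s * ∫ x in csq ctr (1 / 2 - r / 4), |f x| := by
  have hl : 0 < 1 - 4 * s := by linarith
  have hL0 : 0 ≤ L := (abs_nonneg _).trans (hL 0)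
  set l := 1 - 4 * s with hldef
  set I := LinearIsometryEquiv.refl ℝ Plane
  set a : Plane := (4 * s) • ctr with ha
  set b : Plane := -(l⁻¹ • I.symm a) with hb
  set K := csq ctr (1 / 2 - s) with hK
  set K' := csq ctr (1 / 2 - r / 4) with hK'
  have hK'K : K' ⊆ K := csq_mono (by linarith)
  have hKΩ : K ⊆ unitSquare := csq_ctr_subset_unitSquare (by linarith)
  have hIK : IntegrableOn f K' :=
    hf.integrableOn_compact_subset (hK'K.trans hKΩ) (isCompact_csq _ _)
  set φ : Plane → ℝ := fun y => ψ (sim b l⁻¹ I.symm y) with hφ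
  have hφt : IsTestOn (csq ctr (1 / 2 - r / 2)) φ := by
    refine (hψ.comp_sim (inv_pos.2 hl).ne').mono fun y hy => ?_
    set z := sim b l⁻¹ I.symm y with hz
    have hyz : y = dil s z := by
      rw [hz, hb]
      exact (sim_sim_symm hl.ne' y).symm
    have h1 := supDist_le_iff.1 (show supDist ctr z ≤ _ from hy)
    change supDist ctr y ≤ _
    rw [supDist_le_iff]
    intro i
    rw [hyz, dil_sub, abs_mul, abs_of_pos hl]
    have := h1 i
    nlinarith [abs_nonneg (z i - ctr i)]
  have hmt : IsTestOn K' (moll ρ φ) := by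
    refine hρ.isTestOn_moll hφt fun x hx y hy => ?_
    have h1 := supDist_le_iff.1 (show supDist ctr x ≤ _ from hx)
    change supDist ctr y ≤ _
    rw [supDist_le_iff]
    intro i
    have h6 : |y i - x i| < s := by
      rw [dist_eq_norm] at hy
      exact (OpLe.abs_coord_le (y - x) i).trans_lt hy
    have h7 := abs_sub_le (y i) (x i) (ctr i)
    linarith [h1 i]
  have hψK' : IsTestOn K' ψ := hψ.mono (csq_mono (by linarith))
  have e1 : ∫ x, ψ x * regularize s ρ f x = (l ^ 2)⁻¹ * ∫ y, f y * moll ρ φ y := by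
    have h1 := integral_comp_sim (a := a) (R := I) hl fun y => moll ρ (K.indicator f) y * φ y
    simp only [hφ, hb, sim_symm_sim hl.ne'] at h1
    have h2 : ∫ x, ψ x * regularize s ρ f x
        = ∫ x, moll ρ (K.indicator f) (sim a l I x) * ψ x := by
      congr 1; funext x; rw [mul_comm]; rfl
    rw [h2, h1]
    congr 1
    rw [← hb, integral_moll_mul hρ (integrable_indicator_csq hf hs) hφt]
    congr 1
    funext y
    by_cases hy : y ∈ K
    · rw [indicator_of_mem hy]
    · rw [hmt.eq_zero fun h => hy (hK'K h)]; simp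
  have hbound : ∀ y ∈ K', |(l ^ 2)⁻¹ * moll ρ φ y - ψ y| ≤ 100 * L * s := by
    intro y hy
    have h0 : |moll ρ φ y - ψ y| ≤ 17 * L * s := by
      refine hρ.abs_moll_sub_le hφt.continuous.aestronglyMeasurable (by positivity) fun y' hy' => ?_
      refine (hlip _ _).trans ?_
      set z := sim b l⁻¹ I.symm y' with hz
      have hyz : y' = dil s z := by
        rw [hz, hb]
        exact (sim_sim_symm hl.ne' y').symm
      have h1 := norm_dil_sub_self hs.le z
      rw [← hyz] at h1
      have h2 := norm_sub_ctr_le (csq_mono (by linarith) hy)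
      have h3 : ‖z - ctr‖ ≤ ‖y' - z‖ + ‖y' - y‖ + ‖y - ctr‖ := by
        have : z - ctr = -(y' - z) + (y' - y) + (y - ctr) := by abel
        rw [this]
        refine (norm_add₃_le).trans ?_
        rw [norm_neg]
      have h4 : ‖y' - y‖ < s := by rwa [mem_ball_iff_norm] at hy'
      have h5 : ‖z - y‖ ≤ ‖y' - z‖ + ‖y' - y‖ := by
        have : z - y = -(y' - z) + (y' - y) := by abel
        rw [this]
        refine (norm_add_le _ _).trans ?_
        rw [norm_neg]
      have h6 : ‖y' - z‖ ≤ 16 * s := by nlinarith [norm_nonneg (z - ctr), norm_nonneg (y' - z)]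
      have h7 : ‖z - y‖ ≤ 17 * s := by linarith
      nlinarith
    have h1 : (l ^ 2)⁻¹ * moll ρ φ y - ψ y
        = (l ^ 2)⁻¹ * (moll ρ φ y - ψ y) + ((l ^ 2)⁻¹ - 1) * ψ y := by ring
    have h2 : (l ^ 2)⁻¹ ≤ 4 := by
      rw [inv_le_comm₀ (by positivity) (by norm_num)]
      nlinarith
    have h3 : 1 ≤ (l ^ 2)⁻¹ := by
      rw [one_le_inv₀ (by positivity)]
      nlinarith
    have h4 : (l ^ 2)⁻¹ - 1 ≤ 32 * s := by
      have h5 : (l ^ 2)⁻¹ - 1 = (l ^ 2)⁻¹ * (1 - l ^ 2) := by field_simp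
      have h6 : 1 - l ^ 2 ≤ 8 * s := by nlinarith
      have h7 : 0 ≤ 1 - l ^ 2 := by nlinarith
      rw [h5]
      nlinarith
    rw [h1]
    refine (abs_add_le _ _).trans ?_
    rw [abs_mul, abs_mul, abs_of_nonneg (show 0 ≤ (l ^ 2)⁻¹ by positivity),
      abs_of_nonneg (show 0 ≤ (l ^ 2)⁻¹ - 1 by linarith)]
    have h5 : (l ^ 2)⁻¹ * |moll ρ φ y - ψ y| ≤ 4 * (17 * L * s) :=
      mul_le_mul h2 h0 (abs_nonneg _) (by norm_num)
    have h6 : ((l ^ 2)⁻¹ - 1) * |ψ y| ≤ (32 * s) * L :=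
      mul_le_mul h4 (hL y) (abs_nonneg _) (by positivity)
    linarith
  have i1 : Integrable fun y => f y * moll ρ φ y :=
    hmt.integrable_mul (hf.mono_set (hK'K.trans hKΩ))
  have i2 : Integrable fun y => f y * ψ y := hψK'.integrable_mul (hf.mono_set (hK'K.trans hKΩ))
  have e2 : (∫ x, ψ x * regularize s ρ f x) - ∫ x, ψ x * f x
      = ∫ y in K', f y * ((l ^ 2)⁻¹ * moll ρ φ y - ψ y) := by
    rw [e1, ← integral_const_mul, setIntegral_eq_integral_of_forall_compl_eq_zero]
    · simp only [mul_comm (ψ _)]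
      rw [← integral_sub (i1.const_mul _) i2]
      congr 1; funext y; ring
    · intro y hy
      rw [hmt.eq_zero hy, hψK'.eq_zero hy]
      simp
  rw [e2, ← integral_const_mul, ← Real.norm_eq_abs]
  refine norm_integral_le_of_norm_le (hIK.abs.const_mul _) ?_
  refine (ae_restrict_iff' (isClosed_csq _ _).measurableSet).2 (ae_of_all _ fun y hy => ?_)
  rw [Real.norm_eq_abs, abs_mul, mul_comm]
  exact mul_le_mul_of_nonneg_right (hbound y hy) (abs_nonneg _)

end Regularize

/-- The regularizations converge uniformly, in the sense of Cauchy. -/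
theorem exists_forall_abs_regularize_sub_le {f : Plane → ℝ}
    (hf : LocallyIntegrableOn f (unitSquare : Set Plane))
    (hfin : hessianSchattenVariation 1 f unitSquare ≠ ∞) {ε : ℝ} (hε : 0 < ε) :
    ∃ (P : Plane → ℝ) (s₀ : ℝ), 0 < s₀ ∧ ∀ s, 0 < s → s ≤ s₀ → ∀ ρ, IsMollifier s ρ →
      ∀ p ∈ unitSquare, |regularize s ρ f p - P p| ≤ ε := by
  obtain ⟨C, hC0, hC⟩ := exists_abs_sub_integral_le_capBall
  obtain ⟨r₀, hr₀, hball⟩ := exists_forall_hsv_capBall_le hf hfin (isCompact_csq ctr (1 / 2))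
    (show 0 < ε / (8 * C) by positivity)
  set r := min (1 / 4) (r₀ / 4) with hr
  have hr0 : 0 < r := by positivity
  have hr1 : r ≤ 1 / 4 := min_le_left _ _
  have hr2 : r ≤ r₀ / 4 := min_le_right _ _
  obtain ⟨L, hL0, hL⟩ := hC r hr0 hr1
  set Q := ∫ x in csq ctr (1 / 2 - r / 4), |f x| with hQ
  have hQ0 : 0 ≤ Q := integral_nonneg fun x => abs_nonneg _
  choose! ψ hψt hψb hψl hψ using hL
  -- The comparison function depends on `f` and `ε` but not on `s` or `ρ`. The radii satisfy `2r +
  -- 5s ≤ r₀`, so the energy of the regularization near `p` is controlled by that of `f` in the ball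
  -- of radius `r₀`. Half of `ε` goes to the four Hessian entries, half to the change of the
  -- weighted mean.
  refine ⟨fun p => ∫ x, ψ p x * f x, min (min (1 / 8) (r / 4)) (min (r₀ / 10) (ε / (200 * L * (Q + 1)))),
    by positivity, fun s hs hss ρ hρ p hp => ?_⟩
  have hs8 : s ≤ 1 / 8 := hss.trans ((min_le_left _ _).trans (min_le_left _ _))
  have hsr : s ≤ r / 4 := hss.trans ((min_le_left _ _).trans (min_le_right _ _))
  have hsr₀ : s ≤ r₀ / 10 := hss.trans ((min_le_right _ _).trans (min_le_left _ _))
  have hsε : s ≤ ε / (200 * L * (Q + 1)) := hss.trans ((min_le_right _ _).trans (min_le_right _ _))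
  have h1 := hψ p hp _ (smooth_regularize hf hs hρ)
  have h2 := abs_integral_mul_regularize_sub_le hf hs hs8 hρ hsr (hψt p hp) (hψb p hp) (hψl p hp)
  have h3 : 100 * L * s * Q ≤ ε / 2 := by
    have h4 := mul_le_mul_of_nonneg_left hsε (show 0 ≤ 100 * L * (Q + 1) by positivity)
    have h5 : 100 * L * (Q + 1) * (ε / (200 * L * (Q + 1))) = ε / 2 := by field_simp; norm_num
    have h6 : 0 ≤ 100 * L * s := by positivity
    nlinarith
  have hpΩ : p ∈ csq ctr (1 / 2) := by
    have : p ∈ (unitSquare : Set Plane) := hp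
    rw [unitSquare_eq] at this
    exact sq_subset_csq this
  have h4 : hessianSchattenVariation 1 (regularize s ρ f) (capBall unitSquare p (2 * r))
      ≤ ENNReal.ofReal (ε / (8 * C)) := by
    refine (hsv_regularize_le hf hs hs8 hρ inter_subset_left fun x hx y hy hxy => ?_).trans
      (hball p hpΩ)
    refine ⟨hy, ?_⟩
    have h5 : dist x p < 2 * r := hx.2
    have h6 := dist_triangle y x p
    rw [Metric.mem_ball]
    linarith
  have h5 : ∀ i j, ∫ x in (capBall unitSquare p (2 * r) : Set Plane),
      |dd (bas i) (dd (bas j) (regularize s ρ f)) x| ≤ ε / (8 * C) := fun i j =>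
    (setIntegral_abs_dd_dd_le (isCompact_csq ctr (1 / 2)) (inter_subset_left.trans (by
      rw [unitSquare_eq]; exact sq_subset_csq)) (smooth_regularize hf hs hρ)
      (ne_top_of_le_ne_top ENNReal.ofReal_ne_top h4) i j).trans
      (ENNReal.toReal_le_of_le_ofReal (by positivity) h4)
  have h6 : C * ∑ i : Fin 2, ∑ j : Fin 2, ∫ x in (capBall unitSquare p (2 * r) : Set Plane),
      |dd (bas i) (dd (bas j) (regularize s ρ f)) x| ≤ ε / 2 := by
    have h7 : ∑ i : Fin 2, ∑ j : Fin 2, ∫ x in (capBall unitSquare p (2 * r) : Set Plane),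
      |dd (bas i) (dd (bas j) (regularize s ρ f)) x| ≤ ∑ i : Fin 2, ∑ j : Fin 2, ε / (8 * C) :=
      Finset.sum_le_sum fun i _ => Finset.sum_le_sum fun j _ => h5 i j
    refine (mul_le_mul_of_nonneg_left h7 hC0.le).trans (le_of_eq ?_)
    simp
    field_simp
    norm_num
  have h7 := abs_sub_le (regularize s ρ f p) (∫ x, ψ p x * regularize s ρ f x) (∫ x, ψ p x * f x)
  linarith

theorem IsTestOn.exists_csq {ψ : Plane → ℝ} (h : IsTestOn (unitSquare : Set Plane) ψ) :
    ∃ r > 0, IsTestOn (csq ctr (1 / 2 - r / 2)) ψ := by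
  rcases (tsupport ψ).eq_empty_or_nonempty with h0 | h0
  · exact ⟨1, one_pos, h.smooth, h.compact, h0 ▸ empty_subset _⟩
  · obtain ⟨x, hx, hmax⟩ := h.compact.isCompact.exists_isMaxOn h0
      (continuous_supDist ctr).continuousOn
    have h1 := h.supp hx
    rw [unitSquare_eq] at h1
    have h2 : supDist ctr x < 1 / 2 := h1
    refine ⟨1 - 2 * supDist ctr x, by linarith, h.smooth, h.compact, fun y hy => ?_⟩
    have h3 : supDist ctr y ≤ supDist ctr x := hmax hy
    change supDist ctr y ≤ _
    linarith

theorem IsTestOn.exists_bound_lipschitz {A : Set Plane} {ψ : Plane → ℝ} (h : IsTestOn A ψ) :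
    ∃ L, (∀ x, |ψ x| ≤ L) ∧ ∀ x y, |ψ x - ψ y| ≤ L * ‖x - y‖ := by
  obtain ⟨M, hM⟩ := h.continuous.bounded_above_of_compact_support h.compact
  obtain ⟨N, hN⟩ := ContDiff.lipschitzWith_of_hasCompactSupport h.compact h.smooth (by simp)
  refine ⟨max M N, fun x => (hM x).trans (le_max_left _ _), fun x y => ?_⟩
  have h1 := hN.dist_le_mul x y
  rw [Real.dist_eq, dist_eq_norm] at h1
  exact h1.trans (mul_le_mul_of_nonneg_right (le_max_right _ _) (norm_nonneg _))

/-- Smooth approximation, uniform and with control of the energy. -/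
theorem exists_smooth_near {f : Plane → ℝ} (hf : LocallyIntegrableOn f (unitSquare : Set Plane))
    (hfin : hessianSchattenVariation 1 f unitSquare ≠ ∞) {δ : ℝ} (hδ : 0 < δ) :
    ∃ u : Plane → ℝ, Smooth u ∧
      (∀ᵐ x ∂(volume.restrict (unitSquare : Set Plane)), |u x - f x| ≤ δ) ∧
      hessianSchattenVariation 1 u unitSquare ≤ hessianSchattenVariation 1 f unitSquare := by
  set s : ℕ → ℝ := fun n => 1 / (n + 8) with hs
  have hs0 : ∀ n, 0 < s n := fun n => by positivity
  have hs8 : ∀ n, s n ≤ 1 / 8 := fun n => by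
    simp only [hs]; gcongr; linarith [n.cast_nonneg (α := ℝ)]
  have hst : Tendsto s atTop (𝓝 0) := by
    have := (tendsto_one_div_add_atTop_nhds_zero_nat (𝕜 := ℝ)).comp (tendsto_add_atTop_nat 7)
    refine this.congr fun n => ?_
    simp only [hs, Function.comp]
    push_cast
    ring
  choose ρ hρ using fun n => exists_mollifier (hs0 n)
  set u : ℕ → Plane → ℝ := fun n => regularize (s n) (ρ n) f with hu
  have hus : ∀ n, Smooth (u n) := fun n => smooth_regularize hf (hs0 n) (hρ n)
  have huE : ∀ n, hessianSchattenVariation 1 (u n) unitSquare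
      ≤ hessianSchattenVariation 1 f unitSquare := fun n =>
    hsv_regularize_le hf (hs0 n) (hs8 n) (hρ n) subset_rfl fun x _ y hy _ => hy
  have hnear : ∀ ε > 0, ∃ (P : Plane → ℝ) (N : ℕ), ∀ n ≥ N, ∀ p ∈ unitSquare, |u n p - P p| ≤ ε := by
    intro ε hε
    obtain ⟨P, s₀, hs₀, h⟩ := exists_forall_abs_regularize_sub_le hf hfin hε
    obtain ⟨N, hN⟩ := eventually_atTop.1 (hst.eventually (Iic_mem_nhds hs₀))
    exact ⟨P, N, fun n hn p hp => h _ (hs0 n) (hN n hn) _ (hρ n) p hp⟩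
  have hcauchy : UniformCauchySeqOn u atTop (unitSquare : Set Plane) := by
    rw [Metric.uniformCauchySeqOn_iff]
    intro ε hε
    obtain ⟨P, N, h⟩ := hnear (ε / 3) (by positivity)
    refine ⟨N, fun m hm n hn x hx => ?_⟩
    have h1 := h m hm x hx
    have h2 := h n hn x hx
    rw [abs_sub_comm] at h2
    have h3 := abs_sub_le (u m x) (P x) (u n x)
    rw [Real.dist_eq]
    linarith
  have hlim : ∀ x, ∃ a, x ∈ unitSquare → Tendsto (fun n => u n x) atTop (𝓝 a) := fun x => by
    by_cases hx : x ∈ unitSquare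
    · obtain ⟨a, ha⟩ := cauchySeq_tendsto_of_complete (hcauchy.cauchySeq hx)
      exact ⟨a, fun _ => ha⟩
    · exact ⟨0, fun h => absurd h hx⟩
  choose w hw using hlim
  have hunif : TendstoUniformlyOn u w atTop (unitSquare : Set Plane) :=
    hcauchy.tendstoUniformlyOn_of_tendsto fun x hx => hw x hx
  have hwc : ContinuousOn w (unitSquare : Set Plane) :=
    hunif.continuousOn (Frequently.of_forall fun n => (hus n).continuous.continuousOn)
  have hwl : LocallyIntegrableOn w (unitSquare : Set Plane) :=
    hwc.locallyIntegrableOn unitSquare.isOpen.measurableSet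
  -- The uniform limit `w` is identified with `f` as a distribution: tested with `ψ`, the
  -- regularizations converge both to `w` and to `f`.
  have hwf : ∀ᵐ x : Plane, x ∈ (unitSquare : Set Plane) → w x - f x = 0 := by
    refine unitSquare.isOpen.ae_eq_zero_of_integral_contDiff_smul_eq_zero (hwl.sub hf)
      fun ψ h1 h2 h3 => ?_
    have hψ : IsTestOn (unitSquare : Set Plane) ψ := ⟨h1, h2, h3⟩
    have iw := hψ.integrable_mul hwl
    have ifψ := hψ.integrable_mul hf
    have t1 : Tendsto (fun n => ∫ x, u n x * ψ x) atTop (𝓝 (∫ x, w x * ψ x)) := by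
      rw [Metric.tendsto_atTop]
      intro ε hε
      have hI0 : 0 ≤ ∫ x, |ψ x| := integral_nonneg fun x => abs_nonneg _
      set η := ε / ((∫ x, |ψ x|) + 1) with hη
      have hη0 : 0 < η := by positivity
      obtain ⟨N, hN⟩ := eventually_atTop.1 (Metric.tendstoUniformlyOn_iff.1 hunif η hη0)
      refine ⟨N, fun n hn => ?_⟩
      rw [dist_eq_norm, ← integral_sub (hψ.integrable_mul_cont (hus n).continuous) iw]
      refine (norm_integral_le_of_norm_le (hψ.integrable.abs.const_mul η)
        (ae_of_all _ fun x => ?_)).trans_lt ?_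
      · by_cases hx : x ∈ (unitSquare : Set Plane)
        · have h4 := hN n hn x hx
          rw [dist_comm, Real.dist_eq] at h4
          rw [← sub_mul, Real.norm_eq_abs, abs_mul]
          exact mul_le_mul_of_nonneg_right h4.le (abs_nonneg _)
        · simp [hψ.eq_zero hx]
      · rw [integral_const_mul]
        have h5 : η * ((∫ x, |ψ x|) + 1) = ε := by rw [hη]; field_simp
        linarith
    have t2 : Tendsto (fun n => ∫ x, u n x * ψ x) atTop (𝓝 (∫ x, f x * ψ x)) := by
      obtain ⟨r, hr, hψr⟩ := hψ.exists_csq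
      obtain ⟨L, hL, hlip⟩ := hψ.exists_bound_lipschitz
      have h4 : Tendsto (fun n => 100 * L * s n * ∫ x in csq ctr (1 / 2 - r / 4), |f x|) atTop
          (𝓝 0) := by
        simpa using (hst.const_mul (100 * L)).mul_const (∫ x in csq ctr (1 / 2 - r / 4), |f x|)
      rw [tendsto_iff_norm_sub_tendsto_zero]
      refine squeeze_zero' (Eventually.of_forall fun n => norm_nonneg _) ?_ h4
      filter_upwards [hst.eventually (Iic_mem_nhds (show 0 < r / 4 by positivity))] with n hn
      have h5 := abs_integral_mul_regularize_sub_le hf (hs0 n) (hs8 n) (hρ n) hn hψr hL hlip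
      simpa only [Real.norm_eq_abs, mul_comm (ψ _)] using h5
    have := tendsto_nhds_unique t1 t2
    simp only [smul_eq_mul, mul_comm (ψ _), sub_mul]
    rw [integral_sub iw ifψ, this, sub_self]
  obtain ⟨N, hN⟩ := eventually_atTop.1 (Metric.tendstoUniformlyOn_iff.1 hunif δ hδ)
  refine ⟨u N, hus N, (ae_restrict_iff' unitSquare.isOpen.measurableSet).2 ?_, huE N⟩
  filter_upwards [hwf] with x hx hxΩ
  have h1 := hN N le_rfl x hxΩ
  rw [dist_comm, Real.dist_eq] at h1
  rw [← sub_eq_zero.1 (hx hxΩ)]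
  exact h1.le

end HTV

/-! ### Combination of the two approximations and convergence of the energies. -/

namespace HTV

theorem exists_PL_near {f : Plane → ℝ} (hf : LocallyIntegrableOn f (unitSquare : Set Plane))
    (hfin : hessianSchattenVariation 1 f unitSquare ≠ ∞) {δ : ℝ} (hδ : 0 < δ) :
    ∃ g : Plane → ℝ, IsPL g ∧
      (∀ᵐ x ∂(volume.restrict (unitSquare : Set Plane)), |g x - f x| ≤ δ) ∧
      hessianSchattenVariation 1 g unitSquare
        ≤ hessianSchattenVariation 1 f unitSquare + ENNReal.ofReal δ := by
  obtain ⟨u, hu, huf, huE⟩ := exists_smooth_near hf hfin (half_pos hδ)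
  obtain ⟨g, hg, hgu, hgE⟩ := exists_PL_near_smooth hu (ne_top_of_le_ne_top hfin huE) (half_pos hδ)
  refine ⟨g, hg, ?_, hgE.trans (add_le_add huE (ENNReal.ofReal_le_ofReal (by linarith)))⟩
  filter_upwards [huf, ae_restrict_mem unitSquare.isOpen.measurableSet] with x hx hxΩ
  have := abs_sub_le (g x) (u x) (f x)
  linarith [hgu x hxΩ]

theorem IsTestOn.tendsto_integral_mul {A : Set Plane} (hA : MeasurableSet A) {f : Plane → ℝ}
    (hf : LocallyIntegrableOn f A) {g : ℕ → Plane → ℝ} (hg : ∀ n, LocallyIntegrableOn (g n) A)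
    {δ : ℕ → ℝ} (hδ : Tendsto δ atTop (𝓝 0))
    (hgf : ∀ n, ∀ᵐ x ∂(volume.restrict A), |g n x - f x| ≤ δ n) {φ : Plane → ℝ}
    (hφ : IsTestOn A φ) : Tendsto (fun n => ∫ x, g n x * φ x) atTop (𝓝 (∫ x, f x * φ x)) := by
  rw [tendsto_iff_norm_sub_tendsto_zero]
  refine squeeze_zero (fun n => norm_nonneg _) (fun n => ?_)
    (by simpa using hδ.mul_const (∫ x, |φ x|))
  rw [← integral_sub (hφ.integrable_mul (hg n)) (hφ.integrable_mul hf), ← integral_const_mul]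
  refine norm_integral_le_of_norm_le (hφ.integrable.abs.const_mul (δ n)) ?_
  filter_upwards [(ae_restrict_iff' hA).1 (hgf n)] with x hx
  by_cases hxA : x ∈ A
  · rw [← sub_mul, Real.norm_eq_abs, abs_mul]
    exact mul_le_mul_of_nonneg_right (hx hxA) (abs_nonneg _)
  · simp [hφ.eq_zero hxA]

/-- Lower semicontinuity together with an upper bound gives convergence of the energies. -/
theorem tendsto_hsv {U : Opens Plane} {f : Plane → ℝ} (hf : LocallyIntegrableOn f U)
    {g : ℕ → Plane → ℝ} (hg : ∀ n, LocallyIntegrableOn (g n) U) {δ : ℕ → ℝ}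
    (hδ : Tendsto δ atTop (𝓝 0))
    (hgf : ∀ n, ∀ᵐ x ∂(volume.restrict (U : Set Plane)), |g n x - f x| ≤ δ n)
    (hE : ∀ n, hessianSchattenVariation 1 (g n) U
      ≤ hessianSchattenVariation 1 f U + ENNReal.ofReal (δ n)) :
    Tendsto (fun n => hessianSchattenVariation 1 (g n) U) atTop
      (𝓝 (hessianSchattenVariation 1 f U)) := by
  have hup : Tendsto (fun n => hessianSchattenVariation 1 f U + ENNReal.ofReal (δ n)) atTop
      (𝓝 (hessianSchattenVariation 1 f U)) := by
    simpa using (ENNReal.tendsto_ofReal hδ).const_add (hessianSchattenVariation 1 f U)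
  refine tendsto_order.2 ⟨fun a ha => ?_, fun a ha => ?_⟩
  -- A single field already detects energy above `a` for `f`, and its pairing is continuous under
  -- uniform convergence.
  · obtain ⟨F, hF, haF⟩ : ∃ F, Adm U F ∧ a < ENNReal.ofReal (pr f F) := by
      by_contra! hcon
      exact not_le.2 ha (hsv_le hcon)
    have h1 : Tendsto (fun n => ENNReal.ofReal (pr (g n) F)) atTop (𝓝 (ENNReal.ofReal (pr f F))) :=
      ENNReal.tendsto_ofReal
        (hF.1.ddiv.tendsto_integral_mul U.isOpen.measurableSet hf hg hδ hgf)
    filter_upwards [h1.eventually (lt_mem_nhds haF)] with n hn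
    exact hn.trans_le (le_hsv _ hF)
  · filter_upwards [hup.eventually (gt_mem_nhds ha)] with n hn
    exact (hE n).trans_lt hn

theorem memLp_top_of_ae_near {f u : Plane → ℝ}
    (hf : LocallyIntegrableOn f (unitSquare : Set Plane)) (hu : Continuous u) {δ : ℝ}
    (huf : ∀ᵐ x ∂(volume.restrict (unitSquare : Set Plane)), |u x - f x| ≤ δ) :
    MemLp f ∞ (volume.restrict (unitSquare : Set Plane)) := by
  obtain ⟨M, hM⟩ := (isCompact_csq ctr (1 / 2)).exists_bound_of_continuousOn hu.continuousOn
  refine memLp_top_of_bound hf.aestronglyMeasurable (M + δ) ?_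
  filter_upwards [huf, ae_restrict_mem unitSquare.isOpen.measurableSet] with x hx hxΩ
  rw [unitSquare_eq] at hxΩ
  have h1 := hM x (sq_subset_csq hxΩ)
  have h2 := abs_sub_abs_le_abs_sub (f x) (u x)
  rw [abs_sub_comm] at h2
  rw [Real.norm_eq_abs] at h1 ⊢
  linarith

end HTV

/-- Every `f ∈ L¹_loc((0,1)²)` with bounded Hessian–Schatten variation (`p = 1`) is the limit in
`L^∞((0,1)²)` of CPWL functions whose Hessian–Schatten variations converge to that of `f`. -/
theorem theorem4p3 (f : EuclideanSpace ℝ (Fin 2) → ℝ)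
    (hf : HTV.HasBoundedHSV 1 f HTV.unitSquare) :
    MemLp f ∞ (volume.restrict (HTV.unitSquare : Set (EuclideanSpace ℝ (Fin 2)))) ∧
    ∃ g : ℕ → EuclideanSpace ℝ (Fin 2) → ℝ,
      (∀ k, HTV.IsCPWL (g k) HTV.unitSquare ∧
        MemLp (g k) ∞ (volume.restrict (HTV.unitSquare : Set (EuclideanSpace ℝ (Fin 2)))) ∧
        HTV.HasBoundedHSV 1 (g k) HTV.unitSquare) ∧
      Tendsto
        (fun k => eLpNorm (g k - f) ∞
          (volume.restrict (HTV.unitSquare : Set (EuclideanSpace ℝ (Fin 2)))))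
        atTop (𝓝 0) ∧
      Tendsto (fun k => HTV.hessianSchattenVariation 1 (g k) HTV.unitSquare) atTop
        (𝓝 (HTV.hessianSchattenVariation 1 f HTV.unitSquare)) := by
  have hδ : ∀ n : ℕ, (0 : ℝ) < 1 / ((n : ℝ) + 1) := fun n => by positivity
  have hδt := tendsto_one_div_add_atTop_nhds_zero_nat (𝕜 := ℝ)
  choose g hg hgf hgE using fun n => HTV.exists_PL_near hf.1 hf.2.ne (hδ n)
  have hgl : ∀ n, LocallyIntegrableOn (g n) (HTV.unitSquare : Set HTV.Plane) := fun n =>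
    (hg n).1.locallyIntegrable.locallyIntegrableOn _
  refine ⟨HTV.memLp_top_of_ae_near hf.1 (hg 0).1 (hgf 0), g, fun k =>
    ⟨(hg k).isCPWL _, HTV.memLp_top_of_ae_near (hgl k) (hg k).1 (δ := 0) (by simp),
      hgl k, (hgE k).trans_lt (ENNReal.add_lt_top.2 ⟨hf.2, ENNReal.ofReal_lt_top⟩)⟩, ?_,
    HTV.tendsto_hsv hf.1 hgl hδt hgf hgE⟩
  have hlim : Tendsto (fun n : ℕ => ENNReal.ofReal (1 / ((n : ℝ) + 1))) atTop (𝓝 0) := by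
    simpa using ENNReal.tendsto_ofReal hδt
  refine tendsto_of_tendsto_of_tendsto_of_le_of_le tendsto_const_nhds hlim (fun n => bot_le)
    fun n => ?_
  simp only [eLpNorm_exponent_top]
  exact eLpNormEssSup_le_of_ae_bound (f := g n - f) (hgf n)
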